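/- Let $M$ be a smooth manifold of dimension $n$ and let $\mathcal M=\Pi T^*M$ be the odd symplectic supermanifold of dimension $n|n$ whose structure sheaf is the sheaf of exterior algebras of the tangent bundle of $M$. A chart $y=(y^1,\dots,y^n)$ of $M$ gives coordinates $y^i|\theta_i$ on $\mathcal M$, where $\theta_i$ is the vector field $\partial/\partial y^i$ regarded as an odd function; for another chart $y'$ one has $\theta'_j=\sum_i \frac{\partial y^i}{\partial y'^j}\theta_i$. **Forms.** Superforms $\Omega^{\bullet|0}_{\mathcal M}$ are locally the supercommutative algebra over $C^\infty(M)$ generated by the odd $\theta_i, dy^i$ and the even $d\theta_i$, with $d=\sum_i dy^i\,\partial_{y^i}+\sum_i d\theta_i\,\partial_{\theta_i}$. For $0\le p\le n$, the forms $\Omega^{\bullet|p}_{\mathcal M}$ of picture $p$ are the left $\Omega^{\bullet|0}_{\mathcal M}$-module generated by symbols $\delta(u_1)\cdots\delta(u_p)$. Here $u_1,\dots,u_p$ are even superforms such that, modulo the ideal generated by the $\theta_i,dy^i$, each $u_k$ is a nonempty product of linear forms in the $d\theta_i$ (with coefficients in $C^\infty(M)$), and any $p$ linear forms obtained by choosing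 one factor of each $u_k$ are pointwise linearly independent. The relations are $$u_k\,\delta(u_1)\cdots\delta(u_p)=0,\qquad \delta(u_1)\cdots\delta(u_p)=\det H\cdot \delta(v_1)\cdots\delta(v_p)\quad\text{if } v=Hu,$$ for matrices $H$ of even superforms such that $v$ is again admitted, together with all consequences of these relations under $d$. The differential is $$d(\alpha\,\delta(u_1)\cdots\delta(u_p))=d\alpha\,\delta(u_1)\cdots\delta(u_p)-\sum_k du_k\,\alpha\,\delta(u_1)\cdots\delta(u_k^2)\cdots\delta(u_p).$$ Thus $\delta(\ell^{k+1})$ stands for $\tfrac{(-1)^k}{k!}\delta^{(k)}(\ell)$; one has $\delta(\lambda\ell)=\lambda^{-1}\delta(\ell)$ without absolute value, and the deltas anticommute. For $p=0$ these are the differential forms, for $p=n$ the integral forms, and for $0<p<n$ the pseudoforms. The odd symplectic form is $\omega=\sum_i dy^i\,d\theta_i$; it is the same in every chart. Multiplication by $\omega$ is a differential on $\Omega^{\bullet|p}_{\mathcal M}$ that anticommutes with $d$; let $E_1=H_\omega(\Omega^{\bullet|p}_{\mathcal M})$ be its cohomology sheaf (a sheaf of modules over $\mathcal O_{\mathcal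 M}$), and $E_2=H_dH_\omega(\Omega^{\bullet|p}_{\mathcal M})$ the cohomology sheaf of $E_1$ under the differential induced by $d$. For a chart $y$ and $0\le p\le n$ put $$\alpha_p^{y}=\sum_{i_1,\dots,i_n}\epsilon_{i_1\cdots i_n}\,dy^{i_1}\cdots dy^{i_{n-p}}\,\delta(d\theta_{i_{n-p+1}})\cdots\delta(d\theta_{i_n}).$$ **Theorem.** For every $p=0,\dots,n$ the following hold (on stalks at every point of $M$, for all charts around that point). 1. $\omega\,\alpha^y_p=0$, and $H_\omega(\Omega^{\bullet|p}_{\mathcal M})$ is free of rank one over $\mathcal O_{\mathcal M}$ on the domain of $y$, with basis the class $[\alpha_p^y]$. In particular $\bigoplus_{p=0}^n H_\omega(\Omega^{\bullet|p}_{\mathcal M})$ is free of rank $n+1$ there, with basis $[\alpha_0^y],\dots,[\alpha_n^y]$. 2. The class transforms as a semidensity: for any two charts $y,y'$, $$[\alpha_p^{y'}]=\det\!\Big(\frac{\partial y'}{\partial y}\Big)\,[\alpha_p^{y}],$$ and the Berezinian of the coordinate change $(y|\theta)\mapsto(y'|\theta')$ is $\det(\partial y'/\partial y)^2$. Consequently,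 let semidensities be the sections of the line bundle $\mathcal{B}er(\mathcal M)^{\otimes 1/2}\cong\det M$ with transition function $\det(\partial y'/\partial y)$, that is, the families of superfunctions $(s_y)$ indexed by charts with $s_y=s_{y'}\det(\partial y'/\partial y)$. Then there is an isomorphism of $\mathcal O_{\mathcal M}$-modules from the semidensities onto $H_\omega(\Omega^{\bullet|p}_{\mathcal M})$ that sends $s$ to $s_y[\alpha_p^y]$ for every chart $y$. 3. The differential induced by $d$ on $H_\omega(\Omega^{\bullet|p}_{\mathcal M})$ is zero. Hence $E_2=E_1$: the class in $E_2$ of an element $c$ of $E_1$ corresponds to $c$ itself. -/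

import Mathlib

open scoped Manifold ContDiff Topology TensorProduct

namespace OddSymplectic

section Algebra

/-- Polynomials in the even generators `dθ_1, …, dθ_n`. -/
abbrev Fibre (n : ℕ) : Type := MvPolynomial (Fin n) ℝ

/-- Superforms with constant coefficients: the Grassmann algebra over `ℝ[dθ_1, …, dθ_n]` on the odd
generators `θ_i` (index `inl i`) and `dx^i` (index `inr i`). -/
abbrev Grass (n : ℕ) : Type := ExteriorAlgebra (Fibre n) (Fin n ⊕ Fin n → Fibre n)

/-- Differential superforms in the coordinates `x^i | θ_i`, with coefficient ring `R` (functions of `x`):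
the supercommutative algebra `R[θ_i, dx^i | dθ_i]`, i.e. polynomial superfunctions on the total space of
`ΠT` of the supermanifold. `θ_i` and `dx^i` are odd, `dθ_i` is even. -/
abbrev SuperForm (n : ℕ) (R : Type*) [CommRing R] [Algebra ℝ R] : Type _ := R ⊗[ℝ] Grass n

variable {n : ℕ} {R : Type*} [CommRing R] [Algebra ℝ R]

/-- A function of `x`, as a superform. -/
noncomputable def func (f : R) : SuperForm n R := f ⊗ₜ[ℝ] 1

/-- The odd generators. -/
noncomputable def odd (v : Fin n ⊕ Fin n → Fibre n) : SuperForm n R :=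
  1 ⊗ₜ[ℝ] (ExteriorAlgebra.ι (Fibre n) v)

variable (R) in
/-- The odd coordinate `θ_i`. -/
noncomputable def theta (i : Fin n) : SuperForm n R := odd (Pi.single (Sum.inl i) 1)

variable (R) in
/-- The odd generator `dx^i`. -/
noncomputable def dx (i : Fin n) : SuperForm n R := odd (Pi.single (Sum.inr i) 1)

variable (R) in
/-- The even generator `dθ_i`. -/
noncomputable def dtheta (i : Fin n) : SuperForm n R :=
  1 ⊗ₜ[ℝ] (algebraMap (Fibre n) (Grass n) (MvPolynomial.X i))

/-- The parity involution, `a ↦ (-1)^{|a|} a`; `a` is even exactly when `parity a = a`. -/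
noncomputable def parity : SuperForm n R →ₐ[ℝ] SuperForm n R :=
  Algebra.TensorProduct.map (AlgHom.id ℝ R)
    ((CliffordAlgebra.involute (Q := (0 : QuadraticForm (Fibre n) (Fin n ⊕ Fin n → Fibre n)))).restrictScalars ℝ)

/-- Setting all odd generators to zero: superforms map to `R[dθ_1, …, dθ_n]`. -/
noncomputable def body : SuperForm n R →ₐ[ℝ] R ⊗[ℝ] Fibre n :=
  Algebra.TensorProduct.map (AlgHom.id ℝ R) (ExteriorAlgebra.algebraMapInv.restrictScalars ℝ)

/-- The left derivative `∂/∂θ_i`. -/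
noncomputable def dTheta (i : Fin n) : SuperForm n R →ₗ[ℝ] SuperForm n R :=
  LinearMap.lTensor R ((CliffordAlgebra.contractLeft (Q := (0 : QuadraticForm (Fibre n) (Fin n ⊕ Fin n → Fibre n)))
    (LinearMap.proj (Sum.inl i))).restrictScalars ℝ)

/-- The de Rham differential `d = ∑ dx^i ∂/∂x^i + ∑ dθ_i ∂/∂θ_i`, where `D i` is `∂/∂x^i` on `R`. -/
noncomputable def deRham (D : Fin n → R →ₗ[ℝ] R) : SuperForm n R →ₗ[ℝ] SuperForm n R :=
  ∑ i, (LinearMap.mulLeft ℝ (dx R i) ∘ₗ LinearMap.rTensor (Grass n) (D i) +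
    LinearMap.mulLeft ℝ (dtheta R i) ∘ₗ dTheta i)

variable (n R) in
/-- The odd symplectic form `ω = ∑ dx^i dθ_i`. -/
noncomputable def omega : SuperForm n R := ∑ i, dx R i * dtheta R i

theorem grass_ι_mul (v : Fin n ⊕ Fin n → Fibre n) (a : Grass n) :
    ExteriorAlgebra.ι (Fibre n) v * a = CliffordAlgebra.involute a * ExteriorAlgebra.ι (Fibre n) v := by
  induction a using ExteriorAlgebra.induction with
  | algebraMap r => rw [AlgHom.commutes, Algebra.commutes]
  | ι w =>
    erw [CliffordAlgebra.involute_ι]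
    rw [neg_mul, eq_neg_iff_add_eq_zero]
    exact ExteriorAlgebra.ι_add_mul_swap v w
  | mul a b ha hb => rw [← mul_assoc, ha, mul_assoc, hb, ← mul_assoc, map_mul]
  | add a b ha hb => rw [mul_add, ha, hb, map_add, add_mul]

theorem odd_mul (v : Fin n ⊕ Fin n → Fibre n) (a : SuperForm n R) :
    odd v * a = parity a * odd v := by
  induction a using TensorProduct.induction_on with
  | zero => simp
  | tmul r a =>
    simp only [odd, parity, Algebra.TensorProduct.tmul_mul_tmul, Algebra.TensorProduct.map_tmul]
    rw [grass_ι_mul]; simp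
  | add a b ha hb => rw [mul_add, ha, hb, map_add, add_mul]

theorem dtheta_comm (i : Fin n) (a : SuperForm n R) : dtheta R i * a = a * dtheta R i := by
  induction a using TensorProduct.induction_on with
  | zero => simp
  | tmul r a =>
    simp only [dtheta, Algebra.TensorProduct.tmul_mul_tmul]
    rw [Algebra.commutes]; simp
  | add a b ha hb => rw [mul_add, ha, hb, add_mul]

theorem omega_mul (a : SuperForm n R) : omega n R * a = parity a * omega n R := by
  simp only [omega, Finset.sum_mul, Finset.mul_sum]
  refine Finset.sum_congr rfl fun i _ => ?_
  rw [mul_assoc, dtheta_comm, ← mul_assoc, dx, odd_mul, mul_assoc]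

theorem parity_odd (v : Fin n ⊕ Fin n → Fibre n) : parity (odd v : SuperForm n R) = - odd v := by
  simp only [odd, parity, Algebra.TensorProduct.map_tmul]
  erw [CliffordAlgebra.involute_ι]
  rw [TensorProduct.tmul_neg]; rfl

theorem parity_dtheta (i : Fin n) : parity (dtheta R i) = dtheta R i := by
  simp only [dtheta, parity, Algebra.TensorProduct.map_tmul]
  simp

theorem parity_parity (a : SuperForm n R) : parity (parity a) = a := by
  induction a using TensorProduct.induction_on with
  | zero => simp
  | tmul r a => simp [parity]
  | add a b ha hb => rw [map_add, map_add, ha, hb]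

theorem contract_involute (i : Fin n) (a : Grass n) :
    CliffordAlgebra.contractLeft (Q := (0 : QuadraticForm (Fibre n) (Fin n ⊕ Fin n → Fibre n)))
      (LinearMap.proj (Sum.inl i)) (CliffordAlgebra.involute a) =
    - CliffordAlgebra.involute (CliffordAlgebra.contractLeft (LinearMap.proj (Sum.inl i)) a) := by
  induction a using CliffordAlgebra.left_induction with
  | algebraMap r => simp
  | add a b ha hb => simp only [map_add, ha, hb, neg_add]
  | ι_mul v a h =>
    simp only [map_mul, CliffordAlgebra.involute_ι, neg_mul, map_neg,
      CliffordAlgebra.contractLeft_ι_mul, h, map_sub, map_smul]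
    simp

theorem dTheta_parity (i : Fin n) (a : SuperForm n R) : dTheta i (parity a) = - parity (dTheta i a) := by
  induction a using TensorProduct.induction_on with
  | zero => simp
  | tmul r a =>
    simp [dTheta, parity, contract_involute, TensorProduct.tmul_neg]
  | add a b ha hb => simp only [map_add, ha, hb, neg_add]

theorem rTensor_parity (D : R →ₗ[ℝ] R) (a : SuperForm n R) :
    LinearMap.rTensor (Grass n) D (parity a) = parity (LinearMap.rTensor (Grass n) D a) := by
  induction a using TensorProduct.induction_on with
  | zero => simp
  | tmul r a => simp [parity]
  | add a b ha hb => simp only [map_add, ha, hb]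

theorem deRham_parity (D : Fin n → R →ₗ[ℝ] R) (a : SuperForm n R) :
    deRham D (parity a) = - parity (deRham D a) := by
  simp only [deRham, LinearMap.sum_apply, map_sum, ← Finset.sum_neg_distrib]
  refine Finset.sum_congr rfl fun i _ => ?_
  simp only [LinearMap.add_apply, LinearMap.comp_apply, LinearMap.mulLeft_apply, map_add, map_mul,
    rTensor_parity, dTheta_parity, parity_dtheta, dx, parity_odd]
  noncomm_ring

theorem dTheta_dx_mul (i j : Fin n) (a : SuperForm n R) :
    dTheta i (dx R j * a) = - (dx R j * dTheta i a) := by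
  induction a using TensorProduct.induction_on with
  | zero => simp
  | tmul r a =>
    simp only [dx, odd, dTheta, Algebra.TensorProduct.tmul_mul_tmul, LinearMap.lTensor_tmul,
      LinearMap.restrictScalars_apply]
    erw [CliffordAlgebra.contractLeft_ι_mul]
    simp [TensorProduct.tmul_neg]
  | add a b ha hb => simp only [mul_add, map_add, ha, hb, neg_add]

theorem dTheta_dtheta_mul (i j : Fin n) (a : SuperForm n R) :
    dTheta i (dtheta R j * a) = dtheta R j * dTheta i a := by
  induction a using TensorProduct.induction_on with
  | zero => simp
  | tmul r a =>
    simp only [dtheta, dTheta, Algebra.TensorProduct.tmul_mul_tmul, LinearMap.lTensor_tmul,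
      LinearMap.restrictScalars_apply]
    erw [CliffordAlgebra.contractLeft_algebraMap_mul]
  | add a b ha hb => simp only [mul_add, map_add, ha, hb]

theorem rTensor_one_tmul_mul (D : R →ₗ[ℝ] R) (g : Grass n) (a : SuperForm n R) :
    LinearMap.rTensor (Grass n) D ((1 ⊗ₜ[ℝ] g) * a) = (1 ⊗ₜ[ℝ] g) * LinearMap.rTensor (Grass n) D a := by
  induction a using TensorProduct.induction_on with
  | zero => simp
  | tmul r a => simp [Algebra.TensorProduct.tmul_mul_tmul]
  | add a b ha hb => simp only [mul_add, map_add, ha, hb]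

theorem deRham_omega_mul (D : Fin n → R →ₗ[ℝ] R) (a : SuperForm n R) :
    deRham D (omega n R * a) = - (omega n R * deRham D a) := by
  simp only [deRham, LinearMap.sum_apply, Finset.mul_sum, ← Finset.sum_neg_distrib]
  refine Finset.sum_congr rfl fun i _ => ?_
  simp only [LinearMap.add_apply, LinearMap.comp_apply, LinearMap.mulLeft_apply, omega,
    Finset.sum_mul, map_sum, Finset.mul_sum, ← Finset.sum_neg_distrib, ← Finset.sum_add_distrib]
  refine Finset.sum_congr rfl fun j _ => ?_
  have h1 : LinearMap.rTensor (Grass n) (D i) (dx R j * dtheta R j * a) =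
      dx R j * dtheta R j * LinearMap.rTensor (Grass n) (D i) a := by
    rw [mul_assoc, dx, odd, rTensor_one_tmul_mul, dtheta, rTensor_one_tmul_mul, mul_assoc]
  have h2 : dx R i * dx R j = - (dx R j * dx R i) := by
    simp only [dx]; rw [odd_mul, parity_odd, neg_mul]
  rw [h1, mul_assoc (dx R j) (dtheta R j) a, dTheta_dx_mul, dTheta_dtheta_mul]
  have h3 : ∀ b : SuperForm n R, dx R i * (dx R j * b) = - (dx R j * (dx R i * b)) := fun b => by
    rw [← mul_assoc, h2, neg_mul, mul_assoc]
  have h4 : ∀ b : SuperForm n R, dtheta R i * (dx R j * b) = dx R j * (dtheta R i * b) := fun b => by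
    rw [← mul_assoc, dtheta_comm, mul_assoc]
  have h5 : ∀ b : SuperForm n R, dtheta R i * (dtheta R j * b) = dtheta R j * (dtheta R i * b) := fun b => by
    rw [← mul_assoc, dtheta_comm, mul_assoc]
  have h6 : ∀ b : SuperForm n R, dtheta R j * (dx R i * b) = dx R i * (dtheta R j * b) := fun b => by
    rw [← mul_assoc, dtheta_comm, mul_assoc]
  simp only [mul_assoc, mul_add, mul_neg, neg_add, h3, h4, h5, h6]

end Algebra

section Picture

variable {n : ℕ} {R : Type*} [CommRing R] [Algebra ℝ R]

/-- The linear form `∑ v_i dθ_i`. -/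
noncomputable def linForm (v : Fin n → R) : R ⊗[ℝ] Fibre n := ∑ i, v i ⊗ₜ[ℝ] MvPolynomial.X i

/-- A `p`-tuple `u` of even superforms for which the symbol `δ(u_1) ⋯ δ(u_p)` is admitted: up to nilpotents
(terms containing `θ` or `dx`) every `u_j` is a nonempty product of linear forms in the `dθ`s, and any `p`
linear forms obtained by choosing one factor of each `u_j` are linearly independent at the base point
(`ev` is evaluation there). Powers of a linear form `ℓ` encode the derivatives of the delta:
`δ(ℓ^{k+1})` stands for `(-1)^k δ^{(k)}(ℓ) / k!`. Products of distinct linear forms encode the infinite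
Taylor series of delta-forms: with `a = dθ_1`, `b = dθ_2`, one has
`δ(b) - δ(b + s a) = s a δ(b (b + s a))`, and `δ(b (b + s a))` is the formal series
`∑_{k ≥ 1} (-1)^k (-s)^{k-1} a^{k-1} δ^{(k)}(b) / k!`. -/
def IsDeltaSystem (ev : R →+* ℝ) {p : ℕ} (u : Fin p → SuperForm n R) : Prop :=
  (∀ j, parity (u j) = u j) ∧
  ∃ L : Fin p → Multiset (Fin n → R),
    (∀ j, L j ≠ 0 ∧ body (u j) = ((L j).map linForm).prod) ∧
    ∀ s : Fin p → Fin n → R, (∀ j, s j ∈ L j) → LinearIndependent ℝ fun j i => ev (s j i)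

theorem IsDeltaSystem.sqSlot {ev : R →+* ℝ} {p : ℕ} {u : Fin p → SuperForm n R}
    (hu : IsDeltaSystem ev u) (k : Fin p) :
    IsDeltaSystem ev (Function.update u k (u k * u k)) := by
  obtain ⟨he, L, hL, hs⟩ := hu
  refine ⟨fun j => ?_, Function.update L k (L k + L k), fun j => ?_, fun s h => hs s fun j => ?_⟩
  · rcases eq_or_ne j k with rfl | h
    · simp [he]
    · simp [h, he]
  · rcases eq_or_ne j k with rfl | h
    · simp [(hL j).1, (hL j).2]
    · simpa [h] using hL j
  · have := h j
    rcases eq_or_ne j k with rfl | h'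
    · simpa using this
    · simpa [h'] using this

/-- Admitted `p`-tuples. -/
noncomputable def DeltaSystem (n : ℕ) (ev : R →+* ℝ) (p : ℕ) : Type _ :=
  {u : Fin p → SuperForm n R // IsDeltaSystem ev u}

/-- The determinant (Leibniz formula) of a matrix of even, hence commuting, superforms. -/
noncomputable def superDet {p : ℕ} (H : Matrix (Fin p) (Fin p) (SuperForm n R)) : SuperForm n R :=
  ∑ σ : Equiv.Perm (Fin p), (Equiv.Perm.sign σ : ℤ) • (List.ofFn fun j => H (σ j) j).prod

/-- Formal sums of symbols `α δ(u_1) ⋯ δ(u_p)`: the free left module over the superforms on the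
admitted `p`-tuples. -/
abbrev PreForm (n : ℕ) (ev : R →+* ℝ) (p : ℕ) : Type _ := DeltaSystem n ev p →₀ SuperForm n R

variable {ev : R →+* ℝ} {p : ℕ}

/-- Replace `u_k` by its square. As `-δ(u_k^2)` is the derivative of `δ(u_k)`, this is how derivatives of
`δ(u)` with respect to `u_k` are written. -/
noncomputable def DeltaSystem.sqSlot (u : DeltaSystem n ev p) (k : Fin p) : DeltaSystem n ev p :=
  ⟨_, u.2.sqSlot k⟩

/-- The de Rham differential on formal sums, by the Leibniz and the chain rule:
`d (α δ(u)) = dα δ(u) + ∑_k du_k α ∂_k δ(u)`, where `∂_k δ(u) = - δ(u_1, …, u_k^2, …, u_p)`. -/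
noncomputable def preDeRham (D : Fin n → R →ₗ[ℝ] R) : PreForm n ev p →+ PreForm n ev p :=
  Finsupp.liftAddHom fun u =>
    (Finsupp.singleAddHom u).comp (deRham D).toAddMonoidHom -
      ∑ k, (Finsupp.singleAddHom (u.sqSlot k)).comp (AddMonoidHom.mulLeft (deRham D (u.1 k)))

variable (n ev p) in
/-- The two defining properties of Dirac deltas: `u_k δ(u) = 0` (`slot`), and the change of variables rule
`δ(u) = det H · δ(H u)` (`change`), without absolute value. The second contains `δ(u) = λ δ(λ u)`, the
anticommutation of the deltas, `ℓ δ(ℓ^{k+1}) = δ(ℓ^k)` and Taylor expansion. -/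
inductive DeltaRel : PreForm n ev p → Prop
  | slot (u : DeltaSystem n ev p) (k : Fin p) : DeltaRel (Finsupp.single u (u.1 k))
  | change (u v : DeltaSystem n ev p) (H : Matrix (Fin p) (Fin p) (SuperForm n R))
      (hH : ∀ i j, parity (H i j) = H i j) (hv : ∀ i, v.1 i = ∑ j, H i j * u.1 j) :
      DeltaRel (Finsupp.single u 1 - Finsupp.single v (superDet H))

variable (n ev p) in
/-- The differential submodule generated by the delta relations: the smallest submodule that contains them
and is stable under `d`. -/
noncomputable def relations (D : Fin n → R →ₗ[ℝ] R) : Submodule (SuperForm n R) (PreForm n ev p) :=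
  sInf {N | (∀ f, DeltaRel n ev p f → f ∈ N) ∧ ∀ f ∈ N, preDeRham D f ∈ N}

theorem preDeRham_mem {D : Fin n → R →ₗ[ℝ] R} {f : PreForm n ev p}
    (hf : f ∈ relations n ev p D) : preDeRham D f ∈ relations n ev p D := by
  simp only [relations, Submodule.mem_sInf] at hf ⊢
  exact fun N hN => hN.2 f (hf N hN)

variable (n ev p) in
/-- Forms of picture `p`: superforms times `p` deltas, modulo the delta relations. For `p = 0` these are the
differential superforms, for `p = n` the integral forms. -/
abbrev PForm (D : Fin n → R →ₗ[ℝ] R) : Type _ := PreForm n ev p ⧸ relations n ev p D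

variable {D : Fin n → R →ₗ[ℝ] R}

/-- The form `α δ(u_1) ⋯ δ(u_p)`. -/
noncomputable def PForm.mk (α : SuperForm n R) (u : DeltaSystem n ev p) : PForm n ev p D :=
  (relations n ev p D).mkQ (Finsupp.single u α)

variable (n ev p D) in
/-- The de Rham differential on forms of picture `p`. -/
noncomputable def pDeRham : PForm n ev p D →+ PForm n ev p D :=
  QuotientAddGroup.map (relations n ev p D).toAddSubgroup (relations n ev p D).toAddSubgroup
    (preDeRham D) fun _ h => preDeRham_mem h

theorem preDeRham_single (u : DeltaSystem n ev p) (α : SuperForm n R) :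
    preDeRham D (Finsupp.single u α) = Finsupp.single u (deRham D α) -
      ∑ k, Finsupp.single (u.sqSlot k) (deRham D (u.1 k) * α) := by
  simp [preDeRham, AddMonoidHom.finsetSum_apply]

theorem preDeRham_omega (f : PreForm n ev p) :
    preDeRham D (omega n R • f) = - (omega n R • preDeRham D f) := by
  induction f using Finsupp.induction_linear with
  | zero => simp
  | add f g hf hg => simp only [smul_add, map_add, hf, hg, neg_add]
  | single u α =>
    simp only [Finsupp.smul_single, smul_eq_mul, preDeRham_single, deRham_omega_mul, smul_sub,
      Finset.smul_sum, neg_sub]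
    have h : ∀ k, deRham D (u.1 k) * (omega n R * α) = -(omega n R * (deRham D (u.1 k) * α)) := by
      intro k
      rw [← mul_assoc, ← mul_assoc, omega_mul (deRham D (u.1 k))]
      have := deRham_parity D (u.1 k)
      rw [u.2.1 k] at this
      rw [eq_neg_iff_add_eq_zero, ← add_mul, ← add_mul]
      nth_rw 1 [this]
      simp
    simp only [h, Finsupp.single_neg, Finset.sum_neg_distrib]
    abel

theorem pDeRham_omega (s : PForm n ev p D) :
    pDeRham n ev p D (omega n R • s) = - (omega n R • pDeRham n ev p D s) := by
  induction s using Submodule.Quotient.induction_on with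
  | H f => exact congrArg (relations n ev p D).mkQ (preDeRham_omega f)

instance : RingHomSurjective ((parity : SuperForm n R →ₐ[ℝ] SuperForm n R) : SuperForm n R →+* SuperForm n R) :=
  ⟨fun a => ⟨parity a, parity_parity a⟩⟩

variable (n ev p D) in
/-- The differential `s ↦ ω s` on forms of picture `p`; as `ω` is odd it is linear up to the parity
involution, so its kernel and range are submodules. -/
noncomputable def omegaMul : PForm n ev p D →ₛₗ[((parity : SuperForm n R →ₐ[ℝ] SuperForm n R) :
    SuperForm n R →+* SuperForm n R)] PForm n ev p D where
  toFun s := omega n R • s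
  map_add' := smul_add _
  map_smul' a s := by
    rw [← mul_smul, omega_mul, mul_smul]; rfl

variable (n ev p D) in
/-- The first page `E_1 = H_ω(Ω^{•|p})`. -/
def E1 : Type _ :=
  (LinearMap.ker (omegaMul n ev p D)) ⧸
    (LinearMap.range (omegaMul n ev p D)).submoduleOf (LinearMap.ker (omegaMul n ev p D))

noncomputable instance : AddCommGroup (E1 n ev p D) :=
  inferInstanceAs (AddCommGroup ((LinearMap.ker (omegaMul n ev p D)) ⧸
    (LinearMap.range (omegaMul n ev p D)).submoduleOf (LinearMap.ker (omegaMul n ev p D))))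

noncomputable instance : Module (SuperForm n R) (E1 n ev p D) :=
  inferInstanceAs (Module (SuperForm n R) ((LinearMap.ker (omegaMul n ev p D)) ⧸
    (LinearMap.range (omegaMul n ev p D)).submoduleOf (LinearMap.ker (omegaMul n ev p D))))

variable (n ev p D) in
/-- The class of an `ω`-cocycle. -/
noncomputable def E1.mk : LinearMap.ker (omegaMul n ev p D) →ₗ[SuperForm n R] E1 n ev p D :=
  Submodule.mkQ _

variable (n ev p D) in
/-- `d` on `ω`-cocycles. -/
noncomputable def kerDeRham : LinearMap.ker (omegaMul n ev p D) →+ LinearMap.ker (omegaMul n ev p D) where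
  toFun s := ⟨pDeRham n ev p D s, by
    have h : omega n R • (s : PForm n ev p D) = 0 := s.2
    change omega n R • pDeRham n ev p D s = 0
    rw [← neg_eq_zero, ← pDeRham_omega, h, map_zero]⟩
  map_zero' := by simp
  map_add' a b := by ext; simp

variable (n ev p D) in
/-- The differential of the first page, induced by the de Rham differential. -/
noncomputable def E1.d : E1 n ev p D →+ E1 n ev p D :=
  QuotientAddGroup.map
    ((LinearMap.range (omegaMul n ev p D)).submoduleOf (LinearMap.ker (omegaMul n ev p D))).toAddSubgroup
    ((LinearMap.range (omegaMul n ev p D)).submoduleOf (LinearMap.ker (omegaMul n ev p D))).toAddSubgroup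
    (kerDeRham n ev p D) (by
      rintro ⟨s, hs⟩ ⟨t, ht⟩
      refine ⟨- pDeRham n ev p D t, ?_⟩
      change omega n R • _ = pDeRham n ev p D s
      rw [smul_neg, ← pDeRham_omega]
      exact congrArg _ ht)

variable (n ev p D) in
/-- The second page `E_2 = H_d(H_ω(Ω^{•|p}))`. -/
abbrev E2 : Type _ :=
  (E1.d n ev p D).ker ⧸ ((E1.d n ev p D).range.addSubgroupOf (E1.d n ev p D).ker)

variable (n R) in
/-- Superfunctions: the subalgebra generated by the functions of `x` and the `θ_i`. -/
noncomputable def functions : Subalgebra ℝ (SuperForm n R) :=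
  Algebra.adjoin ℝ (Set.range func ∪ Set.range (theta R))

end Picture

section Germs

variable (n : ℕ) {M : Type*} [TopologicalSpace M] [ChartedSpace (EuclideanSpace ℝ (Fin n)) M]

/-- Germs at `x` of functions that are smooth near `x`. -/
def smoothGermSubring (x : M) : Subring (Filter.Germ (𝓝 x) ℝ) where
  carrier := {g | ∃ f : M → ℝ, (f : Filter.Germ (𝓝 x) ℝ) = g ∧
    ∀ᶠ y in 𝓝 x, ContMDiffAt (𝓡 n) 𝓘(ℝ, ℝ) ∞ f y}
  mul_mem' := by
    rintro _ _ ⟨f, rfl, hf⟩ ⟨g, rfl, hg⟩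
    exact ⟨f * g, rfl, by filter_upwards [hf, hg] with y h1 h2 using h1.mul h2⟩
  one_mem' := ⟨1, rfl, Filter.Eventually.of_forall fun _ => contMDiffAt_const⟩
  add_mem' := by
    rintro _ _ ⟨f, rfl, hf⟩ ⟨g, rfl, hg⟩
    exact ⟨f + g, rfl, by filter_upwards [hf, hg] with y h1 h2 using h1.add h2⟩
  zero_mem' := ⟨0, rfl, Filter.Eventually.of_forall fun _ => contMDiffAt_const⟩
  neg_mem' := by
    rintro _ ⟨f, rfl, hf⟩
    exact ⟨-f, rfl, by filter_upwards [hf] with y h1 using h1.neg⟩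

/-- The ring of germs at `x` of smooth functions on `M`. -/
def SmoothGerm (x : M) : Type _ := smoothGermSubring n x

namespace SmoothGerm

variable (x : M)

noncomputable instance : CommRing (SmoothGerm n x) := inferInstanceAs (CommRing (smoothGermSubring n x))

noncomputable instance : Algebra ℝ (SmoothGerm n x) :=
  RingHom.toAlgebra
    { toFun := fun c => ⟨((fun _ => c : M → ℝ) : Filter.Germ (𝓝 x) ℝ), fun _ => c, rfl,
        Filter.Eventually.of_forall fun _ => contMDiffAt_const⟩
      map_one' := rfl
      map_mul' := fun _ _ => rfl
      map_zero' := rfl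
      map_add' := fun _ _ => rfl }

/-- Value of a germ at `x`. -/
noncomputable def eval : SmoothGerm n x →+* ℝ :=
  Filter.Germ.valueRingHom.comp (smoothGermSubring n x).subtype

variable {n x}

/-- The germ of a function that is smooth near `x`. -/
def of (f : M → ℝ) (hf : ∀ᶠ y in 𝓝 x, ContMDiffAt (𝓡 n) 𝓘(ℝ, ℝ) ∞ f y) : SmoothGerm n x :=
  ⟨(f : Filter.Germ (𝓝 x) ℝ), f, rfl, hf⟩

end SmoothGerm

/-- Smooth charts of `M` defined near `x`, i.e. local coordinate systems `y^1, …, y^n` at `x`. -/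
def ChartNear (x : M) : Type _ :=
  {e : OpenPartialHomeomorph M (EuclideanSpace ℝ (Fin n)) //
    e ∈ IsManifold.maximalAtlas (𝓡 n) ∞ M ∧ x ∈ e.source}

/-- The reference chart at `x`, in whose coordinates `x^i | θ_i` superforms are written. -/
noncomputable def preferredChart [IsManifold (𝓡 n) ∞ M] (x : M) : ChartNear n x :=
  ⟨chartAt _ x, IsManifold.chart_mem_maximalAtlas x, mem_chart_source _ x⟩

variable {n} {x : M}

/-- The partial derivative `∂f/∂y^i` in the chart `e = (y^1, …, y^n)`. -/
noncomputable def partialFun (e : OpenPartialHomeomorph M (EuclideanSpace ℝ (Fin n))) (i : Fin n)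
    (f : M → ℝ) (y : M) : ℝ :=
  fderiv ℝ (f ∘ e.symm) (e y) (EuclideanSpace.single i 1)

theorem contDiffAt_comp_symm (e : ChartNear n x) {f : M → ℝ} {y : M} (hy : y ∈ e.1.source)
    (hf : ContMDiffAt (𝓡 n) 𝓘(ℝ, ℝ) ∞ f y) : ContDiffAt ℝ ∞ (f ∘ e.1.symm) (e.1 y) := by
  rw [← contMDiffAt_iff_contDiffAt]
  have h := contMDiffAt_symm_of_mem_maximalAtlas e.2.1 (e.1.map_source hy)
  refine ContMDiffAt.comp (I' := 𝓡 n) _ ?_ h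
  rwa [e.1.left_inv hy]

theorem partialFun_smooth (e : ChartNear n x) (i : Fin n) {f : M → ℝ}
    (hf : ∀ᶠ y in 𝓝 x, ContMDiffAt (𝓡 n) 𝓘(ℝ, ℝ) ∞ f y) :
    ∀ᶠ y in 𝓝 x, ContMDiffAt (𝓡 n) 𝓘(ℝ, ℝ) ∞ (partialFun e.1 i f) y := by
  filter_upwards [hf, e.1.open_source.mem_nhds e.2.2] with y h1 h2
  have h := contDiffAt_comp_symm e h2 h1
  have h3 : ContDiffAt ℝ ∞ (fun z => fderiv ℝ (f ∘ e.1.symm) z (EuclideanSpace.single i 1)) (e.1 y) :=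
    (h.fderiv_right (m := ∞) (by simp)).clm_apply contDiffAt_const
  exact ContMDiffAt.comp (I' := 𝓡 n) y h3.contMDiffAt (contMDiffAt_of_mem_maximalAtlas e.2.1 h2)

theorem partialFun_congr (e : ChartNear n x) (i : Fin n) {f g : M → ℝ} (h : f =ᶠ[𝓝 x] g) :
    partialFun e.1 i f =ᶠ[𝓝 x] partialFun e.1 i g := by
  filter_upwards [eventually_eventually_nhds.2 h, e.1.open_source.mem_nhds e.2.2] with y h1 h2
  have h3 : f ∘ e.1.symm =ᶠ[𝓝 (e.1 y)] g ∘ e.1.symm := by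
    have := e.1.continuousAt_symm (e.1.map_source h2)
    rw [ContinuousAt, e.1.left_inv h2] at this
    exact this.eventually h1
  simp only [partialFun, h3.fderiv_eq]

/-- The partial derivative `∂/∂y^i` on germs. -/
noncomputable def partialDeriv (e : ChartNear n x) (i : Fin n) :
    SmoothGerm n x →ₗ[ℝ] SmoothGerm n x where
  toFun g := ⟨Filter.Germ.map' (partialFun e.1 i) (fun _ _ h => partialFun_congr e i h) g.1, by
    obtain ⟨_, f, rfl, hf⟩ := g
    exact ⟨_, rfl, partialFun_smooth e i hf⟩⟩
  map_add' := by
    rintro ⟨_, f, rfl, hf⟩ ⟨_, g, rfl, hg⟩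
    refine Subtype.ext (Filter.Germ.coe_eq.2 ?_)
    filter_upwards [hf, hg, e.1.open_source.mem_nhds e.2.2] with y h1 h2 h3
    have d1 := (contDiffAt_comp_symm e h3 h1).differentiableAt (by simp)
    have d2 := (contDiffAt_comp_symm e h3 h2).differentiableAt (by simp)
    have := fderiv_add d1 d2
    exact congrArg (fun T => T (EuclideanSpace.single i 1)) this
  map_smul' := by
    rintro c ⟨_, f, rfl, hf⟩
    refine Subtype.ext (Filter.Germ.coe_eq.2 ?_)
    filter_upwards [hf, e.1.open_source.mem_nhds e.2.2] with y h1 h3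
    have d1 := (contDiffAt_comp_symm e h3 h1).differentiableAt (by simp)
    have := fderiv_const_smul d1 c
    exact congrArg (fun T => T (EuclideanSpace.single i 1)) this

/-- The germ of the coordinate function `y^j`. -/
noncomputable def coord (e : ChartNear n x) (j : Fin n) : SmoothGerm n x :=
  SmoothGerm.of (fun y => e.1 y j) (by
    filter_upwards [e.1.open_source.mem_nhds e.2.2] with y hy
    have h := contMDiffAt_of_mem_maximalAtlas e.2.1 hy
    have h2 : ContDiff ℝ ∞ (fun z : EuclideanSpace ℝ (Fin n) => z j) := by fun_prop
    exact ContMDiffAt.comp (I' := 𝓡 n) y h2.contDiffAt.contMDiffAt h)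

/-- The Jacobian matrix `∂y'^j/∂y^i` (row `j`, column `i`) for `e = (y^i)` and `e' = (y'^j)`. -/
noncomputable def jac (e e' : ChartNear n x) : Matrix (Fin n) (Fin n) (SmoothGerm n x) :=
  Matrix.of fun j i => partialDeriv e i (coord e' j)

theorem differentiableAt_transition (e e' : ChartNear n x) :
    DifferentiableAt ℝ (e'.1 ∘ e.1.symm) (e.1 x) := by
  have h := contMDiffAt_symm_of_mem_maximalAtlas e.2.1 (e.1.map_source e.2.2)
  have h' := contMDiffAt_of_mem_maximalAtlas e'.2.1 e'.2.2
  have : ContMDiffAt (𝓡 n) (𝓡 n) ∞ (e'.1 ∘ e.1.symm) (e.1 x) := by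
    refine ContMDiffAt.comp (I' := 𝓡 n) _ ?_ h
    rwa [e.1.left_inv e.2.2]
  exact (contMDiffAt_iff_contDiffAt.1 this).differentiableAt (by simp)

theorem eval_jac (e e' : ChartNear n x) (j i : Fin n) :
    SmoothGerm.eval n x (jac e e' j i) =
      (fderiv ℝ (e'.1 ∘ e.1.symm) (e.1 x) (EuclideanSpace.single i 1)) j := by
  have hd := differentiableAt_transition e e'
  change fderiv ℝ ((fun y => e'.1 y j) ∘ e.1.symm) (e.1 x) _ = _
  have h2 : ((fun y => e'.1 y j) ∘ e.1.symm) =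
      (EuclideanSpace.proj j : EuclideanSpace ℝ (Fin n) →L[ℝ] ℝ) ∘ (e'.1 ∘ e.1.symm) := rfl
  rw [h2, ((EuclideanSpace.proj j : EuclideanSpace ℝ (Fin n) →L[ℝ] ℝ).hasFDerivAt.comp _
    hd.hasFDerivAt).fderiv]
  rfl

theorem jac_linearIndependent (e e' : ChartNear n x) :
    LinearIndependent ℝ fun i j => SmoothGerm.eval n x (jac e e' j i) := by
  have hd := @differentiableAt_transition n M _ _ x
  set T := fderiv ℝ (e'.1 ∘ e.1.symm) (e.1 x)
  set S := fderiv ℝ (e.1 ∘ e'.1.symm) (e'.1 x)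
  have hST : S.comp T = ContinuousLinearMap.id ℝ _ := by
    have h1 : (e'.1 ∘ e.1.symm) (e.1 x) = e'.1 x := by simp [e.1.left_inv e.2.2]
    have hS : DifferentiableAt ℝ (e.1 ∘ e'.1.symm) ((e'.1 ∘ e.1.symm) (e.1 x)) := by
      rw [h1]; exact hd e' e
    have h2 := fderiv_comp (e.1 x) hS (hd e e')
    rw [h1] at h2
    rw [← h2, ← fderiv_id (x := e.1 x)]
    refine Filter.EventuallyEq.fderiv_eq ?_
    have hc := e.1.continuousAt_symm (e.1.map_source e.2.2)
    rw [ContinuousAt, e.1.left_inv e.2.2] at hc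
    filter_upwards [hc.eventually (e'.1.open_source.mem_nhds e'.2.2),
      e.1.open_target.mem_nhds (e.1.map_source e.2.2)] with z hz hz'
    simp only [Function.comp_apply, id]
    rw [e'.1.left_inv hz, e.1.right_inv hz']
  have hinj : Function.Injective T := fun a b h => by
    have := congrArg S h
    have h3 := fun c => congrArg (fun L => L c) hST
    simp only [ContinuousLinearMap.comp_apply, ContinuousLinearMap.id_apply] at h3
    rwa [h3, h3] at this
  have hb : LinearIndependent ℝ fun i : Fin n => (EuclideanSpace.single i 1 : EuclideanSpace ℝ (Fin n)) := by
    have h := (EuclideanSpace.basisFun (Fin n) ℝ).toBasis.linearIndependent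
    have h' : ((EuclideanSpace.basisFun (Fin n) ℝ).toBasis : Fin n → EuclideanSpace ℝ (Fin n)) =
        fun i => EuclideanSpace.single i 1 := by
      funext i; simp
    rwa [h'] at h
  have h4 := hb.map' ((WithLp.linearEquiv 2 ℝ (Fin n → ℝ)).toLinearMap ∘ₗ T.toLinearMap)
    (LinearMap.ker_eq_bot.2 (by
      rw [LinearMap.coe_comp]
      exact (LinearEquiv.injective _).comp hinj))
  have h5 : (fun i j => SmoothGerm.eval n x (jac e e' j i)) =
      ((WithLp.linearEquiv 2 ℝ (Fin n → ℝ)).toLinearMap ∘ₗ T.toLinearMap) ∘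
        fun i : Fin n => (EuclideanSpace.single i 1 : EuclideanSpace ℝ (Fin n)) := by
    funext i j
    rw [eval_jac]
    rfl
  rw [h5]
  exact h4

end Germs

section Stalk

variable {n : ℕ} {M : Type*} [TopologicalSpace M] [ChartedSpace (EuclideanSpace ℝ (Fin n)) M]
  [IsManifold (𝓡 n) ∞ M] {x : M}

variable (n x) in
/-- The stalk at `x` of the superforms `Ω^{•|0}` of `ΠT*M`, in the reference coordinates. -/
abbrev FormStalk : Type _ := SuperForm n (SmoothGerm n x)

variable (n x) in
/-- The partial derivatives in the reference chart. -/
noncomputable def basePartial (i : Fin n) : SmoothGerm n x →ₗ[ℝ] SmoothGerm n x :=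
  partialDeriv (preferredChart n x) i

/-- The odd coordinate `θ^e_j = ∑_i (∂x^i/∂y^j) θ_i` of `ΠT*M` attached to the chart `e = (y^1, …, y^n)`; that
is, `θ^e_j` is the coordinate vector field `∂/∂y^j`, regarded as an odd function on `ΠT*M`. -/
noncomputable def chartTheta (e : ChartNear n x) (j : Fin n) : FormStalk n x :=
  ∑ i, func (jac e (preferredChart n x) i j) * theta (SmoothGerm n x) i

/-- `dy^j` for the chart `e`. -/
noncomputable def chartDx (e : ChartNear n x) (j : Fin n) : FormStalk n x :=
  deRham (basePartial n x) (func (coord e j))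

/-- `dθ^e_j` for the chart `e`; it includes the term `∑_i d(∂x^i/∂y^j) θ_i`. -/
noncomputable def chartDtheta (e : ChartNear n x) (j : Fin n) : FormStalk n x :=
  deRham (basePartial n x) (chartTheta e j)

theorem parity_chartDtheta (e : ChartNear n x) (j : Fin n) :
    parity (chartDtheta e j) = chartDtheta e j := by
  have h : parity (chartTheta e j) = - chartTheta e j := by
    simp only [chartTheta, map_sum, map_mul, theta, parity_odd, mul_neg, Finset.sum_neg_distrib]
    simp [func, parity]
  have h2 := deRham_parity (basePartial n x) (chartTheta e j)
  rw [h, map_neg, neg_inj] at h2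
  exact h2.symm

theorem body_chartDtheta (e : ChartNear n x) (j : Fin n) :
    body (chartDtheta e j) = linForm fun i => jac e (preferredChart n x) i j := by
  have h1 : ∀ i : Fin n, body (dx (SmoothGerm n x) i) = 0 := fun i => by
    simp only [body, dx, odd, Algebra.TensorProduct.map_tmul, AlgHom.restrictScalars_apply,
      ExteriorAlgebra.algebraMapInv, ExteriorAlgebra.lift_ι_apply]
    simp
  have h2 : ∀ i : Fin n, body (dtheta (SmoothGerm n x) i) = 1 ⊗ₜ[ℝ] MvPolynomial.X i := fun i => by
    simp [body, dtheta]
  have h3 : ∀ (i k : Fin n) (r : SmoothGerm n x),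
      dTheta i (func r * theta (SmoothGerm n x) k) = if k = i then func r else 0 := fun i k r => by
    simp only [dTheta, func, theta, odd, Algebra.TensorProduct.tmul_mul_tmul, one_mul, mul_one,
      LinearMap.lTensor_tmul, LinearMap.restrictScalars_apply]
    erw [CliffordAlgebra.contractLeft_ι]
    by_cases h : k = i
    · subst h; simp
    · have : (Pi.single (Sum.inl k) (1 : Fibre n) : Fin n ⊕ Fin n → Fibre n) (Sum.inl i) = 0 := by
        rw [Pi.single_apply, if_neg]; simpa using fun h' => h h'.symm
      simp [h, this]
  have h4 : ∀ r : SmoothGerm n x, body (func r : FormStalk n x) = r ⊗ₜ[ℝ] 1 := fun r => by simp [body, func]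
  simp only [chartDtheta, deRham, LinearMap.sum_apply, LinearMap.add_apply, LinearMap.comp_apply,
    LinearMap.mulLeft_apply, map_sum, map_add, map_mul, h1, zero_mul, zero_add, h2, linForm]
  refine Finset.sum_congr rfl fun i _ => ?_
  simp only [chartTheta, map_sum, h3, Finset.sum_ite_eq', Finset.mem_univ, if_true, apply_ite body, h4]
  simp

theorem isDeltaSystem_chartDtheta (e : ChartNear n x) {p : ℕ} (f : Fin p → Fin n)
    (hf : Function.Injective f) :
    IsDeltaSystem (SmoothGerm.eval n x) fun k => chartDtheta e (f k) := by
  refine ⟨fun k => parity_chartDtheta e _,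
    fun k => {fun i => jac e (preferredChart n x) i (f k)}, fun k => ⟨by simp, ?_⟩, fun s hs => ?_⟩
  · rw [body_chartDtheta]; simp
  · have h : s = fun k i => jac e (preferredChart n x) i (f k) :=
      funext fun k => Multiset.mem_singleton.1 (hs k)
    subst h
    exact (jac_linearIndependent e (preferredChart n x)).comp f hf

variable (n x) in
/-- The stalk at `x` of the forms `Ω^{•|p}` of picture `p` on `ΠT*M`. -/
abbrev PicForm (p : ℕ) : Type _ := PForm n (SmoothGerm.eval n x) p (basePartial n x)

/-- The form `∑ ε_{i_1 … i_n} dy^{i_1} ⋯ dy^{i_{n-p}} δ(dθ^e_{i_{n-p+1}}) ⋯ δ(dθ^e_{i_n})` of the chart `e`. -/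
noncomputable def generator (e : ChartNear n x) (p : ℕ) (hp : p ≤ n) : PicForm n x p :=
  ∑ σ : Equiv.Perm (Fin n), (Equiv.Perm.sign σ : ℤ) •
    PForm.mk (List.ofFn fun k : Fin (n - p) => chartDx e (σ (Fin.castLE (Nat.sub_le n p) k))).prod
      ⟨fun k : Fin p => chartDtheta e (σ (Fin.cast (Nat.sub_add_cancel hp) (Fin.natAdd (n - p) k))),
        isDeltaSystem_chartDtheta e _ (σ.injective.comp
          ((Fin.cast_injective _).comp (Fin.natAdd_injective _ _)))⟩

variable (n x) in
/-- The stalk at `x` of the structure sheaf of `ΠT*M`. -/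
abbrev StructureStalk : Type _ := functions n (SmoothGerm n x)

variable (n x) in
/-- The stalk at `x` of `H_ω(Ω^{•|p})`. -/
abbrev Coh (p : ℕ) : Type _ := E1 n (SmoothGerm.eval n x) p (basePartial n x)

/-- The Berezinian of the coordinate change `(y | θ^e) ↦ (y' | θ^{e'})` of `ΠT*M`. Its super-Jacobian has even
block `∂y'/∂y`, odd block `∂θ^{e'}_j/∂θ^e_i = ∂y^i/∂y'^j`, and `∂y'/∂θ^e = 0`, so that
`Ber = det(∂y'/∂y) · det(∂θ^{e'}/∂θ^e)⁻¹`; this is the transition function of `Ber(ΠT*M)`. -/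
noncomputable def berezinian (e e' : ChartNear n x) : SmoothGerm n x :=
  (jac e e').det * ((jac e' e).transpose)⁻¹.det

variable (n x) in
/-- The stalk at `x` of the semidensities of `ΠT*M`: a superfunction `s_e` for every coordinate system `e`, with
`s_e = s_{e'} · det(∂y'/∂y)`. These are the sections of the line bundle whose transition function
`det(∂y'/∂y)`, that of `det M`, is the square root of the Berezinian. -/
noncomputable def Semidensity : Submodule (StructureStalk n x) (ChartNear n x → StructureStalk n x) where
  carrier := {s | ∀ e e', (s e).1 = (s e').1 * func (jac e e').det}
  zero_mem' := by intro e e'; simp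
  add_mem' := by
    intro s t hs ht e e'
    simp [hs e e', ht e e', add_mul]
  smul_mem' := by
    intro a s hs e e'
    simp [hs e e', mul_assoc]

end Stalk

end OddSymplectic

open OddSymplectic

/-!
# The `ω`-cohomology of differential forms on `ΠT*M`

**Delta forms as generalized fractions.** The form `β δ(u_1) ⋯ δ(u_p)` behaves like the fraction with
numerator `β` and denominator `u_1 ⋯ u_p` in a local cohomology module: it vanishes when `β` is a
combination of the `u_k`, and it may be written over any system `w = H u`, with numerator `det H · β`.
Two delta systems always have a common refinement whose members are products of linear forms in the
`dθ_i` without nilpotent terms (`DeltaSystem.exists_common_refinement`), and such a system is a regular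
family on superforms (`DeltaSystem.IsPure.regularFamily`). For regular `w` the factor `det H` is well
defined modulo `w` (`det_sub_det_mem`). The same fact over the dual numbers, applied to `b + ε db`,
shows that the differential consequences of the relations are already consequences of the relations
themselves (`relations_eq`). Hence `β δ(w) = 0` only if the numerator vanishes modulo some finer system.

**Transgression.** Let `u` be a delta system and consider the Koszul-type differential
`ω + ∑ u_k e_k` on superforms with `p` additional odd variables `e_k`. A cocycle of it has a top
coefficient `β` and a constant term `τ`, and then `β δ(u)` and `τ` are both annihilated by `ω`. Since
refinements of `u` are regular, every `ω`-cocycle arises as such a `β δ(u)`, and `τ` is determined up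
to `ω`-coboundaries. Conversely `β δ(u)` is a coboundary if `τ` is one, since linear forms in the `dθ_i`
act null-homotopically: `dθ_i` is the anticommutator of `ω` and `∂/∂(dx^i)`. Thus `m ↦ τ` identifies the
`ω`-cohomology in picture `p` with that in picture `0` (`exists_transgresses`,
`Transgresses.exists_eq_omega_mul`, `Transgresses.exists_eq_omega_smul`), up to parity twists. In
picture `0` the form `ω = ∑ dx^i dθ_i` is the Koszul differential of the regular family `dθ_i`, and its
cohomology consists of the superfunctions times `dx^1 ⋯ dx^n` (`exists_dxTop_add`,
`eq_zero_of_dxTop_eq`).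

**The generators.** In any chart `ω = ∑ dy^j dθ_j`, because `∑ dy^j θ_j` does not depend on the chart.
The product of the `dy^j + e_j` is therefore a Koszul cocycle, and it shows that each term of `α^y_p`
transgresses to `± dy^1 ⋯ dy^n = ± det(∂y/∂x) dx^1 ⋯ dx^n` (`transgresses_prod`,
`transgresses_generator`). This determinant is invertible, so `[α^y_p]` is a basis, and the
multiplicativity of Jacobian determinants gives the transition law and the isomorphism with
semidensities.

**The differential.** In the reference chart `α_p` is closed, so `d [f α_p] = [df α_p]`. The one-forms
`dx^i` annihilate `dx^1 ⋯ dx^n`, and `dθ_i dx^1 ⋯ dx^n` is an `ω`-coboundary; hence `dx^i` and `dθ_i` act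
by zero on the cohomology, and `df`, a combination of them, does too (`E1.d_eq_zero`).
-/

namespace OddSymplectic

/-! ### Even superforms and their bodies -/

section SuperAlgebra

variable {n : ℕ} {R : Type*} [CommRing R] [Algebra ℝ R]

theorem even_mul_comm {a : SuperForm n R} (ha : parity a = a) (b : SuperForm n R) :
    a * b = b * a := by
  have key : ∀ g : Grass n, a * ((1 : R) ⊗ₜ[ℝ] g) = ((1 : R) ⊗ₜ[ℝ] g) * a := by
    intro g
    induction g using ExteriorAlgebra.induction with
    | algebraMap r =>
      clear ha
      induction a using TensorProduct.induction_on with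
      | zero => simp
      | tmul s h =>
        simp only [Algebra.TensorProduct.tmul_mul_tmul, mul_one, one_mul]
        rw [Algebra.commutes]
      | add c d hc hd => rw [mul_add, add_mul, hc, hd]
    | ι v =>
      have := odd_mul v a
      rw [ha] at this
      exact this.symm
    | mul x y hx hy =>
      have : ((1 : R) ⊗ₜ[ℝ] (x * y) : SuperForm n R) = (1 ⊗ₜ[ℝ] x) * (1 ⊗ₜ[ℝ] y) := by simp
      rw [this, ← mul_assoc, hx, mul_assoc, hy, mul_assoc]
    | add x y hx hy => rw [TensorProduct.tmul_add, mul_add, hx, hy, add_mul]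
  induction b using TensorProduct.induction_on with
  | zero => simp
  | tmul r g =>
    have h1 : (r ⊗ₜ[ℝ] g : SuperForm n R) = (r ⊗ₜ[ℝ] 1) * (1 ⊗ₜ[ℝ] g) := by simp
    have h2 : ∀ c : SuperForm n R, c * (r ⊗ₜ[ℝ] 1) = (r ⊗ₜ[ℝ] 1) * c := fun c => by
      induction c using TensorProduct.induction_on with
      | zero => simp
      | tmul s h => simp [Algebra.TensorProduct.tmul_mul_tmul, mul_comm]
      | add x y hx hy => rw [add_mul, mul_add, hx, hy]
    rw [h1, ← mul_assoc, h2, mul_assoc, key, mul_assoc]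
  | add x y hx hy => rw [mul_add, hx, hy, add_mul]

variable (n R) in
/-- The commutative ring of even superforms. -/
noncomputable def evenSubalgebra : Subalgebra ℝ (SuperForm n R) :=
  AlgHom.equalizer parity (AlgHom.id ℝ _)

variable (n R) in
/-- The even superforms, as a type. -/
abbrev EvenForm : Type _ := evenSubalgebra n R

theorem mem_evenSubalgebra {a : SuperForm n R} : a ∈ evenSubalgebra n R ↔ parity a = a := Iff.rfl

theorem EvenForm.parity_coe (a : EvenForm n R) : parity (a : SuperForm n R) = a := a.2

noncomputable instance : CommRing (EvenForm n R) :=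
  { (inferInstance : Ring (EvenForm n R)) with
    mul_comm := fun a b => Subtype.ext (even_mul_comm a.2 b.1) }

noncomputable instance : Semiring (EvenForm n R) := CommRing.toCommSemiring.toSemiring

noncomputable instance : Module (EvenForm n R) (SuperForm n R) :=
  inferInstanceAs (Module (evenSubalgebra n R) (SuperForm n R))

theorem EvenForm.smul_def (a : EvenForm n R) (s : SuperForm n R) : a • s = (a : SuperForm n R) * s := rfl

theorem EvenForm.coe_mul_comm (a : EvenForm n R) (s : SuperForm n R) :
    (a : SuperForm n R) * s = s * a := even_mul_comm a.2 s

theorem EvenForm.mul_smul (a : EvenForm n R) (s t : SuperForm n R) : s * (a • t) = a • (s * t) := by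
  simp only [EvenForm.smul_def, ← mul_assoc, EvenForm.coe_mul_comm a s]

theorem parity_smul (a : EvenForm n R) (s : SuperForm n R) : parity (a • s) = a • parity s := by
  simp only [EvenForm.smul_def, map_mul]
  rw [EvenForm.parity_coe]

variable (n R) in
/-- Functions of `x` and `dθ`, as even superforms. -/
noncomputable def pureForm : R ⊗[ℝ] Fibre n →ₐ[ℝ] SuperForm n R :=
  Algebra.TensorProduct.map (AlgHom.id ℝ R)
    ((Algebra.ofId (Fibre n) (Grass n)).restrictScalars ℝ)

theorem pureForm_tmul (r : R) (f : Fibre n) :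
    pureForm n R (r ⊗ₜ f) = r ⊗ₜ[ℝ] algebraMap (Fibre n) (Grass n) f := rfl

theorem body_pureForm (a : R ⊗[ℝ] Fibre n) : body (pureForm n R a) = a := by
  induction a using TensorProduct.induction_on with
  | zero => simp
  | tmul r f =>
    simp only [pureForm_tmul, body, Algebra.TensorProduct.map_tmul, AlgHom.restrictScalars_apply,
      ExteriorAlgebra.algebraMapInv, AlgHom.commutes]
    rfl
  | add a b ha hb => rw [map_add, map_add, ha, hb]

theorem parity_pureForm (a : R ⊗[ℝ] Fibre n) : parity (pureForm n R a) = pureForm n R a := by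
  induction a using TensorProduct.induction_on with
  | zero => simp
  | tmul r f =>
    simp only [pureForm_tmul, parity, Algebra.TensorProduct.map_tmul, AlgHom.restrictScalars_apply,
      AlgHom.commutes]
    rfl
  | add a b ha hb => rw [map_add, map_add, ha, hb]

variable (n R) in
/-- Functions of `x` and `dθ`, inside the even superforms. -/
noncomputable def evenOf : R ⊗[ℝ] Fibre n →+* EvenForm n R :=
  (pureForm n R).toRingHom.codRestrict (evenSubalgebra n R) parity_pureForm

@[simp] theorem coe_evenOf (a : R ⊗[ℝ] Fibre n) : (evenOf n R a : SuperForm n R) = pureForm n R a := rfl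

/-- The projection of superforms onto even superforms. -/
noncomputable def evenPart (s : SuperForm n R) : EvenForm n R :=
  ⟨(2⁻¹ : ℝ) • (s + parity s), by
    rw [mem_evenSubalgebra, map_smul, map_add, parity_parity, add_comm]⟩

theorem evenPart_coe (a : EvenForm n R) : evenPart (a : SuperForm n R) = a := by
  refine Subtype.ext ?_
  simp only [evenPart, EvenForm.parity_coe, ← two_smul ℝ (a : SuperForm n R), smul_smul]
  norm_num

theorem evenPart_add (s t : SuperForm n R) : evenPart (s + t) = evenPart s + evenPart t := by
  refine Subtype.ext ?_
  simp only [evenPart, map_add, Subalgebra.coe_add, ← smul_add]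
  congr 1
  abel

theorem evenPart_smul (a : EvenForm n R) (s : SuperForm n R) : evenPart (a • s) = a * evenPart s := by
  refine Subtype.ext ?_
  simp only [evenPart, parity_smul, Subalgebra.coe_mul, ← smul_add]
  rw [EvenForm.smul_def, mul_smul_comm]

/-- An even superform differs from its body by a nilpotent. A monomial `v x` with `v` an odd generator
has even part `v y` with `y` the odd part of `x`, and `(v y) ^ 2 = 0`; sums of commuting nilpotents
are nilpotent. -/
theorem isNilpotent_sub_evenOf_body (a : EvenForm n R) :
    IsNilpotent (a - evenOf n R (body (a : SuperForm n R))) := by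
  have key : ∀ s : SuperForm n R, IsNilpotent (evenPart s - evenOf n R (body s)) := by
    intro s
    induction s using TensorProduct.induction_on with
    | zero => refine ⟨1, ?_⟩; ext; simp [evenPart]
    | add s t hs ht =>
      rw [evenPart_add, map_add, map_add, add_sub_add_comm]
      exact (Commute.all _ _).isNilpotent_add hs ht
    | tmul r g =>
      induction g using CliffordAlgebra.left_induction with
      | algebraMap f =>
        have h : (r ⊗ₜ[ℝ] (algebraMap (Fibre n) (Grass n) f) : SuperForm n R)
          = evenOf n R (r ⊗ₜ f) := rfl
        refine ⟨1, ?_⟩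
        erw [h]
        rw [evenPart_coe, coe_evenOf, body_pureForm, sub_self, pow_one]
      | add x y hx hy =>
        rw [TensorProduct.tmul_add, evenPart_add, map_add, map_add, add_sub_add_comm]
        exact (Commute.all _ _).isNilpotent_add hx hy
      | ι_mul x v _ =>
        -- the odd part of `r ⊗ x`
        set y : SuperForm n R := (2⁻¹ : ℝ) • (r ⊗ₜ[ℝ] x - parity (r ⊗ₜ[ℝ] x)) with hy
        have hpy : parity y = - y := by
          rw [hy, map_smul, map_sub, parity_parity, ← smul_neg, neg_sub]
        have h0 : (r ⊗ₜ[ℝ] (CliffordAlgebra.ι _ v * x) : SuperForm n R) =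
            odd v * r ⊗ₜ[ℝ] x := by
          simp only [odd, Algebra.TensorProduct.tmul_mul_tmul, one_mul]
        have hb : body (r ⊗ₜ[ℝ] (CliffordAlgebra.ι _ v * x) : SuperForm n R) = 0 := by
          rw [h0, map_mul]
          simp only [body, odd, Algebra.TensorProduct.map_tmul, AlgHom.restrictScalars_apply,
            ExteriorAlgebra.algebraMapInv, ExteriorAlgebra.lift_ι_apply]
          simp
        have he : ((evenPart (r ⊗ₜ[ℝ] (CliffordAlgebra.ι _ v * x) : SuperForm n R) : EvenForm n R) :
            SuperForm n R) = odd v * y := by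
          rw [h0]
          simp only [evenPart, map_mul, parity_odd, hy, mul_smul_comm]
          rw [mul_sub, neg_mul, sub_eq_add_neg]
        rw [hb, map_zero, sub_zero]
        refine ⟨2, Subtype.ext ?_⟩
        rw [Subalgebra.coe_pow, he, pow_two]
        have hvv : (odd v * odd v : SuperForm n R) = 0 := by
          simp only [odd, Algebra.TensorProduct.tmul_mul_tmul]
          erw [ExteriorAlgebra.ι_sq_zero]
          simp
        have hyv : y * odd v = - (odd v * y) := by rw [odd_mul, hpy, neg_mul, neg_neg]
        calc odd v * y * (odd v * y) = odd v * (y * odd v) * y := by noncomm_ring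
          _ = - (odd v * (odd v * y) * y) := by
            rw [hyv, mul_neg, neg_mul]
          _ = - (odd v * odd v * (y * y)) := by noncomm_ring
          _ = 0 := by rw [hvv, zero_mul, neg_zero]
  have := key a
  rwa [evenPart_coe] at this

end SuperAlgebra

/-! ### The Leibniz rule and determinants -/

section Leibniz

variable {n : ℕ} {R : Type*} [CommRing R] [Algebra ℝ R]

theorem contractLeft_mul (φ : Module.Dual (Fibre n) (Fin n ⊕ Fin n → Fibre n)) (a b : Grass n) :
    CliffordAlgebra.contractLeft (Q := (0 : QuadraticForm (Fibre n) (Fin n ⊕ Fin n → Fibre n))) φ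
      (a * b) = CliffordAlgebra.contractLeft φ a * b +
        CliffordAlgebra.involute a * CliffordAlgebra.contractLeft φ b := by
  induction a using CliffordAlgebra.left_induction with
  | algebraMap r =>
    rw [CliffordAlgebra.contractLeft_algebraMap_mul, CliffordAlgebra.contractLeft_algebraMap,
      AlgHom.commutes, zero_mul, zero_add]
  | add x y hx hy => simp only [add_mul, map_add, hx, hy]; abel
  | ι_mul x v h =>
    rw [mul_assoc, CliffordAlgebra.contractLeft_ι_mul, h, CliffordAlgebra.contractLeft_ι_mul,
      map_mul, CliffordAlgebra.involute_ι, mul_add, sub_mul, smul_mul_assoc, neg_mul, neg_mul,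
      mul_assoc, mul_assoc]
    abel

/-- The contraction of superforms with a constant covector in the odd generators. -/
noncomputable def contract (φ : Module.Dual (Fibre n) (Fin n ⊕ Fin n → Fibre n)) :
    SuperForm n R →ₗ[ℝ] SuperForm n R :=
  LinearMap.lTensor R ((CliffordAlgebra.contractLeft
    (Q := (0 : QuadraticForm (Fibre n) (Fin n ⊕ Fin n → Fibre n))) φ).restrictScalars ℝ)

theorem contract_tmul (φ : Module.Dual (Fibre n) (Fin n ⊕ Fin n → Fibre n)) (r : R) (g : Grass n) :
    contract φ (r ⊗ₜ[ℝ] g : SuperForm n R) = r ⊗ₜ[ℝ] (CliffordAlgebra.contractLeft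
    (Q := (0 : QuadraticForm (Fibre n) (Fin n ⊕ Fin n → Fibre n))) φ g) := rfl

theorem dTheta_eq_contract (i : Fin n) :
    (dTheta i : SuperForm n R →ₗ[ℝ] SuperForm n R) = contract (LinearMap.proj (Sum.inl i)) := rfl

theorem contract_mul (φ : Module.Dual (Fibre n) (Fin n ⊕ Fin n → Fibre n)) (a b : SuperForm n R) :
    contract φ (a * b) = contract φ a * b + parity a * contract φ b := by
  induction a using TensorProduct.induction_on with
  | zero => simp
  | add x y hx hy => simp only [add_mul, map_add, hx, hy]; abel
  | tmul r g =>
    induction b using TensorProduct.induction_on with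
    | zero => simp
    | add x y hx hy => simp only [mul_add, map_add, hx, hy]; abel
    | tmul s h =>
      rw [Algebra.TensorProduct.tmul_mul_tmul, contract_tmul, contractLeft_mul, contract_tmul,
        contract_tmul, TensorProduct.tmul_add, Algebra.TensorProduct.tmul_mul_tmul]
      have h : parity (r ⊗ₜ[ℝ] g : SuperForm n R) = r ⊗ₜ[ℝ] CliffordAlgebra.involute g := rfl
      rw [h, Algebra.TensorProduct.tmul_mul_tmul]

theorem parity_func (f : R) : parity (func f : SuperForm n R) = func f := by
  simp [func, parity]

/-- The superdifferential is an odd derivation if the `D i` are derivations. -/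
theorem deRham_mul {D : Fin n → R →ₗ[ℝ] R} (hD : ∀ i f g, D i (f * g) = D i f * g + f * D i g)
    (a b : SuperForm n R) : deRham D (a * b) = deRham D a * b + parity a * deRham D b := by
  have hr : ∀ i (a b : SuperForm n R), LinearMap.rTensor (Grass n) (D i) (a * b) =
      LinearMap.rTensor (Grass n) (D i) a * b + a * LinearMap.rTensor (Grass n) (D i) b := by
    intro i a b
    induction a using TensorProduct.induction_on with
    | zero => simp
    | add x y hx hy => simp only [add_mul, map_add, hx, hy]; abel
    | tmul r g =>
      induction b using TensorProduct.induction_on with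
      | zero => simp
      | add x y hx hy => simp only [mul_add, map_add, hx, hy]; abel
      | tmul s h =>
        simp only [Algebra.TensorProduct.tmul_mul_tmul, LinearMap.rTensor_tmul, hD,
          TensorProduct.add_tmul]
  simp only [deRham, LinearMap.sum_apply, Finset.sum_mul, Finset.mul_sum, ← Finset.sum_add_distrib]
  refine Finset.sum_congr rfl fun i _ => ?_
  simp only [LinearMap.add_apply, LinearMap.comp_apply, LinearMap.mulLeft_apply, hr,
    dTheta_eq_contract, contract_mul]
  have h1 : ∀ c : SuperForm n R, dx R i * (a * c) = parity a * (dx R i * c) := fun c => by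
    rw [← mul_assoc, dx, odd_mul, mul_assoc]
  have h2 : ∀ c : SuperForm n R, dtheta R i * (parity a * c) = parity a * (dtheta R i * c) :=
    fun c => by rw [← mul_assoc, dtheta_comm, mul_assoc]
  rw [mul_add, mul_add, h1, h2]
  noncomm_ring

/-- The signed sum of ordered products `superDet` is the usual one over the ring of even superforms. -/
theorem superDet_coe {p : ℕ} (H : Matrix (Fin p) (Fin p) (EvenForm n R)) :
    superDet (fun i j => (H i j : SuperForm n R)) = (H.det : SuperForm n R) := by
  unfold superDet
  rw [Matrix.det_apply, AddSubmonoidClass.coe_finsetSum]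
  refine Finset.sum_congr rfl fun σ _ => ?_
  have h : (List.ofFn fun j => (H (σ j) j : SuperForm n R)).prod =
      ((∏ j, H (σ j) j : EvenForm n R) : SuperForm n R) := by
    rw [← List.prod_ofFn]
    have := map_list_prod (evenSubalgebra n R).val (List.ofFn fun j => H (σ j) j)
    rw [List.map_ofFn] at this
    exact this.symm
  rw [h, Units.smul_def]
  exact (map_zsmul (evenSubalgebra n R).val _ _).symm

end Leibniz

end OddSymplectic

namespace OddSymplectic

/-! ### Regular families -/

section Regular

variable {ι : Type*} {C : Type*} [CommRing C] {M : Type*} [AddCommGroup M] [Module C M]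

variable (M) in
/-- The submodule `∑_{j ∈ T} w_j M` of `M`. -/
def combos (w : ι → C) (T : Finset ι) : Submodule C M where
  carrier := {x | ∃ y : ι → M, x = ∑ j ∈ T, w j • y j}
  zero_mem' := ⟨0, by simp⟩
  add_mem' := by
    rintro _ _ ⟨y, rfl⟩ ⟨z, rfl⟩
    exact ⟨y + z, by simp [smul_add, Finset.sum_add_distrib]⟩
  smul_mem' := by
    rintro c _ ⟨y, rfl⟩
    exact ⟨c • y, by simp [Finset.smul_sum, smul_comm c]⟩

theorem mem_combos {w : ι → C} {T : Finset ι} {x : M} :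
    x ∈ combos M w T ↔ ∃ y : ι → M, x = ∑ j ∈ T, w j • y j := Iff.rfl

theorem smul_mem_combos {w : ι → C} {T : Finset ι} {j : ι} (hj : j ∈ T) (x : M) :
    w j • x ∈ combos M w T := by
  classical
  refine ⟨Pi.single j x, ?_⟩
  rw [Finset.sum_eq_single_of_mem j hj]
  · simp
  · intro i _ h; simp [h]

theorem combos_congr {w w' : ι → C} {T : Finset ι} (h : ∀ j ∈ T, w j = w' j) :
    combos M w T = combos M w' T := by
  ext x
  exact exists_congr fun y => by rw [Finset.sum_congr rfl fun j hj => by rw [h j hj]]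

theorem mem_combos_insert [DecidableEq ι] {w : ι → C} {T : Finset ι} {k : ι} (hk : k ∉ T) {x : M} :
    x ∈ combos M w (insert k T) ↔ ∃ y, x - w k • y ∈ combos M w T := by
  constructor
  · rintro ⟨y, rfl⟩
    exact ⟨y k, y, by rw [Finset.sum_insert hk]; abel⟩
  · rintro ⟨z, y, h⟩
    refine ⟨Function.update y k z, ?_⟩
    rw [Finset.sum_insert hk, Function.update_self, sub_eq_iff_eq_add.1 h, add_comm]
    congr 1
    refine Finset.sum_congr rfl fun j hj => ?_
    rw [Function.update_of_ne (show j ≠ k from fun e => hk (e ▸ hj))]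

variable (M) in
/-- A family of scalars each of which is a nonzerodivisor on `M` modulo any of the others:
a regular sequence in any order. -/
def RegularFamily (w : ι → C) : Prop :=
  ∀ (T : Finset ι) (k : ι), k ∉ T → ∀ x : M, w k • x ∈ combos M w T → x ∈ combos M w T

/-- Regularity is multiplicative in each member of the family. -/
theorem RegularFamily.update_mul [DecidableEq ι] {w : ι → C} {j : ι} {a b : C}
    (ha : RegularFamily M (Function.update w j a)) (hb : RegularFamily M (Function.update w j b)) :
    RegularFamily M (Function.update w j (a * b)) := by
  have hc : ∀ (c d : C) (T : Finset ι), j ∉ T →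
      combos M (Function.update w j c) T = combos M (Function.update w j d) T := fun c d T hT =>
    combos_congr fun i hi => by
      have : i ≠ j := fun h => hT (h ▸ hi)
      simp [this]
  intro T k hk x hx
  by_cases hj : j ∈ T
  -- From `w_k x = a b y` modulo the rest, `x = b x'` by regularity with `b` in place of `a b`; then
  -- `w_k x' = a y` because `b` may be cancelled, and `x' = a x''` by regularity with `a`.
  · have hkj : k ≠ j := fun h => hk (h ▸ hj)
    obtain ⟨T', hT', rfl⟩ : ∃ T', j ∉ T' ∧ insert j T' = T :=
      ⟨T.erase j, Finset.notMem_erase _ _, Finset.insert_erase hj⟩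
    have hk' : k ∉ T' := fun h => hk (Finset.mem_insert_of_mem h)
    have ha1 := ha (insert j T') k hk
    have hb1 := hb (insert j T') k hk x
    have hb2 := hb T' j hT'
    simp only [mem_combos_insert hT', Function.update_self, Function.update_of_ne hkj,
      hc (a * b) b T' hT', hc a b T' hT'] at ha1 hb1 hb2 hx ⊢
    obtain ⟨y, hy⟩ := hx
    obtain ⟨x', hx'⟩ := hb1 ⟨a • y, by rwa [smul_smul, mul_comm b]⟩
    have h1 : w k • x' - a • y ∈ combos M (Function.update w j b) T' := by
      refine hb2 _ ?_
      have h2 := Submodule.sub_mem _ hy (Submodule.smul_mem _ (w k) hx')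
      convert h2 using 1
      simp only [smul_sub, smul_smul, mul_comm]
      abel
    obtain ⟨x'', hx''⟩ := ha1 x' ⟨y, h1⟩
    refine ⟨x'', ?_⟩
    have h3 := Submodule.add_mem _ hx' (Submodule.smul_mem _ b hx'')
    convert h3 using 1
    simp only [smul_sub, smul_smul, mul_comm]
    abel
  · rcases eq_or_ne k j with rfl | hkj
    · have ha1 := ha T k hk
      have hb1 := hb T k hk
      simp only [Function.update_self, hc (a * b) b T hj, hc a b T hj] at ha1 hb1 hx ⊢
      exact hb1 _ (ha1 _ (by rwa [smul_smul]))
    · have ha1 := ha T k hk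
      simp only [Function.update_of_ne hkj, hc (a * b) a T hj] at ha1 hx ⊢
      exact ha1 _ hx

/-- Products are regular if all families of factors are. Factors are split off one at a time, by
induction on their number. -/
theorem regularFamily_prod [Fintype ι] (u : ι → Multiset C) (hu : ∀ j, u j ≠ 0)
    (h : ∀ s : ι → C, (∀ j, s j ∈ u j) → RegularFamily M s) :
    RegularFamily M fun j => (u j).prod := by
  classical
  induction hN : ∑ j, (u j).card using Nat.strong_induction_on generalizing u with
  | _ N ih =>
    by_cases h1 : ∃ j, 1 < (u j).card
    · obtain ⟨j, hj⟩ := h1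
      obtain ⟨a, ha⟩ := Multiset.exists_mem_of_ne_zero (hu j)
      obtain ⟨v, hv⟩ := Multiset.exists_cons_of_mem ha
      have hv0 : v ≠ 0 := by rintro rfl; simp [hv] at hj
      have step : ∀ z : Multiset C, z ≠ 0 → z ≤ u j → z.card < (u j).card →
          RegularFamily M (Function.update (fun i => (u i).prod) j z.prod) := by
        intro z hz hzu hzc
        have hm : ∀ i, Function.update u j z i ≤ u i := fun i => by
          rcases eq_or_ne i j with rfl | hi
          · simpa using hzu
          · simp [hi]
        have h2 := ih _ (by
          rw [← hN]
          refine Finset.sum_lt_sum (fun i _ => Multiset.card_le_card (hm i)) ⟨j, Finset.mem_univ _, ?_⟩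
          simpa using hzc) (Function.update u j z) (fun i => by
            rcases eq_or_ne i j with rfl | hi
            · simpa using hz
            · simpa [hi] using hu i)
          (fun s hs => h s fun i => Multiset.mem_of_le (hm i) (hs i)) rfl
        convert h2 using 1
        funext i
        rcases eq_or_ne i j with rfl | hi <;> simp [*]
      have hcv : (u j).card = v.card + 1 := by rw [hv, Multiset.card_cons]
      have ha' := step {a} (by simp) (by simpa using ha) (by simpa using hj)
      have hb' := step v hv0 (by rw [hv]; exact Multiset.le_cons_self _ _) (by omega)
      rw [Multiset.prod_singleton] at ha'
      have := ha'.update_mul hb'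
      rwa [← Multiset.prod_cons, ← hv, Function.update_eq_self j (fun i => (u i).prod)] at this
    · have h2 : ∀ j, ∃ a, u j = {a} := fun j => by
        have := Multiset.card_pos.2 (hu j)
        have h3 : ¬ 1 < (u j).card := fun h => h1 ⟨j, h⟩
        exact Multiset.card_eq_one.1 (by omega)
      choose s hs using h2
      have : (fun j => (u j).prod) = s := by funext j; simp [hs]
      rw [this]
      exact h s fun j => by simp [hs]

/-- Regularity passes to direct summands. -/
theorem RegularFamily.retract {C' M' : Type*} [CommRing C'] [AddCommGroup M'] [Module C' M']
    {w : ι → C} {w' : ι → C'} (h : RegularFamily M w) (i : M' →+ M) (r : M →+ M')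
    (hi : ∀ j x, i (w' j • x) = w j • i x) (hr : ∀ j x, r (w j • x) = w' j • r x)
    (hri : ∀ x, r (i x) = x) : RegularFamily M' w' := by
  rintro T k hk x ⟨y, hy⟩
  obtain ⟨z, hz⟩ := h T k hk (i x) ⟨fun j => i (y j), by rw [← hi, hy, map_sum]; simp only [hi]⟩
  exact ⟨fun j => r (z j), by rw [← hri x, hz, map_sum]; simp only [hr]⟩

theorem RegularFamily.comp {κ : Type*} {w : ι → C} (h : RegularFamily M w) (f : κ → ι)
    (hf : Function.Injective f) : RegularFamily M (w ∘ f) := by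
  classical
  have hc : ∀ T, combos M (w ∘ f) T = combos M w (T.map ⟨f, hf⟩) := fun T => by
    ext x
    simp only [mem_combos, Finset.sum_map, Function.Embedding.coeFn_mk, Function.comp_apply]
    constructor
    · rintro ⟨y, rfl⟩
      exact ⟨Function.extend f y 0, Finset.sum_congr rfl fun j _ => by rw [hf.extend_apply]⟩
    · rintro ⟨y, rfl⟩
      exact ⟨y ∘ f, rfl⟩
  intro T k hk x hx
  rw [hc] at hx ⊢
  exact h _ (f k) (by simpa [hf.eq_iff] using hk) x hx

/-- Regularity passes to free modules. -/
theorem RegularFamily.finsupp {w : ι → C} (h : RegularFamily M w) (κ : Type*) :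
    RegularFamily (κ →₀ M) w := by
  classical
  rintro T k hk x ⟨y, hy⟩
  have h1 : ∀ a, ∃ z : ι → M, x a = ∑ j ∈ T, w j • z j := fun a => by
    refine h T k hk (x a) ⟨fun j => y j a, ?_⟩
    have := DFunLike.congr_fun hy a
    simpa [Finsupp.finsetSum_apply] using this
  choose z hz using h1
  refine ⟨fun j => Finsupp.onFinset x.support (fun a => if x a = 0 then 0 else z a j) fun a ha => ?_, ?_⟩
  · rw [Finsupp.mem_support_iff]
    intro h0
    simp [h0] at ha
  · ext a
    simp only [Finsupp.finsetSum_apply, Finsupp.smul_apply, Finsupp.onFinset_apply]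
    by_cases h0 : x a = 0
    · simp [h0]
    · simp only [h0, if_false]
      exact hz a

theorem combos_eq_span (w : ι → C) (T : Finset ι) :
    (combos C w T : Set C) = (Ideal.span (w '' T) : Set C) := by
  classical
  ext x
  simp only [SetLike.mem_coe]
  constructor
  · rintro ⟨y, rfl⟩
    exact Ideal.sum_mem _ fun j hj => by
      rw [smul_eq_mul, mul_comm]
      exact Ideal.mul_mem_left _ _ (Ideal.subset_span ⟨j, hj, rfl⟩)
  · intro hx
    have : Ideal.span (w '' T) ≤ combos C w T := by
      rw [Ideal.span_le]
      rintro _ ⟨j, hj, rfl⟩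
      have := smul_mem_combos (M := C) (w := w) hj 1
      simpa using this
    exact this hx

theorem regularFamily_X {κ : Type*} : RegularFamily (MvPolynomial κ C)
    (MvPolynomial.X : κ → MvPolynomial κ C) := by
  classical
  intro T k hk x hx
  rw [← SetLike.mem_coe, combos_eq_span, SetLike.mem_coe, MvPolynomial.mem_ideal_span_X_image] at hx ⊢
  intro m hm
  obtain ⟨i, hi, h0⟩ := hx (Finsupp.single k 1 + m) (by
    rw [smul_eq_mul, MvPolynomial.mem_support_iff, MvPolynomial.coeff_X_mul]
    exact MvPolynomial.mem_support_iff.1 hm)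
  refine ⟨i, hi, ?_⟩
  have hik : k ≠ i := fun h => hk (by rw [h]; exact hi)
  simpa [Finsupp.single_apply, hik] using h0

end Regular

/-! ### Regularity of products of linear forms -/

section LinearForms

variable {n : ℕ} {R : Type*} [CommRing R] [Algebra ℝ R] {ev : R →+* ℝ}

theorem ev_algebraMap (ev : R →+* ℝ) (c : ℝ) : ev (algebraMap ℝ R c) = c :=
  RingHom.congr_fun (Subsingleton.elim (ev.comp (algebraMap ℝ R)) (RingHom.id ℝ)) c

/-- Linear forms that are independent at the base point are part of a linear coordinate system,
hence form a regular family. -/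
theorem regularFamily_linear (hloc : ∀ r, ev r ≠ 0 → IsUnit r) {p : ℕ} (v : Fin p → Fin n → R)
    (hv : LinearIndependent ℝ fun j i => ev (v j i)) :
    RegularFamily (MvPolynomial (Fin n) R) fun j => ∑ i, MvPolynomial.C (v j i) * MvPolynomial.X i := by
  classical
  set b := Module.Basis.sumExtend hv with hb
  have : Finite (Fin p ⊕ Module.Basis.sumExtendIndex hv) := Module.Finite.finite_basis b
  have := Fintype.ofFinite (Fin p ⊕ Module.Basis.sumExtendIndex hv)
  obtain ⟨σ⟩ : Nonempty (Fin n ≃ (Fin p ⊕ Module.Basis.sumExtendIndex hv)) :=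
    ⟨Fintype.equivOfCardEq (by
      rw [← Module.finrank_eq_card_basis b]; simp)⟩
  have hbl : ∀ j, b (Sum.inl j) = fun i => ev (v j i) := fun j => by
    simp only [hb, Module.Basis.sumExtend, Module.Basis.reindex_apply, Module.Basis.extend_apply_self]
    rfl
  -- the given forms, completed by constant ones; invertible since it is so at the base point
  set A : Matrix (Fin n) (Fin n) R := fun i =>
    Sum.elim v (fun k i => algebraMap ℝ R (b (Sum.inr k) i)) (σ i) with hA
  have hAev : A.map ev = (fun i => b (σ i)) := by
    ext i k
    rw [Matrix.map_apply, hA]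
    rcases h : σ i with j | j
    · simp [h, hbl]
    · simp [h, ev_algebraMap]
  have hdet : IsUnit A.det := by
    refine hloc _ ?_
    rw [RingHom.map_det, RingHom.mapMatrix_apply, hAev]
    have h1 : IsUnit (Matrix.of fun i => b (σ i)) :=
      Matrix.linearIndependent_rows_iff_isUnit.1 (b.linearIndependent.comp σ σ.injective)
    exact ((Matrix.isUnit_iff_isUnit_det _).1 h1).ne_zero
  -- the linear change of coordinates with matrix `B`
  let φ : Matrix (Fin n) (Fin n) R → MvPolynomial (Fin n) R →ₐ[R] MvPolynomial (Fin n) R := fun B =>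
    MvPolynomial.aeval fun i => ∑ k, MvPolynomial.C (B i k) * MvPolynomial.X k
  have hφ : ∀ B B' : Matrix (Fin n) (Fin n) R, B * B' = 1 → ∀ x, φ B' (φ B x) = x := by
    intro B B' hBB x
    have : (φ B').comp (φ B) = AlgHom.id R _ := by
      refine MvPolynomial.algHom_ext fun i => ?_
      have h2 : ∀ i l, ∑ k, MvPolynomial.C (B i k) * (MvPolynomial.C (B' k l) * MvPolynomial.X l) =
          MvPolynomial.C ((B * B') i l) * (MvPolynomial.X l : MvPolynomial (Fin n) R) := fun i l => by
        rw [Matrix.mul_apply, map_sum, Finset.sum_mul]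
        exact Finset.sum_congr rfl fun k _ => by rw [map_mul, mul_assoc]
      simp only [φ, AlgHom.comp_apply, MvPolynomial.aeval_X, map_sum, map_mul, AlgHom.id_apply,
        MvPolynomial.algHom_C, MvPolynomial.algebraMap_eq, Finset.mul_sum]
      rw [Finset.sum_comm]
      simp only [h2, hBB, Matrix.one_apply, apply_ite MvPolynomial.C, map_one, map_zero, ite_mul,
        one_mul, zero_mul, Finset.sum_ite_eq, Finset.mem_univ, if_true]
    exact DFunLike.congr_fun this x
  have hX := (regularFamily_X (C := R) (κ := Fin n)).comp (fun j : Fin p => σ.symm (Sum.inl j))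
    (σ.symm.injective.comp Sum.inl_injective)
  have hφX : ∀ j : Fin p, φ A (MvPolynomial.X (σ.symm (Sum.inl j))) =
      ∑ i, MvPolynomial.C (v j i) * MvPolynomial.X i := fun j => by
    simp [φ, hA]
  have hφX' : ∀ j : Fin p, φ A⁻¹ (∑ i, MvPolynomial.C (v j i) * MvPolynomial.X i) =
      (MvPolynomial.X (σ.symm (Sum.inl j))) := fun j => by
    rw [← hφX, hφ _ _ (Matrix.mul_nonsing_inv A hdet)]
  refine hX.retract (φ A⁻¹ : _ →+ _) (φ A : _ →+ _) (fun j x => ?_) (fun j x => ?_) fun x => ?_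
  · simp only [smul_eq_mul, AddMonoidHom.coe_coe, map_mul, hφX']
    rfl
  · simp only [smul_eq_mul, AddMonoidHom.coe_coe, map_mul, hφX, Function.comp_apply]
  · exact hφ _ _ (Matrix.nonsing_inv_mul A hdet) x

theorem regularFamily_linForm (hloc : ∀ r, ev r ≠ 0 → IsUnit r) {p : ℕ} (v : Fin p → Fin n → R)
    (hv : LinearIndependent ℝ fun j i => ev (v j i)) :
    RegularFamily (R ⊗[ℝ] Fibre n) fun j => linForm (v j) := by
  have e : ∀ j, MvPolynomial.algebraTensorAlgEquiv ℝ R (linForm (v j)) =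
      ∑ i, MvPolynomial.C (v j i) * MvPolynomial.X i := fun j => by
    simp [linForm, MvPolynomial.smul_eq_C_mul]
  refine (regularFamily_linear hloc v hv).retract
    (MvPolynomial.algebraTensorAlgEquiv ℝ R (σ := Fin n)).toRingEquiv.toAddEquiv.toAddMonoidHom
    (MvPolynomial.algebraTensorAlgEquiv ℝ R (σ := Fin n)).symm.toRingEquiv.toAddEquiv.toAddMonoidHom
    (fun j x => ?_) (fun j x => ?_) fun x => ?_
  · change MvPolynomial.algebraTensorAlgEquiv ℝ R (linForm (v j) * x) = _ * _
    rw [map_mul, e]; rfl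
  · change (MvPolynomial.algebraTensorAlgEquiv ℝ R).symm (_ * x) = linForm (v j) * _
    rw [map_mul, ← e, AlgEquiv.symm_apply_apply]; rfl
  · exact (MvPolynomial.algebraTensorAlgEquiv ℝ R).symm_apply_apply x

/-- The superforms are free over the functions of `x` and `dθ`; regular families of such functions
therefore stay regular. -/
theorem RegularFamily.superForm {ι : Type*} {a : ι → R ⊗[ℝ] Fibre n}
    (h : RegularFamily (R ⊗[ℝ] Fibre n) a) :
    RegularFamily (SuperForm n R) fun j => evenOf n R (a j) := by
  classical
  let : LinearOrder (Fin n ⊕ Fin n) := linearOrderOfSTO WellOrderingRel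
  let b := (Pi.basisFun (Fibre n) (Fin n ⊕ Fin n)).ExteriorAlgebra
  let e₁ : Grass n ≃ₗ[ℝ] (Finset (Fin n ⊕ Fin n) →₀ Fibre n) := b.repr.restrictScalars ℝ
  let e : SuperForm n R ≃ₗ[ℝ] (Finset (Fin n ⊕ Fin n) →₀ R ⊗[ℝ] Fibre n) :=
    (TensorProduct.congr (LinearEquiv.refl ℝ R) e₁).trans
      (TensorProduct.finsuppRight ℝ ℝ R (Fibre n) (Finset (Fin n ⊕ Fin n)))
  have he : ∀ (a : R ⊗[ℝ] Fibre n) (x : SuperForm n R), e (pureForm n R a * x) = a • e x := by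
    intro a x
    induction a using TensorProduct.induction_on with
    | zero => ext T; rw [map_zero, zero_mul, map_zero, Finsupp.smul_apply, zero_smul]; rfl
    | add a b ha hb => rw [map_add, add_mul, map_add, ha, hb, add_smul]
    | tmul r f =>
      induction x using TensorProduct.induction_on with
      | zero => simp
      | add x y hx hy => rw [mul_add, map_add, hx, hy, map_add, smul_add]
      | tmul s g =>
        ext T
        have h1 : ∀ (s : R) (g : Grass n), e (s ⊗ₜ[ℝ] g) T = s ⊗ₜ[ℝ] b.repr g T := fun s g => by
          simp only [e, LinearEquiv.trans_apply, TensorProduct.congr_tmul,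
            TensorProduct.finsuppRight_apply_tmul_apply]
          rfl
        rw [pureForm_tmul, Algebra.TensorProduct.tmul_mul_tmul, h1, Finsupp.smul_apply, h1,
          ← Algebra.smul_def, map_smul]
        simp [Algebra.TensorProduct.tmul_mul_tmul]
  refine (h.finsupp (Finset (Fin n ⊕ Fin n))).retract e.toLinearMap.toAddMonoidHom
    e.symm.toLinearMap.toAddMonoidHom (fun j x => ?_) (fun j x => ?_) fun x => ?_
  · exact he _ _
  · refine e.injective ?_
    rw [EvenForm.smul_def]
    change e (e.symm _) = e (pureForm n R (a j) * e.symm x)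
    rw [he, LinearEquiv.apply_symm_apply, LinearEquiv.apply_symm_apply]
  · exact e.symm_apply_apply x

/-- The even superforms are a direct summand of the superforms. -/
theorem RegularFamily.evenForm {ι : Type*} {w : ι → EvenForm n R}
    (h : RegularFamily (SuperForm n R) w) : RegularFamily (EvenForm n R) w := by
  refine h.retract (evenSubalgebra n R).val.toLinearMap.toAddMonoidHom
    ⟨⟨evenPart, by simpa using evenPart_coe (0 : EvenForm n R)⟩, evenPart_add⟩ (fun j x => ?_)
    (fun j x => ?_) fun x => ?_
  · rfl
  · exact evenPart_smul _ _
  · exact evenPart_coe _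

end LinearForms

end OddSymplectic

namespace OddSymplectic

/-! ### Refinement of delta systems -/

section Refinement

/-- Given finitely many independent `p`-tuples of vectors, one can choose in the span of each of them
`q ≤ p` vectors, in such a way that vectors chosen at distinct stages, from any of the tuples, are
independent. -/
theorem exists_generic_combinations {V κ : Type*} [AddCommGroup V] [Module ℝ V] [Finite κ] {p : ℕ}
    (t : κ → Fin p → V) (ht : ∀ c, LinearIndependent ℝ (t c)) (q : ℕ) (hq : q ≤ p) :
    ∃ a : Fin q → κ → Fin p → ℝ, ∀ c : Fin q → κ,
      LinearIndependent ℝ fun j => ∑ k, a j (c j) k • t (c j) k := by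
  induction q with
  | zero => exact ⟨fun j => j.elim0, fun c => linearIndependent_empty_type⟩
  | succ q ih =>
    obtain ⟨a, ha⟩ := ih (by omega)
    have h1 : ∀ c₀ : κ, ∃ x : Fin p → ℝ, ∀ c : Fin q → κ,
        ∑ k, x k • t c₀ k ∉ Submodule.span ℝ (Set.range fun j => ∑ k, a j (c j) k • t (c j) k) := by
      intro c₀
      -- otherwise the coefficient space is a finite union of the subspaces `W c`, so one of them is
      -- everything, which is impossible for dimension reasons
      by_contra! hcon
      let W : (Fin q → κ) → Submodule ℝ (Fin p → ℝ) := fun c =>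
        (Submodule.span ℝ (Set.range fun j => ∑ k, a j (c j) k • t (c j) k)).comap
          (Fintype.linearCombination ℝ (t c₀))
      have hW : ⋃ c, (W c : Set (Fin p → ℝ)) = Set.univ := by
        refine Set.eq_univ_of_forall fun x => ?_
        obtain ⟨c, hc⟩ := hcon x
        exact Set.mem_iUnion.2 ⟨c, by simpa [W, Fintype.linearCombination_apply] using hc⟩
      obtain ⟨c, hc⟩ := Subspace.exists_eq_top_of_iUnion_eq_univ hW
      have h2 : Submodule.span ℝ (Set.range (t c₀)) ≤
          Submodule.span ℝ (Set.range fun j => ∑ k, a j (c j) k • t (c j) k) := by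
        rw [Submodule.span_le]
        rintro _ ⟨k, rfl⟩
        have : Pi.single k 1 ∈ W c := hc ▸ Submodule.mem_top
        simpa [W, Fintype.linearCombination_apply_single] using this
      have : FiniteDimensional ℝ
          (Submodule.span ℝ (Set.range fun j => ∑ k, a j (c j) k • t (c j) k)) :=
        FiniteDimensional.span_of_finite ℝ (Set.finite_range _)
      have h3 := Submodule.finrank_mono h2
      rw [finrank_span_eq_card (ht c₀), finrank_span_eq_card (ha c)] at h3
      simp at h3
      omega
    choose x hx using h1
    refine ⟨Fin.cons x a, fun c => ?_⟩
    have := linearIndependent_finCons.2 ⟨ha (Fin.tail c), hx (c 0) (Fin.tail c)⟩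
    have e : (fun j => ∑ k, (Fin.cons x a : Fin (q + 1) → κ → Fin p → ℝ) j (c j) k • t (c j) k) =
        Fin.cons (∑ k, x (c 0) k • t (c 0) k)
          fun j => ∑ k, a j (Fin.tail c j) k • t (Fin.tail c j) k := by
      funext j
      refine Fin.cases ?_ (fun j => ?_) j <;> simp [Fin.tail]
    rw [e]
    exact this

variable {n : ℕ} {R : Type*} [CommRing R] [Algebra ℝ R] {ev : R →+* ℝ} {p : ℕ}

/-- The members of a delta system as elements of the commutative ring of even superforms. -/
def DeltaSystem.even (u : DeltaSystem n ev p) (j : Fin p) : EvenForm n R := ⟨u.1 j, u.2.1 j⟩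

@[simp] theorem DeltaSystem.coe_even (u : DeltaSystem n ev p) (j : Fin p) :
    (u.even j : SuperForm n R) = u.1 j := rfl

/-- A delta system without nilpotent terms: every member is a product of linear forms. -/
def DeltaSystem.IsPure (u : DeltaSystem n ev p) : Prop := ∀ j, u.1 j = pureForm n R (body (u.1 j))

theorem linForm_sum {κ : Type*} (s : Finset κ) (a : κ → ℝ) (v : κ → Fin n → R) :
    linForm (∑ k ∈ s, a k • v k) = ∑ k ∈ s, a k • linForm (v k) := by
  simp only [linForm, Finset.sum_apply, Pi.smul_apply, TensorProduct.sum_tmul, Finset.smul_sum,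
    TensorProduct.smul_tmul']
  exact Finset.sum_comm

/-- Pure delta systems are regular. -/
theorem DeltaSystem.IsPure.regularFamily (hloc : ∀ r, ev r ≠ 0 → IsUnit r)
    {u : DeltaSystem n ev p} (hu : u.IsPure) : RegularFamily (SuperForm n R) u.even := by
  obtain ⟨-, L, hL, hs⟩ := u.2
  have h1 : RegularFamily (R ⊗[ℝ] Fibre n) fun j => ((L j).map linForm).prod := by
    refine regularFamily_prod _ (fun j => by simpa using (hL j).1) fun s hsel => ?_
    choose v hv hvs using fun j => Multiset.mem_map.1 (hsel j)
    have : s = fun j => linForm (v j) := funext fun j => (hvs j).symm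
    rw [this]
    exact regularFamily_linForm hloc v (hs v hv)
  have h2 := h1.superForm
  convert h2 using 1
  funext j
  refine Subtype.ext ?_
  rw [DeltaSystem.coe_even, hu j, (hL j).2]
  rfl

/-- A prime ideal that contains all members of a delta system contains a linear factor of each of
them, because nilpotents lie in every prime. -/
theorem DeltaSystem.selection_of_prime {u : DeltaSystem n ev p} {L : Fin p → Multiset (Fin n → R)}
    (hL : ∀ j, body (u.1 j) = ((L j).map linForm).prod) {P : Ideal (EvenForm n R)} [P.IsPrime]
    (hP : ∀ j, u.even j ∈ P) : ∀ j, ∃ v ∈ L j, evenOf n R (linForm v) ∈ P := by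
  intro j
  have h1 : evenOf n R (body (u.1 j)) ∈ P := by
    have h2 : u.even j - evenOf n R (body (u.1 j)) ∈ P := by
      obtain ⟨k, hk⟩ := isNilpotent_sub_evenOf_body (u.even j)
      exact Ideal.IsPrime.mem_of_pow_mem ‹_› k (hk ▸ P.zero_mem)
    have := P.sub_mem (hP j) h2
    rwa [sub_sub_cancel] at this
  rw [hL, map_multiset_prod, Multiset.map_map, Ideal.IsPrime.multiset_prod_mem_iff_exists_mem ‹_›] at h1
  simpa using h1

/-- Any two delta systems have a common pure refinement. Its members are powers of products of
generic linear forms, one for each way of selecting factors of the given systems; such a product lies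
in every prime ideal that contains one of the given systems. -/
theorem DeltaSystem.exists_common_refinement (u v : DeltaSystem n ev p) :
    ∃ w : DeltaSystem n ev p, w.IsPure ∧
      (∃ H : Matrix (Fin p) (Fin p) (EvenForm n R), w.even = H.mulVec u.even) ∧
      ∃ H : Matrix (Fin p) (Fin p) (EvenForm n R), w.even = H.mulVec v.even := by
  classical
  obtain ⟨-, L, hL, hs⟩ := id u.2
  obtain ⟨-, L', hL', hs'⟩ := id v.2
  -- all ways of selecting one linear factor from each member of `u`, or of `v`
  let F : Finset (Fin p → Fin n → R) := Fintype.piFinset (fun j => (L j).toFinset) ∪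
    Fintype.piFinset (fun j => (L' j).toFinset)
  have hF : ∀ c : F, LinearIndependent ℝ fun j i => ev (c.1 j i) := fun c => by
    rcases Finset.mem_union.1 c.2 with h | h
    · exact hs _ fun j => by simpa using Fintype.mem_piFinset.1 h j
    · exact hs' _ fun j => by simpa using Fintype.mem_piFinset.1 h j
  obtain ⟨a, ha⟩ := exists_generic_combinations (fun (c : F) k i => ev (c.1 k i)) hF p le_rfl
  let l : Fin p → F → Fin n → R := fun j c => ∑ k, a j c k • c.1 k
  let W : Fin p → Multiset (Fin n → R) := fun j => Finset.univ.val.map (l j)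
  have key : ∀ (s : DeltaSystem n ev p) (L : Fin p → Multiset (Fin n → R)),
      (∀ j, body (s.1 j) = ((L j).map linForm).prod) →
      (Fintype.piFinset (fun j => (L j).toFinset) ⊆ F) →
      ∀ j, evenOf n R ((W j).map linForm).prod ∈ (Ideal.span (Set.range s.even)).radical := by
    intro s L hL hLF j
    rw [Ideal.radical_eq_sInf, Submodule.mem_sInf]
    rintro P ⟨hle, hP⟩
    choose c hc hcP using s.selection_of_prime hL (P := P)
      fun j => hle (Ideal.subset_span ⟨j, rfl⟩)
    have hcF : c ∈ F := hLF (Fintype.mem_piFinset.2 fun j => by simpa using hc j)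
    have h1 : evenOf n R (linForm (l j ⟨c, hcF⟩)) ∈ P := by
      simp only [l, linForm_sum, map_sum]
      refine P.sum_mem fun k _ => ?_
      have : (a j ⟨c, hcF⟩ k • linForm (c k) : R ⊗[ℝ] Fibre n) =
        algebraMap ℝ (R ⊗[ℝ] Fibre n) (a j ⟨c, hcF⟩ k) * linForm (c k) := by
          rw [Algebra.algebraMap_eq_smul_one, smul_mul_assoc, one_mul]
      rw [this, map_mul]
      exact Ideal.mul_mem_left P _ (hcP k)
    refine Ideal.mem_of_dvd P (map_dvd _ (Multiset.dvd_prod ?_)) h1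
    exact Multiset.mem_map_of_mem _ (Multiset.mem_map_of_mem _ (Finset.mem_univ_val _))
  choose N hN using key u L (fun j => (hL j).2) Finset.subset_union_left
  choose N' hN' using key v L' (fun j => (hL' j).2) Finset.subset_union_right
  let K := ∑ j, N j + ∑ j, N' j + 1
  have hbody : ∀ j, body (pureForm n R (((W j).map linForm).prod ^ K)) =
      (((K • W j).map linForm).prod) := fun j => by
    rw [body_pureForm, Multiset.map_nsmul, Multiset.prod_nsmul]
  have hsys : IsDeltaSystem ev fun j => pureForm n R (((W j).map linForm).prod ^ K) := by
    refine ⟨fun j => parity_pureForm _, fun j => K • W j, fun j => ⟨?_, hbody j⟩, fun s hsel => ?_⟩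
    · have hne : ∀ j, ∃ c, c ∈ L j := fun j => Multiset.exists_mem_of_ne_zero (hL j).1
      choose c hc using hne
      have hcF : c ∈ F := Finset.mem_union_left _ (Fintype.mem_piFinset.2 fun j => by simpa using hc j)
      intro h0
      replace h0 : K • W j = 0 := h0
      have h1 : l j ⟨c, hcF⟩ ∈ K • W j := by
        rw [Multiset.mem_nsmul]
        exact ⟨by simp [K], Multiset.mem_map_of_mem _ (Finset.mem_univ_val _)⟩
      rw [h0] at h1
      simp at h1
    · have h1 : ∀ j, ∃ c : F, l j c = s j := fun j => by
        have := (Multiset.mem_nsmul.1 (hsel j)).2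
        obtain ⟨c, -, hc⟩ := Multiset.mem_map.1 this
        exact ⟨c, hc⟩
      choose c hc using h1
      have e : (fun j i => ev (s j i)) = fun j => ∑ k, a j (c j) k • fun i => ev ((c j).1 k i) := by
        funext j i
        rw [← hc j]
        simp [l, Algebra.smul_def, ev_algebraMap]
      rw [e]
      exact ha c
  have hmem : ∀ (s : DeltaSystem n ev p) (N : Fin p → ℕ), (∀ j, N j ≤ K) →
      (∀ j, evenOf n R ((W j).map linForm).prod ^ N j ∈ Ideal.span (Set.range s.even)) →
      ∃ H : Matrix (Fin p) (Fin p) (EvenForm n R),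
        DeltaSystem.even (⟨_, hsys⟩ : DeltaSystem n ev p) = H.mulVec s.even := by
    intro s N hNK hN
    have h1 : ∀ j, evenOf n R (((W j).map linForm).prod ^ K) ∈ Ideal.span (Set.range s.even) :=
      fun j => by
        rw [map_pow]
        exact Ideal.pow_mem_of_pow_mem _ (hN j) (hNK j)
    choose H hH using fun j => Ideal.mem_span_range_iff_exists_fun.1 (h1 j)
    exact ⟨H, funext fun j => (hH j).symm⟩
  refine ⟨⟨_, hsys⟩, fun j => ?_, hmem u N (fun j => ?_) hN, hmem v N' (fun j => ?_) hN'⟩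
  · change _ = pureForm n R (body (pureForm n R _))
    rw [body_pureForm]
  · have := Finset.single_le_sum (f := N) (fun _ _ => Nat.zero_le _) (Finset.mem_univ j)
    omega
  · have := Finset.single_le_sum (f := N') (fun _ _ => Nat.zero_le _) (Finset.mem_univ j)
    omega

end Refinement

end OddSymplectic

namespace OddSymplectic

/-! ### Independence of determinants of the choice of a transition matrix -/

section TransitionDet

variable {C : Type*} [CommRing C] {p : ℕ}

/-- Two matrices that carry `u` to the same regular family `w` have the same determinant modulo `w`.
The rows are exchanged one at a time; the difference is then the determinant of a matrix that carries
`u` to `w` with one member replaced by zero, and Cramer's rule applies. -/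
theorem det_sub_det_mem {w u : Fin p → C} (hw : RegularFamily C w) {H H' : Matrix (Fin p) (Fin p) C}
    (hH : w = H.mulVec u) (hH' : w = H'.mulVec u) : H.det - H'.det ∈ combos C w Finset.univ := by
  classical
  -- rows in `T` are taken from `H`, the others from `H'`
  let G : Finset (Fin p) → Matrix (Fin p) (Fin p) C := fun T i => if i ∈ T then H i else H' i
  have hG : ∀ T, (G T).mulVec u = w := fun T => by
    funext i
    by_cases hi : i ∈ T
    · simp only [Matrix.mulVec, G, hi, if_true]
      conv_rhs => rw [hH]
      rfl
    · simp only [Matrix.mulVec, G, hi, if_false]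
      conv_rhs => rw [hH']
      rfl
  have key : ∀ T, (G T).det - H'.det ∈ combos C w Finset.univ := by
    intro T
    induction T using Finset.induction_on with
    | empty => simp [G]
    | insert k T hk ih =>
      have h1 : G (insert k T) = (G T).updateRow k (H k) := by
        ext i j
        rw [Matrix.updateRow_apply]
        rcases eq_or_ne i k with rfl | h
        · simp [G]
        · simp [G, h]
      have h2 : (G T).updateRow k (H' k) = G T := by
        ext i j
        rw [Matrix.updateRow_apply]
        rcases eq_or_ne i k with rfl | h
        · simp [G, hk]
        · simp [h]
      set K := (G T).updateRow k (H k - H' k) with hK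
      have h3 : (G (insert k T)).det - (G T).det = K.det := by
        have := Matrix.det_updateRow_add (G T) k (H k - H' k) (H' k)
        rw [sub_add_cancel, ← h1, h2] at this
        rw [this, add_sub_cancel_right]
      have h4 : K.mulVec u = Function.update w k 0 := by
        funext i
        rcases eq_or_ne i k with rfl | h
        · have e1 := congrFun hH i
          have e2 := congrFun hH' i
          simp only [Matrix.mulVec] at e1 e2
          simp only [hK, Matrix.mulVec, Matrix.updateRow_self, sub_dotProduct, Function.update_self]
          rw [← e1, ← e2, sub_self]
        · simp only [hK, Matrix.mulVec, Matrix.updateRow_ne h, ne_eq, h, not_false_eq_true,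
            Function.update_of_ne]
          exact congrFun (hG T) i
      have h5 : ∀ j, K.det * u j ∈ combos C w (Finset.univ.erase k) := fun j => by
        have e1 : K.adjugate.mulVec (K.mulVec u) = K.det • u := by
          rw [Matrix.mulVec_mulVec, Matrix.adjugate_mul, Matrix.smul_mulVec, Matrix.one_mulVec]
        have e2 := congrFun e1 j
        rw [h4, Pi.smul_apply, smul_eq_mul] at e2
        rw [← e2]
        refine ⟨fun i => K.adjugate j i, ?_⟩
        simp only [Matrix.mulVec, dotProduct]
        rw [← Finset.add_sum_erase _ _ (Finset.mem_univ k), Function.update_self, mul_zero, zero_add]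
        refine Finset.sum_congr rfl fun i hi => ?_
        rw [Function.update_of_ne (Finset.ne_of_mem_erase hi), smul_eq_mul, mul_comm]
      have h6 : K.det ∈ combos C w (Finset.univ.erase k) := by
        refine hw _ k (Finset.notMem_erase _ _) _ ?_
        rw [congrFun hH k, smul_eq_mul]
        simp only [Matrix.mulVec, dotProduct, Finset.sum_mul]
        refine Submodule.sum_mem _ fun j _ => ?_
        rw [mul_assoc, mul_comm (u j)]
        exact Submodule.smul_mem _ (H k j) (h5 j)
      have h7 : K.det ∈ combos C w Finset.univ := by
        rw [← Finset.insert_erase (Finset.mem_univ k), mem_combos_insert (Finset.notMem_erase _ _)]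
        exact ⟨0, by simpa using h6⟩
      have := Submodule.add_mem _ h7 ih
      rwa [← h3, sub_add_sub_cancel] at this
  have := key Finset.univ
  have h1 : G Finset.univ = H := by ext; simp [G]
  rwa [h1] at this

/-- The derivative of the transition rule: it is the transition rule itself over the ring of elements
`b + ε c` with `ε² = 0`, applied to the elements `b + ε D b` and to the factorizations
`u² = (u - ε D u) (u + ε D u)`. -/
theorem derivation_det_mem {B N : Type*} [CommRing B] [Algebra ℝ B] [AddCommGroup N] [Module B N]
    [Module ℝ N] [IsScalarTower ℝ B N]
    (D : Derivation ℝ B N) {w u v : Fin p → B} (hwB : RegularFamily B w) (hwN : RegularFamily N w)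
    {H K K' : Matrix (Fin p) (Fin p) B} (hH : v = H.mulVec u)
    (hK : w = K.mulVec fun i => v i * v i) (hK' : w = K'.mulVec fun i => u i * u i) :
    K'.det • D (∏ i, u i) + K.det • ((∏ i, v i) • D H.det - H.det • D (∏ i, v i)) ∈
      combos N w Finset.univ := by
  let : Module Bᵐᵒᵖ N := Module.compHom _ ((RingHom.id B).fromOpposite mul_comm)
  have : IsCentralScalar B N := ⟨fun r m => rfl⟩
  have hwC : RegularFamily (TrivSqZeroExt B N)
      fun j => (TrivSqZeroExt.inl (w j) : TrivSqZeroExt B N) := by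
    rintro T k hk x ⟨y, hy⟩
    obtain ⟨z, hz⟩ := hwB T k hk x.fst ⟨fun j => (y j).fst, by
      have := congrArg TrivSqZeroExt.fst hy
      simpa [TrivSqZeroExt.fst_sum] using this⟩
    obtain ⟨z', hz'⟩ := hwN T k hk x.snd ⟨fun j => (y j).snd, by
      have := congrArg TrivSqZeroExt.snd hy
      simpa [TrivSqZeroExt.snd_sum] using this⟩
    refine ⟨fun j => TrivSqZeroExt.inl (z j) + TrivSqZeroExt.inr (z' j), TrivSqZeroExt.ext ?_ ?_⟩
    · simpa [TrivSqZeroExt.fst_sum] using hz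
    · simpa [TrivSqZeroExt.snd_sum] using hz'
  -- `b ↦ b + ε D b`
  let φ : Derivation ℝ B N → B →+* TrivSqZeroExt B N := fun D =>
    { toFun := fun b => TrivSqZeroExt.inl b + TrivSqZeroExt.inr (D b)
      map_one' := by simp
      map_zero' := by simp
      map_add' := fun a b => by
        refine TrivSqZeroExt.ext ?_ ?_ <;> simp
      map_mul' := fun a b => by
        refine TrivSqZeroExt.ext ?_ ?_ <;> simp }
  have hφ : ∀ b : B, φ (-D) b * φ D b = TrivSqZeroExt.inl (b * b) := fun b => by
    refine TrivSqZeroExt.ext ?_ ?_ <;> simp [φ]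
  have hsq : ∀ (A : Matrix (Fin p) (Fin p) B) (z : Fin p → B), (w = A.mulVec fun i => z i * z i) →
      (fun j => (TrivSqZeroExt.inl (w j) : TrivSqZeroExt B N)) = (A.map (TrivSqZeroExt.inlHom B N) *
        Matrix.diagonal fun i => φ (-D) (z i)).mulVec fun i => φ D (z i) := by
    intro A z hA
    rw [← Matrix.mulVec_mulVec]
    have h1 : (Matrix.diagonal fun i => φ (-D) (z i)).mulVec (fun i => φ D (z i)) =
        fun i => TrivSqZeroExt.inlHom B N (z i * z i) := by
      funext i
      rw [Matrix.mulVec_diagonal, hφ]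
      rfl
    rw [h1]
    funext j
    have := RingHom.map_mulVec (TrivSqZeroExt.inlHom B N) A (fun i => z i * z i) j
    rw [← hA] at this
    exact this
  have h1 := hsq K' u hK'
  have h2 := hsq K v hK
  have h3 : (fun i => φ D (v i)) = (H.map (φ D)).mulVec fun i => φ D (u i) := by
    funext j
    have := RingHom.map_mulVec (φ D) H u j
    rw [← hH] at this
    exact this
  rw [h3, Matrix.mulVec_mulVec] at h2
  obtain ⟨y, hy⟩ := det_sub_det_mem hwC h2 h1
  have hdet : ∀ (A : Matrix (Fin p) (Fin p) B) (ψ : B →+* TrivSqZeroExt B N), (A.map ψ).det = ψ A.det := fun A ψ => by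
    rw [RingHom.map_det]; rfl
  rw [Matrix.det_mul, Matrix.det_mul, Matrix.det_mul, Matrix.det_diagonal, Matrix.det_diagonal,
    hdet, hdet, hdet, ← map_prod, ← map_prod] at hy
  refine ⟨fun j => (y j).snd, ?_⟩
  have hfst : ∀ (D : Derivation ℝ B N) (b : B), (φ D b).fst = b := fun D b => by simp [φ]
  have hsnd : ∀ (D : Derivation ℝ B N) (b : B), (φ D b).snd = D b := fun D b => by simp [φ]
  have hf0 : ∀ b : B, (TrivSqZeroExt.inlHom B N b).fst = b := fun b => rfl
  have hs0 : ∀ b : B, (TrivSqZeroExt.inlHom B N b).snd = 0 := fun b => rfl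
  have := congrArg TrivSqZeroExt.snd hy
  simp only [TrivSqZeroExt.snd_sum, TrivSqZeroExt.snd_sub, TrivSqZeroExt.snd_mul,
    TrivSqZeroExt.fst_mul, hfst, hsnd, hf0, hs0, smul_eq_mul, TrivSqZeroExt.fst_inl,
    TrivSqZeroExt.snd_inl, op_smul_eq_smul, smul_zero, add_zero] at this
  rw [← this, Derivation.neg_apply, Derivation.neg_apply]
  module

end TransitionDet

end OddSymplectic

namespace OddSymplectic

/-! ### Coefficients with respect to a common denominator -/

section Coefficients

variable {n : ℕ} {R : Type*} [CommRing R] [Algebra ℝ R] {ev : R →+* ℝ} {p : ℕ}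

/-- `w` refines `u` if its members are combinations of those of `u`; then `δ(u) = det H · δ(w)`. -/
def DeltaSystem.Refines (w u : DeltaSystem n ev p) : Prop :=
  ∃ H : Matrix (Fin p) (Fin p) (EvenForm n R), w.even = H.mulVec u.even

theorem DeltaSystem.Refines.refl (w : DeltaSystem n ev p) : w.Refines w :=
  ⟨1, by rw [Matrix.one_mulVec]⟩

theorem DeltaSystem.Refines.trans {u v w : DeltaSystem n ev p} (h : w.Refines v) (h' : v.Refines u) :
    w.Refines u := by
  obtain ⟨H, hH⟩ := h
  obtain ⟨H', hH'⟩ := h'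
  exact ⟨H * H', by rw [hH, hH', Matrix.mulVec_mulVec]⟩

open Classical in
/-- The determinant of a transition matrix from `u` to `w`, zero if there is none. It is well defined
modulo the members of `w` if these form a regular family. -/
noncomputable def coef (w u : DeltaSystem n ev p) : EvenForm n R :=
  if h : w.Refines u then h.choose.det else 0

theorem det_smul_sub_mem (hloc : ∀ r, ev r ≠ 0 → IsUnit r) {w u : DeltaSystem n ev p}
    (hw : w.IsPure) {H H' : Matrix (Fin p) (Fin p) (EvenForm n R)} (hH : w.even = H.mulVec u.even)
    (hH' : w.even = H'.mulVec u.even) (s : SuperForm n R) :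
    H.det • s - H'.det • s ∈ combos (SuperForm n R) w.even Finset.univ := by
  obtain ⟨y, hy⟩ := det_sub_det_mem (hw.regularFamily hloc).evenForm hH hH'
  refine ⟨fun j => y j • s, ?_⟩
  rw [← sub_smul, hy, Finset.sum_smul]
  simp only [smul_smul, smul_eq_mul]

/-- The quotient of the superforms by the members of `w`. -/
abbrev Residues (w : DeltaSystem n ev p) : Type _ :=
  SuperForm n R ⧸ combos (SuperForm n R) w.even Finset.univ

/-- The class of a superform modulo the members of `w`. -/
noncomputable abbrev residue (w : DeltaSystem n ev p) : SuperForm n R →ₗ[EvenForm n R] Residues w :=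
  (combos (SuperForm n R) w.even Finset.univ).mkQ

theorem residue_eq_zero {w : DeltaSystem n ev p} {s : SuperForm n R} :
    residue w s = 0 ↔ s ∈ combos (SuperForm n R) w.even Finset.univ :=
  Submodule.Quotient.mk_eq_zero _

theorem residue_smul_eq_zero {w : DeltaSystem n ev p} (j : Fin p) (s : SuperForm n R) :
    residue w (w.even j • s) = 0 :=
  residue_eq_zero.2 (smul_mem_combos (Finset.mem_univ j) s)

theorem residue_coef_smul (hloc : ∀ r, ev r ≠ 0 → IsUnit r) {w u : DeltaSystem n ev p}
    (hw : w.IsPure) {H : Matrix (Fin p) (Fin p) (EvenForm n R)} (hH : w.even = H.mulVec u.even)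
    (s : SuperForm n R) : residue w (coef w u • s) = residue w (H.det • s) := by
  have h : w.Refines u := ⟨H, hH⟩
  rw [← sub_eq_zero, ← map_sub, residue_eq_zero, coef, dif_pos h]
  exact det_smul_sub_mem hloc hw h.choose_spec hH s

theorem combos_mul_left {w : DeltaSystem n ev p} {s : SuperForm n R} (a : SuperForm n R)
    (hs : s ∈ combos (SuperForm n R) w.even Finset.univ) :
    a * s ∈ combos (SuperForm n R) w.even Finset.univ := by
  obtain ⟨y, rfl⟩ := hs
  exact ⟨fun j => a * y j, by simp only [Finset.mul_sum, EvenForm.mul_smul]⟩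

/-- Cramer's rule: if `w = H u` then `det H` times a member of `u` vanishes modulo `w`. -/
theorem residue_det_smul (w : DeltaSystem n ev p) {u : Fin p → EvenForm n R}
    {H : Matrix (Fin p) (Fin p) (EvenForm n R)} (hH : w.even = H.mulVec u) (k : Fin p)
    (s : SuperForm n R) : residue w (H.det • u k • s) = 0 := by
  have e1 : H.adjugate.mulVec (H.mulVec u) = H.det • u := by
    rw [Matrix.mulVec_mulVec, Matrix.adjugate_mul, Matrix.smul_mulVec, Matrix.one_mulVec]
  have e2 := congrFun e1 k
  rw [← hH, Pi.smul_apply, smul_eq_mul] at e2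
  rw [smul_smul, ← e2]
  simp only [Matrix.mulVec, dotProduct, Finset.sum_smul, map_sum]
  refine Finset.sum_eq_zero fun j _ => ?_
  rw [mul_comm, mul_smul, residue_smul_eq_zero]

/-- The numerator of a formal sum of delta forms over the common denominator `w`. -/
noncomputable def numerator (w : DeltaSystem n ev p) :
    PreForm n ev p →ₗ[SuperForm n R] SuperForm n R :=
  Finsupp.linearCombination (SuperForm n R) fun u => (coef w u : SuperForm n R)

theorem numerator_single (w u : DeltaSystem n ev p) (a : SuperForm n R) :
    numerator w (Finsupp.single u a) = coef w u • a := by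
  rw [numerator, Finsupp.linearCombination_single, smul_eq_mul, EvenForm.smul_def,
    EvenForm.coe_mul_comm]

variable (n ev p) in
/-- The formal sums whose numerator vanishes modulo the denominator, for all pure denominators that
are fine enough. -/
noncomputable def nullForms : Submodule (SuperForm n R) (PreForm n ev p) where
  carrier := {f | ∀ u : DeltaSystem n ev p, ∃ w₀ : DeltaSystem n ev p, w₀.IsPure ∧ w₀.Refines u ∧
    ∀ w : DeltaSystem n ev p, w.IsPure → w.Refines w₀ → residue w (numerator w f) = 0}
  zero_mem' := fun u => by
    obtain ⟨w, hw, hwu, -⟩ := u.exists_common_refinement u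
    exact ⟨w, hw, hwu, fun w' _ _ => by simp⟩
  add_mem' := by
    intro f g hf hg u
    obtain ⟨w₁, -, h1u, h1⟩ := hf u
    obtain ⟨w₂, hw2, h21, h2⟩ := hg w₁
    refine ⟨w₂, hw2, h21.trans h1u, fun w hw hw2 => ?_⟩
    rw [map_add, map_add, h1 w hw (hw2.trans h21), h2 w hw hw2, add_zero]
  smul_mem' := by
    intro a f hf u
    obtain ⟨w₁, hw1, h1u, h1⟩ := hf u
    refine ⟨w₁, hw1, h1u, fun w hw hw1 => ?_⟩
    have := h1 w hw hw1
    rw [residue_eq_zero] at this ⊢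
    rw [map_smul, smul_eq_mul]
    exact combos_mul_left a this

variable (n ev p) in
/-- The submodule generated by the delta relations, without their differential consequences. -/
noncomputable def relationSpan : Submodule (SuperForm n R) (PreForm n ev p) :=
  Submodule.span _ {f | DeltaRel n ev p f}

theorem single_sub_single_mem {u v : DeltaSystem n ev p}
    {H : Matrix (Fin p) (Fin p) (EvenForm n R)} (hH : v.even = H.mulVec u.even)
    (a : SuperForm n R) :
    Finsupp.single u a - Finsupp.single v (H.det • a) ∈ relationSpan n ev p := by
  have h1 := DeltaRel.change u v (fun i j => (H i j : SuperForm n R)) (fun i j => (H i j).2)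
    (fun i => by
      have := congrArg Subtype.val (congrFun hH i)
      rw [DeltaSystem.coe_even] at this
      rw [this]
      simp only [Matrix.mulVec, dotProduct, AddSubmonoidClass.coe_finsetSum, MulMemClass.coe_mul,
        DeltaSystem.coe_even])
  rw [superDet_coe] at h1
  have h2 := Submodule.smul_mem (relationSpan n ev p) a (Submodule.subset_span h1)
  rwa [smul_sub, Finsupp.smul_single, Finsupp.smul_single, smul_eq_mul, smul_eq_mul, mul_one,
    ← EvenForm.coe_mul_comm, ← EvenForm.smul_def] at h2

theorem single_combos_mem {w : DeltaSystem n ev p} {s : SuperForm n R}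
    (hs : s ∈ combos (SuperForm n R) w.even Finset.univ) :
    Finsupp.single w s ∈ relationSpan n ev p := by
  obtain ⟨y, rfl⟩ := hs
  rw [Finsupp.single_finsetSum]
  refine Submodule.sum_mem _ fun j _ => ?_
  have := Submodule.smul_mem (relationSpan n ev p) (y j) (Submodule.subset_span (DeltaRel.slot w j))
  rwa [Finsupp.smul_single, smul_eq_mul, ← DeltaSystem.coe_even, ← EvenForm.coe_mul_comm] at this

theorem single_sub_numerator_mem {w u : DeltaSystem n ev p} (h : w.Refines u) (a : SuperForm n R) :
    Finsupp.single u a - Finsupp.single w (numerator w (Finsupp.single u a)) ∈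
      relationSpan n ev p := by
  rw [numerator_single, coef, dif_pos h]
  exact single_sub_single_mem h.choose_spec a

/-- Every formal sum has a common denominator. -/
theorem exists_denominator (f : PreForm n ev p) (u : DeltaSystem n ev p) :
    ∃ w₀ : DeltaSystem n ev p, w₀.IsPure ∧ w₀.Refines u ∧ ∀ w : DeltaSystem n ev p, w.Refines w₀ →
      f - Finsupp.single w (numerator w f) ∈ relationSpan n ev p := by
  induction f using Finsupp.induction_linear generalizing u with
  | zero =>
    obtain ⟨w, hw, hwu, -⟩ := u.exists_common_refinement u
    exact ⟨w, hw, hwu, fun w' _ => by simp⟩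
  | add f g hf hg =>
    obtain ⟨w₁, -, h1u, h1⟩ := hf u
    obtain ⟨w₂, hw2, h21, h2⟩ := hg w₁
    refine ⟨w₂, hw2, h21.trans h1u, fun w hw2 => ?_⟩
    have := Submodule.add_mem _ (h1 w (hw2.trans h21)) (h2 w hw2)
    rwa [sub_add_sub_comm, ← Finsupp.single_add, ← map_add] at this
  | single v a =>
    obtain ⟨w, hw, hwu, hwv⟩ := u.exists_common_refinement v
    exact ⟨w, hw, hwu, fun w' hw' => single_sub_numerator_mem (hw'.trans hwv) a⟩

/-- A formal sum equals its numerator over a common denominator `w`, and multiples of members of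
`w` are relations. -/
theorem nullForms_le (f : PreForm n ev p) (hf : f ∈ nullForms n ev p) :
    f ∈ relationSpan n ev p := by
  rcases isEmpty_or_nonempty (DeltaSystem n ev p) with h | ⟨⟨u⟩⟩
  · rw [Subsingleton.elim f 0]
    exact Submodule.zero_mem _
  · obtain ⟨w₁, -, -, h1⟩ := exists_denominator f u
    obtain ⟨w₂, hw2, h21, h2⟩ := hf w₁
    have := Submodule.add_mem _ (h1 w₂ h21)
      (single_combos_mem (residue_eq_zero.1 (h2 w₂ hw2 (.refl _))))
    rwa [sub_add_cancel] at this

/-- The defining relations have vanishing numerators: the first by Cramer's rule, the second because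
determinants are multiplicative and transition determinants are well defined. -/
theorem relationSpan_le (hloc : ∀ r, ev r ≠ 0 → IsUnit r) :
    relationSpan n ev p ≤ nullForms n ev p := by
  refine Submodule.span_le.2 ?_
  rintro _ (⟨u, k⟩ | ⟨u, v, H, hH, hv⟩) u₀
  · obtain ⟨w₀, hw0, h0, hu⟩ := u₀.exists_common_refinement u
    refine ⟨w₀, hw0, h0, fun w hw hww => ?_⟩
    obtain ⟨H, hH⟩ : w.Refines u := hww.trans hu
    rw [numerator_single, residue_coef_smul hloc hw hH]
    have := residue_det_smul w hH k 1
    rwa [EvenForm.smul_def (u.even k), mul_one] at this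
  · obtain ⟨w₀, hw0, h0, hu⟩ := u₀.exists_common_refinement v
    refine ⟨w₀, hw0, h0, fun w hw hww => ?_⟩
    obtain ⟨K, hK⟩ : w.Refines v := hww.trans hu
    let H' : Matrix (Fin p) (Fin p) (EvenForm n R) := fun i j => ⟨H i j, hH i j⟩
    have hH' : v.even = H'.mulVec u.even := by
      funext i
      refine Subtype.ext ?_
      rw [DeltaSystem.coe_even, hv i]
      simp only [Matrix.mulVec, dotProduct, AddSubmonoidClass.coe_finsetSum, MulMemClass.coe_mul,
        DeltaSystem.coe_even, H']
    have hdet : superDet H = (H'.det : SuperForm n R) := superDet_coe H'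
    have hKH : w.even = (K * H').mulVec u.even := by rw [← Matrix.mulVec_mulVec, ← hH', hK]
    rw [map_sub, map_sub, numerator_single, numerator_single, residue_coef_smul hloc hw hK,
      residue_coef_smul hloc hw hKH, hdet, Matrix.det_mul, EvenForm.smul_def, EvenForm.smul_def,
      mul_one, Subalgebra.coe_mul, sub_self]

end Coefficients

end OddSymplectic

namespace OddSymplectic

/-! ### The delta relations are stable under the differential -/

section Stability

variable {n : ℕ} {R : Type*} [CommRing R] [Algebra ℝ R] {ev : R →+* ℝ} {p : ℕ}

/-- An odd superform anticommutes with odd and commutes with even superforms. -/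
theorem odd_form_mul {b : SuperForm n R} (hb : parity b = - b) (a : SuperForm n R) :
    b * a = parity a * b := by
  have hf : ∀ (r : R) (f : Fibre n) (c : SuperForm n R),
      c * (pureForm n R (r ⊗ₜ f)) = pureForm n R (r ⊗ₜ f) * c := fun r f c =>
    (even_mul_comm (parity_pureForm _) c).symm
  have key : ∀ g : Grass n, b * ((1 : R) ⊗ₜ[ℝ] g) = parity ((1 : R) ⊗ₜ[ℝ] g) * b := by
    intro g
    induction g using ExteriorAlgebra.induction with
    | algebraMap f =>
      have := hf 1 f b
      rw [pureForm_tmul] at this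
      rw [this, ← pureForm_tmul, parity_pureForm]
    | ι v =>
      have := odd_mul v b
      rw [hb, neg_mul] at this
      have h2 := parity_odd (R := R) v
      simp only [odd] at this h2
      rw [h2, neg_mul, this, neg_neg]
    | mul x y hx hy =>
      have : ((1 : R) ⊗ₜ[ℝ] (x * y) : SuperForm n R) = (1 ⊗ₜ[ℝ] x) * (1 ⊗ₜ[ℝ] y) := by simp
      rw [this, ← mul_assoc, hx, mul_assoc, hy, map_mul, mul_assoc]
    | add x y hx hy => rw [TensorProduct.tmul_add, mul_add, hx, hy, map_add, add_mul]
  induction a using TensorProduct.induction_on with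
  | zero => simp
  | tmul r g =>
    have h1 : (r ⊗ₜ[ℝ] g : SuperForm n R) = pureForm n R (r ⊗ₜ 1) * (1 ⊗ₜ[ℝ] g) := by
      simp [pureForm_tmul]
    rw [h1, ← mul_assoc, hf, mul_assoc, key, map_mul, parity_pureForm, mul_assoc]
  | add x y hx hy => rw [mul_add, hx, hy, map_add, add_mul]

variable {D : Fin n → R →ₗ[ℝ] R}

/-- The differential as a derivation of the even superforms with values in the superforms. -/
noncomputable def evenDeRham (hD : ∀ i f g, D i (f * g) = D i f * g + f * D i g) :
    Derivation ℝ (EvenForm n R) (SuperForm n R) :=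
  Derivation.mk' ((deRham D).comp (evenSubalgebra n R).val.toLinearMap) fun a b => by
    change deRham D ((a : SuperForm n R) * b) = a • deRham D (b : SuperForm n R) + b • deRham D (a : SuperForm n R)
    rw [deRham_mul hD, EvenForm.parity_coe, EvenForm.smul_def, EvenForm.smul_def, add_comm,
      EvenForm.coe_mul_comm b]

theorem evenDeRham_apply (hD : ∀ i f g, D i (f * g) = D i f * g + f * D i g) (a : EvenForm n R) :
    evenDeRham hD a = deRham D (a : SuperForm n R) := rfl

theorem parity_deRham_even (u : DeltaSystem n ev p) (k : Fin p) :
    parity (deRham D (u.1 k)) = - deRham D (u.1 k) := by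
  have := deRham_parity D (u.1 k)
  rw [u.2.1 k] at this
  exact neg_eq_iff_eq_neg.1 this.symm

theorem preDeRham_smul (hD : ∀ i f g, D i (f * g) = D i f * g + f * D i g) (a : SuperForm n R)
    (f : PreForm n ev p) :
    preDeRham D (a • f) = deRham D a • f + parity a • preDeRham D f := by
  induction f using Finsupp.induction_linear with
  | zero => simp
  | add f g hf hg => simp only [smul_add, map_add, hf, hg]; abel
  | single u b =>
    rw [Finsupp.smul_single, smul_eq_mul, preDeRham_single, preDeRham_single, deRham_mul hD,
      smul_sub, Finset.smul_sum, Finsupp.single_add]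
    simp only [Finsupp.smul_single, smul_eq_mul, ← mul_assoc]
    rw [add_sub_assoc]
    congr 2
    refine Finset.sum_congr rfl fun k _ => ?_
    rw [odd_form_mul (parity_deRham_even u k)]

theorem isDeltaSystem_sq (u : DeltaSystem n ev p) :
    IsDeltaSystem ev fun j => u.1 j * u.1 j := by
  obtain ⟨he, L, hL, hs⟩ := u.2
  refine ⟨fun j => by rw [map_mul, he], fun j => L j + L j, fun j => ⟨?_, ?_⟩, fun s h => hs s fun j => ?_⟩
  · simp [(hL j).1]
  · rw [map_mul, (hL j).2, Multiset.map_add, Multiset.prod_add]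
  · simpa using h j

/-- The system of the squares of the members of `u`. -/
noncomputable def DeltaSystem.sq (u : DeltaSystem n ev p) : DeltaSystem n ev p := ⟨_, isDeltaSystem_sq u⟩

theorem DeltaSystem.sq_even (u : DeltaSystem n ev p) : u.sq.even = fun j => u.even j * u.even j := rfl

theorem DeltaSystem.sqSlot_even (u : DeltaSystem n ev p) (k : Fin p) :
    (u.sqSlot k).even = Function.update u.even k (u.even k * u.even k) := by
  funext j
  refine Subtype.ext ?_
  change Function.update u.1 k (u.1 k * u.1 k) j = _
  rcases eq_or_ne j k with rfl | h
  · rw [Function.update_self, Function.update_self]; rfl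
  · rw [Function.update_of_ne h, Function.update_of_ne h]; rfl

theorem refines_of_sq {u w : DeltaSystem n ev p} {K : Matrix (Fin p) (Fin p) (EvenForm n R)}
    (hK : w.even = K.mulVec u.sq.even) : w.even = (K * Matrix.diagonal u.even).mulVec u.even := by
  rw [← Matrix.mulVec_mulVec, hK]
  congr 1
  funext j
  rw [Matrix.mulVec_diagonal, DeltaSystem.sq_even]

theorem refines_sqSlot_of_sq {u w : DeltaSystem n ev p} {K : Matrix (Fin p) (Fin p) (EvenForm n R)}
    (hK : w.even = K.mulVec u.sq.even) (k : Fin p) :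
    w.even = (K * Matrix.diagonal (Function.update u.even k 1)).mulVec (u.sqSlot k).even := by
  rw [← Matrix.mulVec_mulVec, hK]
  congr 1
  funext j
  rw [Matrix.mulVec_diagonal, DeltaSystem.sq_even, DeltaSystem.sqSlot_even]
  rcases eq_or_ne j k with rfl | h
  · simp
  · simp [h]

theorem derivation_prod {B N : Type*} [CommRing B] [Algebra ℝ B] [AddCommGroup N] [Module B N]
    [Module ℝ N] (δ : Derivation ℝ B N) (u : Fin p → B) :
    δ (∏ j, u j) = ∑ k, (∏ j, Function.update u k 1 j) • δ (u k) := by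
  have key : ∀ T : Finset (Fin p), δ (∏ j ∈ T, u j) =
      ∑ k ∈ T, (∏ j ∈ T, Function.update u k 1 j) • δ (u k) := by
    intro T
    induction T using Finset.induction_on with
    | empty => simp
    | insert a T ha ih =>
      have h1 : ∏ j ∈ T, Function.update u a 1 j = ∏ j ∈ T, u j :=
        Finset.prod_congr rfl fun j hj => by
          rw [Function.update_of_ne (show j ≠ a from fun e => ha (e ▸ hj))]
      rw [Finset.prod_insert ha, Derivation.leibniz, ih, Finset.sum_insert ha, Finset.prod_insert ha,
        Function.update_self, one_mul, h1, Finset.smul_sum, add_comm]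
      congr 1
      refine Finset.sum_congr rfl fun k hk => ?_
      rw [Finset.prod_insert ha, Function.update_of_ne (show a ≠ k from fun e => ha (e ▸ hk)), smul_smul]
  exact key _

/-- Over a denominator `w = K u²`, the numerator of `d (a δ(u))`. -/
theorem residue_numerator_preDeRham (hloc : ∀ r, ev r ≠ 0 → IsUnit r) {u w : DeltaSystem n ev p}
    (hw : w.IsPure) {K : Matrix (Fin p) (Fin p) (EvenForm n R)} (hK : w.even = K.mulVec u.sq.even)
    (a : SuperForm n R) :
    residue w (numerator w (preDeRham D (Finsupp.single u a))) =
      residue w (K.det • (∏ j, u.even j) • deRham D a) -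
        ∑ k, residue w (K.det • (∏ j, Function.update u.even k 1 j) • (deRham D (u.1 k) * a)) := by
  rw [preDeRham_single, map_sub, map_sub, map_sum, map_sum, numerator_single,
    residue_coef_smul hloc hw (refines_of_sq hK), Matrix.det_mul, Matrix.det_diagonal, mul_smul]
  congr 1
  refine Finset.sum_congr rfl fun k _ => ?_
  rw [numerator_single, residue_coef_smul hloc hw (refines_sqSlot_of_sq hK k), Matrix.det_mul,
    Matrix.det_diagonal, mul_smul]

/-- The span of the delta relations is stable under the differential. The numerators are computed over
denominators that refine the squares of the members of all systems involved. -/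
theorem preDeRham_mem_relationSpan (hloc : ∀ r, ev r ≠ 0 → IsUnit r)
    (hD : ∀ i f g, D i (f * g) = D i f * g + f * D i g) {f : PreForm n ev p}
    (hf : f ∈ relationSpan n ev p) : preDeRham D f ∈ relationSpan n ev p := by
  induction hf using Submodule.span_induction with
  | zero => simp
  | add f g _ _ hf hg => rw [map_add]; exact Submodule.add_mem _ hf hg
  | smul a f hf' hf =>
    rw [preDeRham_smul hD]
    exact Submodule.add_mem _ (Submodule.smul_mem _ _ hf') (Submodule.smul_mem _ _ hf)
  | mem f hf =>
    refine nullForms_le _ fun u₀ => ?_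
    obtain ⟨u, k⟩ | ⟨u, v, H, hH, hv⟩ := hf
    · obtain ⟨w₀, hw0, h0, hu⟩ := u₀.exists_common_refinement u.sq
      refine ⟨w₀, hw0, h0, fun w hw hww => ?_⟩
      obtain ⟨K, hK⟩ : w.Refines u.sq := hww.trans hu
      rw [residue_numerator_preDeRham hloc hw hK,
        Finset.sum_eq_single_of_mem k (Finset.mem_univ k), ← map_sub]
      · have h1 : (∏ j, u.even j) = (∏ j, Function.update u.even k 1 j) * u.even k := by
          rw [Finset.prod_update_of_mem (Finset.mem_univ k), one_mul, mul_comm, Finset.sdiff_singleton_eq_erase,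
            Finset.mul_prod_erase _ _ (Finset.mem_univ k)]
        have h2 : deRham D (u.1 k) * u.1 k = u.even k • deRham D (u.1 k) := by
          rw [EvenForm.smul_def, EvenForm.coe_mul_comm]; rfl
        rw [h1, h2, mul_smul, sub_self, map_zero]
      · intro i _ hik
        -- the product over the other slots contains `u_k`, so that `u_k ^ 2` can be split off
        have h1 : (∏ j, Function.update u.even i 1 j) =
            (∏ j ∈ Finset.univ.erase k, Function.update u.even i 1 j) * u.even k := by
          rw [← Finset.mul_prod_erase _ _ (Finset.mem_univ k), Function.update_of_ne hik.symm, mul_comm]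
        have h2 : deRham D (u.1 i) * u.1 k = u.even k • deRham D (u.1 i) := by
          rw [EvenForm.smul_def, EvenForm.coe_mul_comm]; rfl
        have h3 := residue_det_smul w hK k
          ((∏ j ∈ Finset.univ.erase k, Function.update u.even i 1 j) • deRham D (u.1 i))
        rw [h1, h2, ← h3, DeltaSystem.sq_even]
        congr 2
        simp only [smul_smul]
        congr 1
        ring
    · obtain ⟨w₁, -, h1, hu⟩ := u₀.exists_common_refinement u.sq
      obtain ⟨w₀, hw0, h01, hv0⟩ := w₁.exists_common_refinement v.sq
      replace h01 : w₀.Refines w₁ := h01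
      refine ⟨w₀, hw0, h01.trans h1, fun w hw hww => ?_⟩
      obtain ⟨K', hK'⟩ : w.Refines u.sq := hww.trans (h01.trans hu)
      obtain ⟨K, hK⟩ : w.Refines v.sq := hww.trans hv0
      let H' : Matrix (Fin p) (Fin p) (EvenForm n R) := fun i j => ⟨H i j, hH i j⟩
      have hH' : v.even = H'.mulVec u.even := by
        funext i
        refine Subtype.ext ?_
        rw [DeltaSystem.coe_even, hv i]
        simp only [Matrix.mulVec, dotProduct, AddSubmonoidClass.coe_finsetSum, MulMemClass.coe_mul,
          DeltaSystem.coe_even, H']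
      have hdet : superDet H = (H'.det : SuperForm n R) := superDet_coe H'
      have hreg := hw.regularFamily hloc
      have key := derivation_det_mem (evenDeRham hD) hreg.evenForm hreg hH' hK hK'
      rw [← residue_eq_zero, derivation_prod, derivation_prod] at key
      have hd1 : deRham D (1 : SuperForm n R) = 0 := (evenDeRham hD).map_one_eq_zero
      rw [map_sub, map_sub, map_sub, residue_numerator_preDeRham hloc hw hK,
        residue_numerator_preDeRham hloc hw hK', hdet, ← evenDeRham_apply hD, hd1, ← neg_eq_zero,
        ← key]
      have hmul : ∀ k, deRham D (v.1 k) * (H'.det : SuperForm n R) = H'.det • deRham D (v.1 k) :=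
        fun k => by rw [EvenForm.smul_def, EvenForm.coe_mul_comm]
      simp only [mul_one, smul_zero, map_zero, zero_sub, neg_sub, hmul, ← map_sum,
        ← map_sub, evenDeRham_apply, DeltaSystem.coe_even, smul_sub, Finset.smul_sum]
      rw [sub_neg_eq_add, add_comm, ← map_add (residue w)]
      simp only [smul_comm H'.det]

/-- The differential consequences of the delta relations are already contained in their span. -/
theorem relations_eq (hloc : ∀ r, ev r ≠ 0 → IsUnit r)
    (hD : ∀ i f g, D i (f * g) = D i f * g + f * D i g) :
    relations n ev p D = relationSpan n ev p := by
  refine le_antisymm (sInf_le ⟨fun f hf => Submodule.subset_span hf,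
    fun f hf => preDeRham_mem_relationSpan hloc hD hf⟩) (Submodule.span_le.2 fun f hf => ?_)
  simp only [relations, SetLike.mem_coe, Submodule.mem_sInf]
  exact fun N hN => hN.1 f hf

end Stability

end OddSymplectic

namespace OddSymplectic

/-! ### The Koszul complex of a differential and a regular family -/

/-- The module `T[e_1, …, e_p]` of polynomials in `p` anticommuting variables, recursively in `p`:
the pair `(a, b)` stands for `a + e_1 b`. -/
def Kos (T : Type*) : ℕ → Type _
  | 0 => T
  | p + 1 => Kos T p × Kos T p

namespace Kos

section Pairs

variable {T : Type*} {p : ℕ}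

/-- The element `a + e_1 b`. -/
def mk (a b : Kos T p) : Kos T (p + 1) := (a, b)

theorem exists_eq_mk (z : Kos T (p + 1)) : ∃ a b, z = mk a b := ⟨z.1, z.2, rfl⟩

theorem mk_inj {a b c d : Kos T p} : mk a b = mk c d ↔ a = c ∧ b = d := Prod.mk_inj

end Pairs

variable {B T : Type*} [CommRing B] [AddCommGroup T] [Module B T] {p : ℕ}

instance instAddCommGroup : ∀ p, AddCommGroup (Kos T p)
  | 0 => inferInstanceAs (AddCommGroup T)
  | p + 1 =>
    letI := instAddCommGroup p
    inferInstanceAs (AddCommGroup (Kos T p × Kos T p))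

instance instModule : ∀ p, Module B (Kos T p)
  | 0 => inferInstanceAs (Module B T)
  | p + 1 =>
    letI := instModule p
    inferInstanceAs (Module B (Kos T p × Kos T p))

theorem mk_eq_zero {a b : Kos T p} : mk a b = 0 ↔ a = 0 ∧ b = 0 := Prod.mk_inj

theorem mk_zero_zero : mk (0 : Kos T p) 0 = 0 := rfl

theorem mk_add (a b c d : Kos T p) : mk a b + mk c d = mk (a + c) (b + d) := rfl

theorem mk_sub (a b c d : Kos T p) : mk a b - mk c d = mk (a - c) (b - d) := rfl

theorem neg_mk (a b : Kos T p) : - mk a b = mk (-a) (-b) := rfl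

theorem smul_mk (c : B) (a b : Kos T p) : c • mk a b = mk (c • a) (c • b) := rfl

variable (B T) in
/-- The coefficient of `1`. -/
def const : ∀ p, Kos T p →ₗ[B] T
  | 0 => LinearMap.id
  | p + 1 => const p ∘ₗ LinearMap.fst B (Kos T p) (Kos T p)

variable (B T) in
/-- The coefficient of `e_1 ⋯ e_p`. -/
def top : ∀ p, Kos T p →ₗ[B] T
  | 0 => LinearMap.id
  | p + 1 => top p ∘ₗ LinearMap.snd B (Kos T p) (Kos T p)

/-- The monomial `e_1 ⋯ e_p γ`. -/
def lift (γ : T) : ∀ p, Kos T p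
  | 0 => γ
  | p + 1 => mk 0 (lift γ p)

/-- The constant polynomial `γ`. -/
def ofConst : ∀ p, T →ₗ[B] Kos T p
  | 0 => LinearMap.id
  | p + 1 => LinearMap.inl B (Kos T p) (Kos T p) ∘ₗ ofConst p

/-- The operator `q + ∑ w_j e_j`, where `q` anticommutes with the variables. -/
def Q (q : T →ₗ[B] T) : ∀ {p : ℕ}, (Fin p → B) → (Kos T p →ₗ[B] Kos T p)
  | 0, _ => q
  | _ + 1, w => LinearMap.prod (Q q (Fin.tail w) ∘ₗ LinearMap.fst B _ _)
      (w 0 • LinearMap.fst B _ _ - Q q (Fin.tail w) ∘ₗ LinearMap.snd B _ _)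

/-- The contraction `∑ h_j ∂/∂e_j`. -/
def D : ∀ {p : ℕ}, (Fin p → B) → (Kos T p →ₗ[B] Kos T p)
  | 0, _ => 0
  | _ + 1, h => LinearMap.prod (D (Fin.tail h) ∘ₗ LinearMap.fst B _ _ + h 0 • LinearMap.snd B _ _)
      (- D (Fin.tail h) ∘ₗ LinearMap.snd B _ _)

/-- The extension of an additive operator on `T` that anticommutes with the variables. -/
def ext (τ : T →+ T) : ∀ p, Kos T p →+ Kos T p
  | 0 => τ
  | p + 1 => AddMonoidHom.prod ((ext τ p).comp (AddMonoidHom.fst _ _))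
      (- (ext τ p).comp (AddMonoidHom.snd _ _))

@[simp] theorem const_mk (a b : Kos T p) : const B T (p + 1) (mk a b) = const B T p a := rfl
@[simp] theorem top_mk (a b : Kos T p) : top B T (p + 1) (mk a b) = top B T p b := rfl
theorem Q_mk (q : T →ₗ[B] T) (w : Fin (p + 1) → B) (a b : Kos T p) :
    Q q w (mk a b) = mk (Q q (Fin.tail w) a) (w 0 • a - Q q (Fin.tail w) b) := rfl
theorem D_mk (h : Fin (p + 1) → B) (a b : Kos T p) :
    D h (mk a b) = mk (D (Fin.tail h) a + h 0 • b) (- D (Fin.tail h) b) := rfl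
theorem ext_mk (τ : T →+ T) (a b : Kos T p) :
    ext τ (p + 1) (mk a b) = mk (ext τ p a) (- ext τ p b) := rfl

@[simp] theorem const_ofConst (p : ℕ) (t : T) : const B T p (ofConst (B := B) p t) = t := by
  induction p with
  | zero => rfl
  | succ p ih => exact ih

@[simp] theorem top_lift (p : ℕ) (t : T) : top B T p (lift t p) = t := by
  induction p with
  | zero => rfl
  | succ p ih => exact ih

theorem Q_Q {q : T →ₗ[B] T} (hq : ∀ x, q (q x) = 0) (w : Fin p → B) (z : Kos T p) :
    Q q w (Q q w z) = 0 := by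
  induction p with
  | zero => exact hq z
  | succ p ih =>
    obtain ⟨a, b, rfl⟩ := exists_eq_mk z
    simp only [Q_mk, ih, map_sub, map_smul, sub_zero, sub_self, mk_zero_zero]

theorem Q_anticomm {q q' : T →ₗ[B] T} (hq : ∀ x, q (q' x) = - q' (q x)) (w w' : Fin p → B)
    (z : Kos T p) : Q q w (Q q' w' z) = - Q q' w' (Q q w z) := by
  induction p with
  | zero => exact hq z
  | succ p ih =>
    obtain ⟨a, b, rfl⟩ := exists_eq_mk z
    simp only [Q_mk, ih, map_sub, map_smul, neg_mk, mk_inj, true_and]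
    abel

theorem Q_add (q q' : T →ₗ[B] T) (w w' : Fin p → B) (z : Kos T p) :
    Q (q + q') (w + w') z = Q q w z + Q q' w' z := by
  induction p with
  | zero => rfl
  | succ p ih =>
    obtain ⟨a, b, rfl⟩ := exists_eq_mk z
    have h : Fin.tail (w + w') = Fin.tail w + Fin.tail w' := rfl
    simp only [Q_mk, h, ih, mk_add, mk_inj, true_and, Pi.add_apply, add_smul]
    abel

theorem Q_smul (c : B) (q : T →ₗ[B] T) (w : Fin p → B) (z : Kos T p) :
    Q (c • q) (c • w) z = c • Q q w z := by
  induction p with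
  | zero => rfl
  | succ p ih =>
    obtain ⟨a, b, rfl⟩ := exists_eq_mk z
    have h : Fin.tail (c • w) = c • Fin.tail w := rfl
    simp only [Q_mk, h, ih, smul_mk, Pi.smul_apply, smul_sub, smul_smul,
      smul_eq_mul]

theorem Q_zero_zero (z : Kos T p) : Q (0 : T →ₗ[B] T) 0 z = 0 := by
  have := Q_smul (0 : B) (0 : T →ₗ[B] T) (0 : Fin p → B) z
  rwa [zero_smul, zero_smul, zero_smul] at this

theorem Q_sum {ι : Type*} (s : Finset ι) (c : ι → B) (h : ι → Fin p → B) (z : Kos T p) :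
    Q (0 : T →ₗ[B] T) (∑ l ∈ s, c l • h l) z = ∑ l ∈ s, c l • Q (0 : T →ₗ[B] T) (h l) z := by
  classical
  induction s using Finset.induction_on with
  | empty => simp only [Finset.sum_empty, Q_zero_zero]
  | insert i s hi ih =>
    rw [Finset.sum_insert hi, Finset.sum_insert hi, ← ih, ← Q_smul, ← Q_add, smul_zero, add_zero]

theorem const_Q (q : T →ₗ[B] T) (w : Fin p → B) (z : Kos T p) :
    const B T p (Q q w z) = q (const B T p z) := by
  induction p with
  | zero => rfl
  | succ p ih =>
    obtain ⟨a, b, rfl⟩ := exists_eq_mk z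
    exact ih _ a

theorem ofConst_Q (q : T →ₗ[B] T) (t : T) :
    Q q (0 : Fin p → B) (ofConst (B := B) p t) = ofConst (B := B) p (q t) := by
  induction p with
  | zero => rfl
  | succ p ih =>
    have h : ∀ t : T, ofConst (B := B) (p + 1) t = mk (ofConst (B := B) p t) 0 := fun _ => rfl
    have h' : Fin.tail (0 : Fin (p + 1) → B) = 0 := rfl
    rw [h, h, Q_mk, h', ih, map_zero, Pi.zero_apply, zero_smul, sub_zero]

theorem mem_combos_succ {w : Fin (p + 1) → B} {x : T} :
    x ∈ combos T w Finset.univ ↔ ∃ y, x - w 0 • y ∈ combos T (Fin.tail w) Finset.univ := by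
  constructor
  · rintro ⟨y, rfl⟩
    exact ⟨y 0, Fin.tail y, by rw [Fin.sum_univ_succ, add_sub_cancel_left]; rfl⟩
  · rintro ⟨z, y, h⟩
    refine ⟨Fin.cons z y, ?_⟩
    rw [Fin.sum_univ_succ, sub_eq_iff_eq_add.1 h, add_comm]
    simp [Fin.tail]

theorem map_mem_combos (q : T →ₗ[B] T) {w : Fin p → B} {x : T}
    (hx : x ∈ combos T w Finset.univ) : q x ∈ combos T w Finset.univ := by
  obtain ⟨y, rfl⟩ := hx
  exact ⟨fun j => q (y j), by simp only [map_sum, map_smul]⟩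

theorem mem_combos_tail_of_smul {w : Fin (p + 1) → B} (hw : RegularFamily T w) {x : T}
    (hx : w 0 • x ∈ combos T (Fin.tail w) Finset.univ) :
    x ∈ combos T (Fin.tail w) Finset.univ := by
  have h : combos T (Fin.tail w) Finset.univ =
      combos T w (Finset.univ.map (Fin.succEmb p)) := by
    ext y
    simp only [mem_combos, Finset.sum_map]
    constructor
    · rintro ⟨z, rfl⟩
      exact ⟨Fin.cons 0 z, by simp [Fin.tail]⟩
    · rintro ⟨z, rfl⟩
      exact ⟨Fin.tail z, rfl⟩
  rw [h] at hx ⊢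
  exact hw _ 0 (by simp) x hx

theorem regularFamily_tail {w : Fin (p + 1) → B} (hw : RegularFamily T w) :
    RegularFamily T (Fin.tail w) := hw.comp Fin.succ (Fin.succ_injective p)

/-- Taking the top coefficient commutes with the differential up to sign, modulo the `w_j`. -/
theorem top_Q (q : T →ₗ[B] T) (w : Fin p → B) (z : Kos T p) :
    top B T p (Q q w z) - (-1 : B) ^ p • q (top B T p z) ∈ combos T w Finset.univ := by
  induction p with
  | zero =>
    rw [pow_zero, one_smul]
    exact (sub_self (q z)).symm ▸ Submodule.zero_mem _
  | succ p ih =>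
    obtain ⟨a, b, rfl⟩ := exists_eq_mk z
    rw [Q_mk, top_mk, top_mk, mem_combos_succ]
    refine ⟨top B T p a, ?_⟩
    have := Submodule.neg_mem _ (ih (Fin.tail w) b)
    convert this using 1
    rw [map_sub, map_smul, pow_succ, mul_neg_one, neg_smul]
    abel

section Exactness

variable {q : T →ₗ[B] T}

/-- The complex is exact at the cocycles whose top coefficient is a combination of the `w_j`. -/
theorem exists_eq_Q (hq : ∀ x, q (q x) = 0) {w : Fin p → B} (hw : RegularFamily T w) (r : Kos T p)
    (hr : Q q w r = 0) (ht : top B T p r ∈ combos T w Finset.univ) :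
    ∃ s, r = Q q w s ∧ top B T p s = 0 := by
  induction p with
  | zero =>
    obtain ⟨y, hy⟩ := ht
    rw [Finset.univ_eq_empty, Finset.sum_empty] at hy
    exact ⟨0, by rw [map_zero]; exact hy, map_zero _⟩
  | succ p ih =>
    have hw' := regularFamily_tail hw
    obtain ⟨a, b, rfl⟩ := exists_eq_mk r
    rw [Q_mk, mk_eq_zero, sub_eq_zero] at hr
    obtain ⟨ha, hb⟩ := hr
    obtain ⟨γ, hγ⟩ := mem_combos_succ.1 ht
    rw [top_mk] at hγ
    have h1 : top B T p a - (-1 : B) ^ p • q γ ∈ combos T (Fin.tail w) Finset.univ := by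
      refine mem_combos_tail_of_smul hw ?_
      have e1 := top_Q q (Fin.tail w) b
      rw [← hb, map_smul] at e1
      have e2 := Submodule.smul_mem _ ((-1 : B) ^ p) (map_mem_combos q hγ)
      have := Submodule.add_mem _ e1 e2
      convert this using 1
      rw [map_sub, map_smul, smul_sub, smul_sub, smul_comm (w 0)]
      abel
    obtain ⟨a', ha', ta'⟩ := ih hw' (a - Q q (Fin.tail w) (lift γ p))
      (by rw [map_sub, ha, Q_Q hq, sub_zero]) (by
        have e := top_Q q (Fin.tail w) (lift γ p)
        rw [top_lift] at e
        have := Submodule.sub_mem _ h1 e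
        rwa [sub_sub_sub_cancel_right, ← map_sub] at this)
    obtain ⟨b', hb', tb'⟩ := ih hw' (b - w 0 • lift γ p - w 0 • a')
      (by rw [map_sub, map_sub, map_smul, map_smul, ← ha', ← hb, smul_sub]; abel)
      (by rw [map_sub, map_sub, map_smul, map_smul, ta', top_lift, smul_zero, sub_zero]; exact hγ)
    refine ⟨mk (lift γ p + a') (-b'), ?_, by rw [top_mk, map_neg, tb', neg_zero]⟩
    rw [Q_mk, mk_inj, map_add, map_neg, ← ha', ← hb', smul_add]
    constructor <;> abel

/-- An element whose differential is a combination of the `w_j` is the top coefficient of a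
cocycle. -/
theorem exists_Q_eq_zero (hq : ∀ x, q (q x) = 0) {w : Fin p → B} (hw : RegularFamily T w) (β : T)
    (hβ : q β ∈ combos T w Finset.univ) : ∃ z, Q q w z = 0 ∧ top B T p z = β := by
  induction p generalizing β with
  | zero =>
    obtain ⟨y, hy⟩ := hβ
    rw [Finset.univ_eq_empty, Finset.sum_empty] at hy
    exact ⟨β, hy, rfl⟩
  | succ p ih =>
    have hw' := regularFamily_tail hw
    obtain ⟨γ, hγ⟩ := mem_combos_succ.1 hβ
    obtain ⟨a, ha, ta⟩ := ih hw' ((-1 : B) ^ p • γ) (by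
      rw [map_smul]
      refine Submodule.smul_mem _ _ (mem_combos_tail_of_smul hw ?_)
      have := Submodule.neg_mem _ (map_mem_combos q hγ)
      rwa [map_sub, hq, zero_sub, neg_neg, map_smul] at this)
    obtain ⟨s, hs, ts⟩ := exists_eq_Q hq hw' (Q q (Fin.tail w) (lift β p) - w 0 • a)
      (by rw [map_sub, Q_Q hq, map_smul, ha, smul_zero, sub_zero]) (by
        have e1 := top_Q q (Fin.tail w) (lift β p)
        rw [top_lift] at e1
        have := Submodule.add_mem _ e1 (Submodule.smul_mem _ ((-1 : B) ^ p) hγ)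
        convert this using 1
        rw [map_sub, map_smul, ta, smul_sub, smul_comm (w 0)]
        abel)
    refine ⟨mk a (lift β p - s), ?_, by rw [top_mk, map_sub, ts, top_lift, sub_zero]⟩
    rw [Q_mk, mk_eq_zero, ha, map_sub, ← hs]
    exact ⟨rfl, by abel⟩

/-- A cocycle whose top coefficient is exact modulo the `w_j` has exact constant term. -/
theorem const_mem_range (hq : ∀ x, q (q x) = 0) {w : Fin p → B} (hw : RegularFamily T w)
    {z : Kos T p} (hz : Q q w z = 0) {γ : T} (ht : top B T p z - q γ ∈ combos T w Finset.univ) :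
    ∃ η, const B T p z = q η := by
  have hs : (-1 : B) ^ p * (-1 : B) ^ p = 1 := by rw [← mul_pow, neg_one_mul, neg_neg, one_pow]
  obtain ⟨s, hs, -⟩ := exists_eq_Q hq hw (z - Q q w (lift ((-1 : B) ^ p • γ) p))
    (by rw [map_sub, hz, Q_Q hq, sub_zero]) (by
      have e := top_Q q w (lift ((-1 : B) ^ p • γ) p)
      rw [top_lift, map_smul, smul_smul, hs, one_smul] at e
      have := Submodule.sub_mem _ ht e
      rwa [sub_sub_sub_cancel_right, ← map_sub] at this)
  refine ⟨const B T p (s + lift ((-1 : B) ^ p • γ) p), ?_⟩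
  rw [← const_Q, map_add, ← hs, sub_add_cancel]

end Exactness

section Homotopy

theorem ext_smul {τ : T →+ T} {c : B} (h : ∀ x, τ (c • x) = c • τ x) (z : Kos T p) :
    ext τ p (c • z) = c • ext τ p z := by
  induction p with
  | zero => exact h z
  | succ p ih =>
    obtain ⟨a, b, rfl⟩ := exists_eq_mk z
    rw [smul_mk, ext_mk, ih, ih, ext_mk, smul_mk, smul_neg]

/-- A null-homotopy of multiplication by `c` on `T` extends to the complex. -/
theorem ext_Q {q : T →ₗ[B] T} {τ : T →+ T} {c : B} (h : ∀ x, τ (q x) + q (τ x) = c • x)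
    {w : Fin p → B} (hw : ∀ j x, τ (w j • x) = w j • τ x) (z : Kos T p) :
    ext τ p (Q q w z) + Q q w (ext τ p z) = c • z := by
  induction p with
  | zero => exact h z
  | succ p ih =>
    obtain ⟨a, b, rfl⟩ := exists_eq_mk z
    have ih' := ih (w := Fin.tail w) (fun j x => hw j.succ x)
    rw [Q_mk, ext_mk, ext_mk, Q_mk, mk_add, ih', map_sub, ext_smul (hw 0), smul_mk, ← ih' b,
      map_neg]
    congr 1
    abel

/-- Multiplication of each variable `e_j` by `w_j`. -/
def scale : ∀ {p : ℕ}, (Fin p → B) → (Kos T p →ₗ[B] Kos T p)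
  | 0, _ => LinearMap.id
  | _ + 1, w => LinearMap.prod (scale (Fin.tail w) ∘ₗ LinearMap.fst B _ _)
      (w 0 • scale (Fin.tail w) ∘ₗ LinearMap.snd B _ _)

theorem scale_mk (w : Fin (p + 1) → B) (a b : Kos T p) :
    scale w (mk a b) = mk (scale (Fin.tail w) a) (w 0 • scale (Fin.tail w) b) := rfl

theorem top_scale (w : Fin p → B) (z : Kos T p) :
    top B T p (scale w z) = (∏ j, w j) • top B T p z := by
  induction p with
  | zero => rw [Finset.univ_eq_empty, Finset.prod_empty, one_smul]; rfl
  | succ p ih =>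
    obtain ⟨a, b, rfl⟩ := exists_eq_mk z
    rw [scale_mk, top_mk, top_mk, map_smul, ih, smul_smul, Fin.prod_univ_succ]
    rfl

theorem scale_Q (q : T →ₗ[B] T) (w : Fin p → B) (z : Kos T p) :
    scale w (Q q w z) = Q q (fun j => w j * w j) (scale w z) := by
  induction p with
  | zero => rfl
  | succ p ih =>
    obtain ⟨a, b, rfl⟩ := exists_eq_mk z
    have h : Fin.tail (fun j => w j * w j) = fun j => Fin.tail w j * Fin.tail w j := rfl
    rw [Q_mk, scale_mk, scale_mk, Q_mk, h, ih, map_sub, ih, map_smul, map_smul, smul_sub, smul_smul]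

/-- If the `w_j` act null-homotopically, then a cocycle with exact constant term becomes exact once
the family `w` is replaced by that of its squares. -/
theorem exists_scale_eq_Q {q : T →ₗ[B] T} {w : Fin p → B} (τ : Fin p → T →+ T)
    (hτ : ∀ j x, τ j (q x) + q (τ j x) = w j • x) (hτw : ∀ j k x, τ j (w k • x) = w k • τ j x)
    {z : Kos T p} (hz : Q q w z = 0) {η : T} (hη : const B T p z = q η) :
    ∃ y, scale w z = Q q (fun j => w j * w j) y := by
  induction p with
  | zero => exact ⟨η, hη⟩
  | succ p ih =>
    obtain ⟨a, b, rfl⟩ := exists_eq_mk z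
    rw [Q_mk, mk_eq_zero, sub_eq_zero] at hz
    obtain ⟨ha, hb⟩ := hz
    obtain ⟨a', ha'⟩ := ih (w := Fin.tail w) (Fin.tail τ) (fun j x => hτ j.succ x)
      (fun j k x => hτw j.succ k.succ x) ha hη
    have e : Q q (fun j => Fin.tail w j * Fin.tail w j) (scale (Fin.tail w) b - w 0 • a') = 0 := by
      rw [map_sub, ← scale_Q, ← hb, map_smul, map_smul, ha', sub_self]
    refine ⟨mk a' (- ext (τ 0) p (scale (Fin.tail w) b - w 0 • a')), ?_⟩
    have h : Fin.tail (fun j => w j * w j) = fun j => Fin.tail w j * Fin.tail w j := rfl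
    have e2 := ext_Q (w := fun j => Fin.tail w j * Fin.tail w j) (hτ 0)
      (fun (j : Fin p) x => by
        change τ 0 ((w j.succ * w j.succ) • x) = (w j.succ * w j.succ) • τ 0 x
        rw [mul_smul, hτw, hτw, mul_smul])
      (scale (Fin.tail w) b - w 0 • a')
    rw [e, map_zero, zero_add] at e2
    rw [scale_mk, Q_mk, mk_inj, h, ha', map_neg, e2, smul_sub, smul_smul]
    exact ⟨rfl, by abel⟩

end Homotopy

end Kos

end OddSymplectic

namespace OddSymplectic

/-! ### Change of the family in the Koszul complex -/

/-- An alternating map in as many variables as the rank is a multiple of the determinant. -/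
theorem alternating_eq_det_smul {B T : Type*} [CommRing B] [AddCommGroup T] [Module B T] {p : ℕ}
    (A : (Fin p → B) [⋀^Fin p]→ₗ[B] T) (H : Matrix (Fin p) (Fin p) B) :
    (A fun i => H i) = H.det • A fun i => Pi.single i 1 := by
  have h : A = (LinearMap.toSpanSingleton B T (A fun i => Pi.single i 1)).compAlternatingMap
      Matrix.detRowAlternating := by
    refine Module.Basis.ext_alternating (Pi.basisFun B (Fin p)) fun v hv => ?_
    obtain ⟨σ, rfl⟩ : ∃ σ : Equiv.Perm (Fin p), v = σ :=
      ⟨Equiv.ofBijective v (Finite.injective_iff_bijective.1 hv), rfl⟩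
    have h1 : (fun i => Pi.basisFun B (Fin p) (σ i)) =
        (fun i => (Pi.single i 1 : Fin p → B)) ∘ σ := by
      funext i; simp
    have h2 : Matrix.detRowAlternating (fun i => (Pi.single i 1 : Fin p → B)) = 1 := by
      refine Eq.trans (congrArg Matrix.det (Matrix.ext fun i j => ?_))
        (Matrix.det_one (n := Fin p) (R := B))
      rw [Matrix.one_apply, Pi.single_apply]
      simp only [eq_comm]
    rw [h1, AlternatingMap.map_perm, AlternatingMap.map_perm,
      LinearMap.compAlternatingMap_apply, h2, LinearMap.toSpanSingleton_apply, one_smul]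
  have := DFunLike.congr_fun h fun i => H i
  rwa [LinearMap.compAlternatingMap_apply, LinearMap.toSpanSingleton_apply] at this

namespace Kos

variable {B T Y : Type*} [CommRing B] [AddCommGroup T] [Module B T] [AddCommGroup Y] [Module B Y]
  {p k : ℕ}

/-- Substitution of operators `e_j` on `Y` for the variables and of a map `T → Y` for the
coefficients. -/
def eval (f : T →ₗ[B] Y) : ∀ {k : ℕ}, (Fin k → Y →ₗ[B] Y) → (Kos T k →ₗ[B] Y)
  | 0, _ => f
  | _ + 1, e => eval f (Fin.tail e) ∘ₗ LinearMap.fst B _ _ +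
      e 0 ∘ₗ eval f (Fin.tail e) ∘ₗ LinearMap.snd B _ _

theorem eval_mk (f : T →ₗ[B] Y) (e : Fin (k + 1) → Y →ₗ[B] Y) (a b : Kos T k) :
    eval f e (mk a b) = eval f (Fin.tail e) a + e 0 (eval f (Fin.tail e) b) := rfl

theorem eval_Q {f : T →ₗ[B] Y} {e : Fin k → Y →ₗ[B] Y} {q : T →ₗ[B] T} {W : Y →ₗ[B] Y}
    (hf : ∀ t, W (f t) = f (q t)) (hW : ∀ l x, W (e l x) = - e l (W x))
    (he : ∀ l m x, e l (e m x) = - e m (e l x)) (hsq : ∀ l x, e l (e l x) = 0)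
    (u : Fin k → B) (z : Kos T k) :
    eval f e (Q q u z) = W (eval f e z) + ∑ l, u l • e l (eval f e z) := by
  induction k with
  | zero =>
    rw [Finset.univ_eq_empty, Finset.sum_empty, add_zero]
    exact (hf z).symm
  | succ k ih =>
    obtain ⟨a, b, rfl⟩ := exists_eq_mk z
    have ih' := ih (e := Fin.tail e) (fun l => hW l.succ) (fun l m => he l.succ m.succ)
      (fun l => hsq l.succ) (Fin.tail u)
    rw [Q_mk, eval_mk, eval_mk, map_sub, ih', ih', map_smul, Fin.sum_univ_succ]
    simp only [map_add, hW, hsq, map_sub, map_smul, map_sum, smul_add, Finset.sum_add_distrib,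
      he (Fin.succ _) 0, smul_neg, Finset.sum_neg_distrib, Fin.tail, smul_zero]
    abel

/-- The substitution `e_l ↦ ∑_i H_il e_i`. -/
def transport (H : Matrix (Fin p) (Fin k) B) : Kos T k →ₗ[B] Kos T p :=
  eval (ofConst p) fun l => Q 0 fun i => H i l

theorem Q_transport (q : T →ₗ[B] T) (H : Matrix (Fin p) (Fin k) B) (u : Fin k → B) (z : Kos T k) :
    Q q (H.mulVec u) (transport H z) = transport H (Q q u z) := by
  rw [transport, eval_Q (W := Q q 0) (ofConst_Q q) (fun l x => Q_anticomm (by simp) _ _ _)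
    (fun l m x => Q_anticomm (by simp) _ _ _) (fun l x => Q_Q (by simp) _ _), ← Q_sum, ← Q_add,
    add_zero, zero_add]
  congr 2
  funext i
  simp only [Matrix.mulVec, dotProduct, Finset.sum_apply, Pi.smul_apply, smul_eq_mul, mul_comm]

theorem const_transport (H : Matrix (Fin p) (Fin k) B) (z : Kos T k) :
    const B T p (transport H z) = const B T k z := by
  induction k with
  | zero => exact const_ofConst p z
  | succ k ih =>
    obtain ⟨a, b, rfl⟩ := exists_eq_mk z
    rw [transport, eval_mk, map_add, const_Q, LinearMap.zero_apply, add_zero, const_mk]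
    exact ih (fun i l => H i l.succ) a

theorem D_ofConst (h : Fin p → B) (t : T) : D h (ofConst (B := B) p t) = 0 := by
  induction p with
  | zero => rfl
  | succ p ih =>
    have e : ofConst (B := B) (p + 1) t = mk (ofConst (B := B) p t) 0 := rfl
    rw [e, D_mk, ih, smul_zero, add_zero, map_zero, neg_zero, mk_zero_zero]

/-- The canonical anticommutation relations of contractions and multiplications. -/
theorem D_Q (h g : Fin p → B) (z : Kos T p) :
    D h (Q 0 g z) = (h ⬝ᵥ g) • z - Q 0 g (D h z) := by
  induction p with
  | zero =>
    rw [dotProduct, Finset.univ_eq_empty, Finset.sum_empty, zero_smul, zero_sub]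
    exact neg_zero.symm
  | succ p ih =>
    obtain ⟨a, b, rfl⟩ := exists_eq_mk z
    have e : h ⬝ᵥ g = h 0 * g 0 + Fin.tail h ⬝ᵥ Fin.tail g := Fin.sum_univ_succ _
    simp only [Q_mk, D_mk, ih, e, smul_mk, mk_add, mk_sub, mk_inj, map_sub, map_add, map_smul, map_neg,
      add_smul, smul_sub, smul_add, ← smul_smul, smul_comm (g 0)]
    constructor <;> abel

theorem D_transport (h : Fin p → B) (H : Matrix (Fin p) (Fin k) B) (z : Kos T k) :
    D h (transport H z) = transport H (D (Matrix.vecMul h H) z) := by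
  induction k with
  | zero => exact (D_ofConst h z).trans (map_zero _).symm
  | succ k ih =>
    obtain ⟨a, b, rfl⟩ := exists_eq_mk z
    have ih' := ih fun i l => H i l.succ
    have e : Fin.tail (Matrix.vecMul h H) = Matrix.vecMul h fun i l => H i l.succ := rfl
    have e' : Matrix.vecMul h H 0 = h ⬝ᵥ fun i => H i 0 := rfl
    have ht : ∀ a b : Kos T k, transport H (mk a b) = transport (fun i l => H i l.succ) a +
      Q 0 (fun i => H i 0) (transport (fun i l => H i l.succ) b) := fun _ _ => rfl
    rw [D_mk, ht, ht, map_add, D_Q, ih', ih', e, e', map_add, map_neg, map_neg, map_smul]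
    abel

theorem D_add (h g : Fin p → B) (z : Kos T p) : D (h + g) z = D h z + D g z := by
  induction p with
  | zero => exact (add_zero (0 : T)).symm
  | succ p ih =>
    obtain ⟨a, b, rfl⟩ := exists_eq_mk z
    have e : Fin.tail (h + g) = Fin.tail h + Fin.tail g := rfl
    rw [D_mk, D_mk, D_mk, mk_add, e, ih, ih, Pi.add_apply, add_smul, mk_inj]
    constructor <;> abel

theorem D_smul (c : B) (h : Fin p → B) (z : Kos T p) : D (c • h) z = c • D h z := by
  induction p with
  | zero => exact (smul_zero (A := T) c).symm
  | succ p ih =>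
    obtain ⟨a, b, rfl⟩ := exists_eq_mk z
    have e : Fin.tail (c • h) = c • Fin.tail h := rfl
    rw [D_mk, D_mk, smul_mk, e, ih, ih, Pi.smul_apply, smul_eq_mul, smul_add, smul_smul, smul_neg]

theorem D_D (h : Fin p → B) (z : Kos T p) : D h (D h z) = 0 := by
  induction p with
  | zero => rfl
  | succ p ih =>
    obtain ⟨a, b, rfl⟩ := exists_eq_mk z
    rw [D_mk, D_mk, map_add, map_neg, ih, ih, map_smul, neg_zero, neg_zero, smul_neg, zero_add,
      add_neg_cancel, mk_zero_zero]

variable (B T p) in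
/-- The contraction as a linear map to operators. -/
def contraction : (Fin p → B) →ₗ[B] Module.End B (Kos T p) where
  toFun := D
  map_add' h g := LinearMap.ext (D_add h g)
  map_smul' c h := LinearMap.ext (D_smul c h)

variable (B) in
/-- The constant term of the iterated contraction of `z`, an alternating function of the
covectors. -/
noncomputable def contractAll (z : Kos T p) : (Fin p → B) [⋀^Fin p]→ₗ[B] T :=
  (const B T p ∘ₗ LinearMap.applyₗ z ∘ₗ (ExteriorAlgebra.lift B ⟨contraction B T p, fun h =>
    LinearMap.ext (D_D h)⟩).toLinearMap).compAlternatingMap (ExteriorAlgebra.ιMulti B p)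

theorem contractAll_apply (z : Kos T p) (h : Fin p → Fin p → B) :
    contractAll B z h =
      const B T p (((List.ofFn h).map (contraction B T p)).prod z) := by
  simp only [contractAll, LinearMap.compAlternatingMap_apply, LinearMap.comp_apply,
    ExteriorAlgebra.ιMulti_apply, LinearMap.applyₗ_apply_apply, AlgHom.toLinearMap_apply, map_list_prod]
  congr 3
  simp only [List.map_ofFn]
  congr 1
  funext i
  simp

theorem prod_contraction_transport (l : List (Fin p → B)) (H : Matrix (Fin p) (Fin p) B)
    (z : Kos T p) : (l.map (contraction B T p)).prod (transport H z) =
      transport H (((l.map fun h => Matrix.vecMul h H).map (contraction B T p)).prod z) := by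
  induction l with
  | nil => rfl
  | cons h l ih =>
    simp only [List.map_cons, List.prod_cons, Module.End.mul_apply, ih]
    exact D_transport h H _

theorem prod_contraction_mk (l : List (Fin p → B)) (a b : Kos T p) :
    ((l.map fun h => (Fin.cons 0 h : Fin (p + 1) → B)).map (contraction B T (p + 1))).prod (mk a b) =
      mk ((l.map (contraction B T p)).prod a)
        ((-1 : B) ^ l.length • (l.map (contraction B T p)).prod b) := by
  induction l with
  | nil => simp
  | cons h l ih =>
    simp only [List.map_cons, List.prod_cons, Module.End.mul_apply, ih, List.length_cons]
    have e : ∀ c d : Kos T p, contraction B T (p + 1) (Fin.cons 0 h) (mk c d) =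
      mk (contraction B T p h c) (- contraction B T p h d) := fun c d => by
        have := D_mk (Fin.cons 0 h) c d
        rw [Fin.tail_cons, Fin.cons_zero, zero_smul, add_zero] at this
        exact this
    rw [e, map_smul, pow_succ, mul_neg_one, neg_smul]

/-- Contraction with all coordinate covectors extracts the top coefficient, up to a sign. -/
theorem contractAll_single (p : ℕ) : ∃ s : B, s * s = 1 ∧ ∀ z : Kos T p,
    contractAll B z (fun i => Pi.single i 1) = s • top B T p z := by
  induction p with
  | zero => exact ⟨1, one_mul 1, fun z => by rw [contractAll_apply, one_smul]; rfl⟩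
  | succ p ih =>
    obtain ⟨s, hs, h⟩ := ih
    refine ⟨s * (-1) ^ p, ?_, fun z => ?_⟩
    · rw [mul_mul_mul_comm, hs, ← mul_pow, neg_one_mul, neg_neg, one_pow, one_mul]
    · obtain ⟨a, b, rfl⟩ := exists_eq_mk z
      have e : List.ofFn (fun i : Fin (p + 1) => (Pi.single i 1 : Fin (p + 1) → B)) =
          Pi.single 0 1 :: (List.ofFn fun i : Fin p => (Pi.single i 1 : Fin p → B)).map
            fun h => (Fin.cons 0 h : Fin (p + 1) → B) := by
        rw [List.ofFn_succ, List.map_ofFn]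
        congr 2
        funext i
        refine funext fun j => ?_
        refine Fin.cases ?_ (fun j => ?_) j
        · simp
        · simp [Pi.single_apply]
      have e1 : ∀ c d : Kos T p, const B T (p + 1)
          (contraction B T (p + 1) (Pi.single 0 1) (mk c d)) = const B T p d := fun c d => by
        have h1 := D_mk (Pi.single 0 1 : Fin (p + 1) → B) c d
        have h2 : Fin.tail (Pi.single 0 1 : Fin (p + 1) → B) = (0 : B) • 0 := by
          rw [smul_zero]
          funext j
          simp [Fin.tail]
        have h3 := congrArg (const B T (p + 1)) h1
        rw [const_mk, h2, D_smul, zero_smul, zero_add, Pi.single_eq_same, one_smul] at h3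
        exact h3
      rw [contractAll_apply, e, List.map_cons, List.prod_cons, Module.End.mul_apply,
        prod_contraction_mk, e1, map_smul, ← contractAll_apply, h, List.length_ofFn, smul_smul,
        mul_comm, top_mk]

/-- The top coefficient of a transported element is multiplied by the determinant. -/
theorem top_transport (H : Matrix (Fin p) (Fin p) B) (z : Kos T p) :
    top B T p (transport H z) = H.det • top B T p z := by
  obtain ⟨s, hs, h⟩ := contractAll_single (B := B) (T := T) p
  have h1 : contractAll B (transport H z) (fun i => Pi.single i 1) =
      contractAll B z fun i => H i := by
    rw [contractAll_apply, contractAll_apply, prod_contraction_transport, const_transport,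
      List.map_ofFn]
    congr 6
    funext i
    exact Matrix.single_one_vecMul i H
  rw [alternating_eq_det_smul, h, h] at h1
  have h2 := congrArg (s • ·) h1
  simp only [smul_smul, hs, one_smul] at h2
  rw [h2, mul_left_comm, hs, mul_one]

/-- The product `(y_1 + e_1) ⋯ (y_p + e_p) g`. -/
def shifted (g : T) : ∀ {p : ℕ}, (Fin p → T →ₗ[B] T) → Kos T p
  | 0, _ => g
  | _ + 1, y => mk (Q (y 0) 0 (shifted g (Fin.tail y))) (shifted g (Fin.tail y))

theorem top_shifted (g : T) (y : Fin p → T →ₗ[B] T) : top B T p (shifted g y) = g := by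
  induction p with
  | zero => rfl
  | succ p ih => exact ih _

theorem const_shifted (g : T) (y : Fin p → T →ₗ[B] T) :
    const B T p (shifted g y) = (List.ofFn y).prod g := by
  induction p with
  | zero => rfl
  | succ p ih =>
    rw [List.ofFn_succ, List.prod_cons, Module.End.mul_apply, shifted, const_mk, const_Q, ih]
    rfl

/-- If `Ω = q + ∑ u_l y_l` and `q g = 0`, then `Ω + ∑ u_l e_l` equals `q + ∑ u_l (y_l + e_l)`, which
annihilates the product of the `y_l + e_l` with `g`. -/
theorem Q_shifted {Ω q : T →ₗ[B] T} {y : Fin p → T →ₗ[B] T} {g : T} (hg : q g = 0)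
    (hq : ∀ l x, q (y l x) = - y l (q x)) (hy : ∀ l m x, y l (y m x) = - y m (y l x))
    (hsq : ∀ l x, y l (y l x) = 0) (u : Fin p → B) (hΩ : ∀ x, Ω x = q x + ∑ l, u l • y l x) :
    Q Ω u (shifted g y) = 0 := by
  obtain rfl : Ω = q + ∑ l, u l • y l := LinearMap.ext fun x => by
    rw [hΩ, LinearMap.add_apply, LinearMap.sum_apply]
    rfl
  clear hΩ
  induction p with
  | zero =>
    rw [Finset.univ_eq_empty, Finset.sum_empty, add_zero]
    exact hg
  | succ p ih =>
    have ih' := ih (y := Fin.tail y) (fun l => hq l.succ) (fun l m => hy l.succ m.succ)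
      (fun l => hsq l.succ) (Fin.tail u)
    set z := shifted g (Fin.tail y)
    set P := q + ∑ l, Fin.tail u l • Fin.tail y l with hP
    have hall : q + ∑ l, u l • y l = P + u 0 • y 0 := by
      rw [Fin.sum_univ_succ, hP]
      simp only [Fin.tail]
      abel
    have h1 : ∀ x, Q (P + u 0 • y 0) (Fin.tail u) x = Q P (Fin.tail u) x + u 0 • Q (y 0) 0 x := by
      intro x
      rw [← Q_smul, ← Q_add, smul_zero, add_zero]
    have hP0 : ∀ x, P (y 0 x) = - y 0 (P x) := fun x => by
      simp only [hP, LinearMap.add_apply, hq, LinearMap.sum_apply, LinearMap.smul_apply, Fin.tail,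
        hy (Fin.succ _) 0, map_add, map_sum, map_smul, smul_neg, Finset.sum_neg_distrib]
      abel
    have hs : shifted g y = mk (Q (y 0) 0 z) z := rfl
    rw [hs, hall, Q_mk, mk_eq_zero, h1, h1, ih', zero_add, sub_self, Q_Q (hsq 0), smul_zero,
      add_zero, Q_anticomm hP0, ih', map_zero, neg_zero]
    exact ⟨rfl, rfl⟩

section Split

variable {e : Fin k → T →ₗ[B] T} {δ : Fin k → T →+ T} {w : Fin k → B}

/-- A right inverse of the substitution of operators `e_j`, built from operators `δ_j` that satisfy
the canonical anticommutation relations with the `e_j`. -/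
def split : ∀ {k : ℕ}, (Fin k → T →ₗ[B] T) → (Fin k → T →+ T) → (T →+ Kos T k)
  | 0, _, _ => AddMonoidHom.id T
  | _ + 1, e, δ => AddMonoidHom.prod
      ((split (Fin.tail e) (Fin.tail δ)).comp ((δ 0).comp (e 0).toAddMonoidHom))
      ((split (Fin.tail e) (Fin.tail δ)).comp (δ 0))

theorem split_succ (e : Fin (k + 1) → T →ₗ[B] T) (δ : Fin (k + 1) → T →+ T) (r : T) :
    split e δ r = mk (split (Fin.tail e) (Fin.tail δ) (δ 0 (e 0 r)))
      (split (Fin.tail e) (Fin.tail δ) (δ 0 r)) := rfl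

theorem eval_split (h : ∀ l x, δ l (e l x) + e l (δ l x) = x) (r : T) :
    eval LinearMap.id e (split e δ r) = r := by
  induction k generalizing r with
  | zero => rfl
  | succ k ih =>
    have ih' := ih (e := Fin.tail e) (δ := Fin.tail δ) fun l => h l.succ
    rw [split_succ, eval_mk, ih', ih', h]

theorem Q_split (he : ∀ l m x, e l (e m x) = - e m (e l x)) (hsq : ∀ l x, e l (e l x) = 0)
    (hδ : ∀ l m, l ≠ m → ∀ x, δ l (e m x) = - e m (δ l x))
    (hw : ∀ l m x, δ l (w m • x) = w m • δ l x) (r : T) :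
    Q 0 w (split e δ r) = split e δ (∑ l, w l • e l r) := by
  induction k generalizing r with
  | zero =>
    rw [Finset.univ_eq_empty, Finset.sum_empty, map_zero]
    rfl
  | succ k ih =>
    have ih' := ih (e := Fin.tail e) (δ := Fin.tail δ) (w := Fin.tail w)
      (fun l m => he l.succ m.succ) (fun l => hsq l.succ)
      (fun l m h => hδ l.succ m.succ fun h' => h (Fin.succ_injective k h'))
      (fun l m => hw l.succ m.succ)
    have h0 : ∀ (j : Fin k) x, δ 0 (e j.succ x) = - e j.succ (δ 0 x) := fun j =>
      hδ 0 j.succ (Fin.succ_ne_zero j).symm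
    rw [split_succ, Q_mk, ih', ih', split_succ, Fin.sum_univ_succ]
    have e1 : δ 0 (e 0 (w 0 • e 0 r + ∑ i : Fin k, w i.succ • e i.succ r)) =
        ∑ l, Fin.tail w l • Fin.tail e l (δ 0 (e 0 r)) := by
      simp only [map_add, map_smul, hsq, smul_zero, zero_add, map_sum, hw, Fin.tail,
        he 0 (Fin.succ _), h0, map_neg, neg_neg]
    have e2 : δ 0 (w 0 • e 0 r + ∑ i : Fin k, w i.succ • e i.succ r) =
        w 0 • δ 0 (e 0 r) - ∑ l, Fin.tail w l • Fin.tail e l (δ 0 r) := by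
      simp only [map_add, hw, map_sum, Fin.tail, h0, smul_neg, Finset.sum_neg_distrib,
        sub_eq_add_neg]
    have e3 : ∀ (c : B) (x : T), (∀ (l : Fin k) x, δ l.succ (c • x) = c • δ l.succ x) →
        split (Fin.tail e) (Fin.tail δ) (c • x) = c • split (Fin.tail e) (Fin.tail δ) x := by
      clear * -
      intro c x h
      generalize he' : Fin.tail e = e'
      replace h : ∀ (l : Fin k) x, Fin.tail δ l (c • x) = c • Fin.tail δ l x := h
      generalize Fin.tail δ = δ' at h
      clear he' e δ
      induction k generalizing x with
      | zero => rfl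
      | succ k ih =>
        rw [split_succ, split_succ, map_smul, h, h, ih _ (Fin.tail e') (Fin.tail δ') fun l => h l.succ,
          ih _ (Fin.tail e') (Fin.tail δ') fun l => h l.succ, smul_mk]
    rw [e1, e2, map_sub, e3 (w 0) _ fun l => hw l.succ 0]

theorem map_eval_lift {δ₀ : T →+ T} (h : ∀ l x, δ₀ (e l x) = - e l (δ₀ x)) {γ : T}
    (hγ : δ₀ γ = 0) : δ₀ (eval LinearMap.id e (lift γ k)) = 0 := by
  induction k with
  | zero => exact hγ
  | succ k ih =>
    have hl : lift γ (k + 1) = mk 0 (lift γ k) := rfl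
    rw [hl, eval_mk, map_zero, zero_add, h, ih (e := Fin.tail e) fun l => h l.succ, map_zero,
      neg_zero]

theorem split_eval_lift (hsq : ∀ l x, e l (e l x) = 0)
    (h : ∀ l x, δ l (e l x) + e l (δ l x) = x)
    (hδ : ∀ l m, l ≠ m → ∀ x, δ l (e m x) = - e m (δ l x)) {γ : T} (hγ : ∀ l, δ l γ = 0) :
    split e δ (eval LinearMap.id e (lift γ k)) = lift γ k := by
  induction k with
  | zero => rfl
  | succ k ih =>
    have ih' := ih (e := Fin.tail e) (δ := Fin.tail δ) (fun l => hsq l.succ) (fun l => h l.succ)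
      (fun l m h => hδ l.succ m.succ fun h' => h (Fin.succ_injective k h')) (fun l => hγ l.succ)
    have hl : lift γ (k + 1) = mk 0 (lift γ k) := rfl
    have h0 : δ 0 (eval LinearMap.id (Fin.tail e) (lift γ k)) = 0 :=
      map_eval_lift (fun l => hδ 0 l.succ (Fin.succ_ne_zero l).symm) (hγ 0)
    have h1 := h 0 (eval LinearMap.id (Fin.tail e) (lift γ k))
    rw [h0, map_zero, add_zero] at h1
    rw [hl, eval_mk, map_zero, zero_add, split_succ, hsq, map_zero, map_zero, h1, ih']

theorem map_top_split {δ₀ : T →+ T} (h : ∀ l x, δ₀ (δ l x) = - δ l (δ₀ x)) {r : T}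
    (hr : δ₀ r = 0) : δ₀ (top B T k (split e δ r)) = 0 := by
  induction k generalizing r with
  | zero => exact hr
  | succ k ih =>
    rw [split_succ, top_mk]
    exact ih (fun l => h l.succ) (by rw [h, hr, map_zero, neg_zero])

theorem δ_top_split (h : ∀ l m x, δ l (δ m x) = - δ m (δ l x)) (hsq : ∀ l x, δ l (δ l x) = 0)
    (l : Fin k) (r : T) : δ l (top B T k (split e δ r)) = 0 := by
  induction k generalizing r with
  | zero => exact l.elim0
  | succ k ih =>
    rw [split_succ, top_mk]
    refine Fin.cases ?_ (fun l => ?_) l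
    · exact map_top_split (fun l => h 0 l.succ) (hsq 0 r)
    · exact ih (δ := Fin.tail δ) (fun l m => h l.succ m.succ) (fun l => hsq l.succ) l _

theorem Q_zero_lift (w : Fin k → B) (γ : T) : Q (0 : T →ₗ[B] T) w (lift γ k) = 0 := by
  induction k with
  | zero => rfl
  | succ k ih =>
    have hl : lift γ (k + 1) = mk 0 (lift γ k) := rfl
    rw [hl, Q_mk, ih, map_zero, smul_zero, sub_zero, mk_zero_zero]

/-- A cocycle of `∑ w_l e_l` is determined, up to a coboundary, by its top coefficient modulo the
`w_l`. -/
theorem exists_eq_eval_lift_add (he : ∀ l m x, e l (e m x) = - e m (e l x))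
    (hsq : ∀ l x, e l (e l x) = 0) (h : ∀ l x, δ l (e l x) + e l (δ l x) = x)
    (hδ : ∀ l m, l ≠ m → ∀ x, δ l (e m x) = - e m (δ l x))
    (hw : ∀ l m x, δ l (w m • x) = w m • δ l x) (hreg : RegularFamily T w) {τ f : T}
    (hτ : ∑ l, w l • e l τ = 0)
    (hτf : top B T k (split e δ τ) - f ∈ combos T w Finset.univ) :
    ∃ σ, τ = eval LinearMap.id e (lift f k) + ∑ l, w l • e l σ := by
  obtain ⟨s, hs, -⟩ := exists_eq_Q (q := (0 : T →ₗ[B] T)) (by simp) hreg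
    (split e δ τ - lift f k)
    (by rw [map_sub, Q_zero_lift, Q_split he hsq hδ hw, hτ, map_zero, sub_zero])
    (by rwa [map_sub, top_lift])
  refine ⟨eval LinearMap.id e s, ?_⟩
  have h1 := congrArg (eval LinearMap.id e) hs
  rw [eval_Q (W := 0) (by simp) (by simp) he hsq, map_sub, eval_split h, LinearMap.zero_apply,
    zero_add, sub_eq_iff_eq_add] at h1
  rw [h1, add_comm]

/-- A top-degree element that is a coboundary of `∑ w_l e_l` has coefficient in the ideal of the
`w_l`. -/
theorem mem_combos_of_eval_lift_eq (he : ∀ l m x, e l (e m x) = - e m (e l x))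
    (hsq : ∀ l x, e l (e l x) = 0) (h : ∀ l x, δ l (e l x) + e l (δ l x) = x)
    (hδ : ∀ l m, l ≠ m → ∀ x, δ l (e m x) = - e m (δ l x))
    (hw : ∀ l m x, δ l (w m • x) = w m • δ l x) {f σ : T} (hf : ∀ l, δ l f = 0)
    (hfσ : eval LinearMap.id e (lift f k) = ∑ l, w l • e l σ) :
    f ∈ combos T w Finset.univ := by
  have h1 := congrArg (fun x => top B T k (split e δ x)) hfσ
  simp only [split_eval_lift hsq h hδ hf, top_lift, ← Q_split he hsq hδ hw] at h1
  have h2 := top_Q (0 : T →ₗ[B] T) w (split e δ σ)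
  rwa [← h1, LinearMap.zero_apply, smul_zero, sub_zero] at h2

end Split

end Kos

end OddSymplectic

namespace OddSymplectic

/-! ### The `ω`-cohomology of superforms -/

section OmegaCohomology

variable {n : ℕ} {R : Type*} [CommRing R] [Algebra ℝ R] {ev : R →+* ℝ}

/-- Left multiplication by a superform, as a linear map over the even superforms. -/
noncomputable def leftMul (s : SuperForm n R) : SuperForm n R →ₗ[EvenForm n R] SuperForm n R where
  toFun t := s * t
  map_add' := mul_add s
  map_smul' a t := EvenForm.mul_smul a s t

@[simp] theorem leftMul_apply (s t : SuperForm n R) : leftMul s t = s * t := rfl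

theorem odd_mul_self (v : Fin n ⊕ Fin n → Fibre n) : (odd v * odd v : SuperForm n R) = 0 := by
  simp only [odd, Algebra.TensorProduct.tmul_mul_tmul]
  erw [ExteriorAlgebra.ι_sq_zero]
  simp

theorem dx_mul_dx_mul (i j : Fin n) (s : SuperForm n R) :
    dx R i * (dx R j * s) = - (dx R j * (dx R i * s)) := by
  rw [← mul_assoc, ← mul_assoc, dx, dx, odd_mul, parity_odd, neg_mul, neg_mul]

theorem dx_mul_dx_mul_self (i : Fin n) (s : SuperForm n R) : dx R i * (dx R i * s) = 0 := by
  rw [← mul_assoc, dx, odd_mul_self, zero_mul]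

variable (R) in
/-- `dθ_i` as an even superform. -/
noncomputable def dthetaEven (i : Fin n) : EvenForm n R := ⟨dtheta R i, parity_dtheta i⟩

@[simp] theorem coe_dthetaEven (i : Fin n) : (dthetaEven R i : SuperForm n R) = dtheta R i := rfl

theorem omega_mul_eq_sum (s : SuperForm n R) :
    omega n R * s = ∑ i, dthetaEven R i • leftMul (dx R i) s := by
  rw [omega, Finset.sum_mul]
  refine Finset.sum_congr rfl fun i _ => ?_
  rw [EvenForm.smul_def, leftMul_apply, dthetaEven, ← mul_assoc, dtheta_comm]

theorem contract_odd (φ : Module.Dual (Fibre n) (Fin n ⊕ Fin n → Fibre n))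
    (v : Fin n ⊕ Fin n → Fibre n) :
    contract φ (odd v : SuperForm n R) = 1 ⊗ₜ[ℝ] algebraMap (Fibre n) (Grass n) (φ v) := by
  rw [odd, contract_tmul]
  congr 1
  exact CliffordAlgebra.contractLeft_ι _ _ v

theorem contract_pureForm (φ : Module.Dual (Fibre n) (Fin n ⊕ Fin n → Fibre n))
    (a : R ⊗[ℝ] Fibre n) : contract φ (pureForm n R a) = 0 := by
  induction a using TensorProduct.induction_on with
  | zero => simp
  | add a b ha hb => rw [map_add, map_add, ha, hb, add_zero]
  | tmul r f =>
    rw [pureForm_tmul, contract_tmul]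
    erw [CliffordAlgebra.contractLeft_algebraMap]
    rw [TensorProduct.tmul_zero]

theorem contract_pureForm_mul (φ : Module.Dual (Fibre n) (Fin n ⊕ Fin n → Fibre n))
    (a : R ⊗[ℝ] Fibre n) (s : SuperForm n R) :
    contract φ (pureForm n R a * s) = pureForm n R a * contract φ s := by
  rw [contract_mul, contract_pureForm, zero_mul, zero_add, parity_pureForm]

theorem func_eq_pureForm (r : R) : (func r : SuperForm n R) = pureForm n R (r ⊗ₜ 1) := by
  rw [pureForm_tmul, map_one, func]

theorem dtheta_eq_pureForm (i : Fin n) :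
    dtheta R i = pureForm n R (1 ⊗ₜ MvPolynomial.X i) := rfl

theorem contract_contract (φ ψ : Module.Dual (Fibre n) (Fin n ⊕ Fin n → Fibre n))
    (s : SuperForm n R) : contract φ (contract ψ s) = - contract ψ (contract φ s) := by
  induction s using TensorProduct.induction_on with
  | zero => simp
  | add a b ha hb => simp only [map_add, ha, hb, neg_add]
  | tmul r g =>
    simp only [contract_tmul]
    rw [CliffordAlgebra.contractLeft_comm, TensorProduct.tmul_neg]

theorem contract_contract_self (φ : Module.Dual (Fibre n) (Fin n ⊕ Fin n → Fibre n))
    (s : SuperForm n R) : contract φ (contract φ s) = 0 := by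
  induction s using TensorProduct.induction_on with
  | zero => simp
  | add a b ha hb => simp only [map_add, ha, hb, add_zero]
  | tmul r g =>
    simp only [contract_tmul]
    rw [CliffordAlgebra.contractLeft_contractLeft, TensorProduct.tmul_zero]

/-- The left derivative `∂/∂(dx^i)`. -/
noncomputable def dDx (i : Fin n) : SuperForm n R →+ SuperForm n R :=
  (contract (LinearMap.proj (Sum.inr i))).toAddMonoidHom

theorem dDx_eq (i : Fin n) (s : SuperForm n R) :
    dDx i s = contract (LinearMap.proj (Sum.inr i)) s := rfl

theorem dDx_dx_mul_self (i : Fin n) (s : SuperForm n R) :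
    dDx i (dx R i * s) + dx R i * dDx i s = s := by
  rw [dDx_eq, dDx_eq, contract_mul, dx, contract_odd, parity_odd]
  simp [← Algebra.TensorProduct.one_def]

theorem dDx_dx_mul {i j : Fin n} (h : i ≠ j) (s : SuperForm n R) :
    dDx i (dx R j * s) = - (dx R j * dDx i s) := by
  rw [dDx_eq, dDx_eq, contract_mul, dx, contract_odd, parity_odd]
  simp [h]

theorem dDx_pureForm_mul (i : Fin n) (a : R ⊗[ℝ] Fibre n) (s : SuperForm n R) :
    dDx i (pureForm n R a * s) = pureForm n R a * dDx i s := contract_pureForm_mul _ a s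

theorem dDx_dthetaEven_smul (i j : Fin n) (s : SuperForm n R) :
    dDx i (dthetaEven R j • s) = dthetaEven R j • dDx i s :=
  dDx_pureForm_mul i (1 ⊗ₜ MvPolynomial.X j) s

theorem regularFamily_dtheta (hloc : ∀ r, ev r ≠ 0 → IsUnit r) :
    RegularFamily (SuperForm n R) (dthetaEven (n := n) R) := by
  have h := (regularFamily_linForm hloc (fun j : Fin n => (Pi.single j 1 : Fin n → R)) (by
    have e : (fun j i => ev ((Pi.single j 1 : Fin n → R) i)) =
        fun j : Fin n => (Pi.single j 1 : Fin n → ℝ) := by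
      funext j i
      simp only [Pi.single_apply, apply_ite ev, map_one, map_zero]
    rw [e]
    exact Pi.linearIndependent_single_one (Fin n) ℝ)).superForm
  convert h using 1
  funext j
  refine Subtype.ext ?_
  rw [coe_evenOf, coe_dthetaEven, dtheta_eq_pureForm, linForm,
    Finset.sum_eq_single_of_mem j (Finset.mem_univ j), Pi.single_eq_same]
  intro i _ h
  rw [Pi.single_eq_of_ne h, TensorProduct.zero_tmul]

/-- Multiplication by `dx^1 ⋯ dx^n`. -/
noncomputable def dxTop (f : SuperForm n R) : SuperForm n R := (List.ofFn (dx R)).prod * f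

theorem eval_leftMul_lift {k : ℕ} (y : Fin k → SuperForm n R) (f : SuperForm n R) :
    Kos.eval (LinearMap.id : SuperForm n R →ₗ[EvenForm n R] SuperForm n R)
      (fun l => leftMul (y l)) (Kos.lift f k) = (List.ofFn y).prod * f := by
  induction k with
  | zero => exact (one_mul f).symm
  | succ k ih =>
    have hl : Kos.lift f (k + 1) = Kos.mk 0 (Kos.lift f k) := rfl
    rw [hl, Kos.eval_mk, map_zero, zero_add, List.ofFn_succ, List.prod_cons, mul_assoc,
      ← ih fun l => y l.succ]
    rfl

theorem mul_list_prod_eq_zero {y : SuperForm n R} {l : List (SuperForm n R)} (hy : y * y = 0)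
    (hl : ∀ z ∈ l, y * z = - (z * y)) (hmem : y ∈ l) : y * l.prod = 0 := by
  induction l with
  | nil => simp at hmem
  | cons z l ih =>
    rw [List.prod_cons]
    rcases List.mem_cons.1 hmem with rfl | h
    · rw [← mul_assoc, hy, zero_mul]
    · rw [← mul_assoc, hl z (List.mem_cons_self ..), neg_mul, mul_assoc,
        ih (fun z hz => hl z (List.mem_cons_of_mem _ hz)) h, mul_zero, neg_zero]

theorem dx_mul_dxTop (i : Fin n) (f : SuperForm n R) : dx R i * dxTop f = 0 := by
  rw [dxTop, ← mul_assoc, mul_list_prod_eq_zero, zero_mul]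
  · exact odd_mul_self _
  · intro z hz
    obtain ⟨j, rfl⟩ := (List.mem_ofFn' _ _).1 hz
    rw [dx, dx, odd_mul, parity_odd, neg_mul]
  · exact (List.mem_ofFn' _ _).2 ⟨i, rfl⟩

theorem omega_mul_dxTop (f : SuperForm n R) : omega n R * dxTop f = 0 := by
  rw [omega_mul_eq_sum]
  exact Finset.sum_eq_zero fun i _ => by rw [leftMul_apply, dx_mul_dxTop, smul_zero]

theorem omega_mul_omega_mul (s : SuperForm n R) : omega n R * (omega n R * s) = 0 := by
  have h : parity (omega n R) = - omega n R := by
    simp only [omega, map_sum, map_mul, dx, parity_odd, parity_dtheta, neg_mul,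
      Finset.sum_neg_distrib]
  have h1 := omega_mul (omega n R)
  rw [h, neg_mul, eq_neg_iff_add_eq_zero, ← two_smul ℝ, smul_eq_zero_iff_right two_ne_zero] at h1
  rw [← mul_assoc, h1, zero_mul]

section Functions

variable (n) in
/-- The Grassmann algebra on the `θ_i` with real coefficients. -/
abbrev ThetaAlgebra : Type := ExteriorAlgebra ℝ (Fin n → ℝ)

/-- The constant superforms in the `θ_i` alone. -/
noncomputable def ofTheta : ThetaAlgebra n →ₐ[ℝ] Grass n :=
  ExteriorAlgebra.lift ℝ ⟨((ExteriorAlgebra.ι (Fibre n)).restrictScalars ℝ) ∘ₗ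
    LinearMap.pi fun k => Sum.elim
      (fun i => (Algebra.linearMap ℝ (Fibre n)) ∘ₗ LinearMap.proj i) (fun _ => 0) k,
    fun _ => ExteriorAlgebra.ι_sq_zero _⟩

theorem ofTheta_ι (u : Fin n → ℝ) : ofTheta (ExteriorAlgebra.ι ℝ u) =
    ExteriorAlgebra.ι (Fibre n) (Sum.elim (fun i => algebraMap ℝ (Fibre n) (u i)) fun _ => 0) := by
  refine (ExteriorAlgebra.lift_ι_apply ℝ _ _ u).trans ?_
  refine congrArg (ExteriorAlgebra.ι (Fibre n)) (funext fun k => ?_)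
  rcases k with k | k <;> rfl

/-- The module structure over `ℝ[dθ]` in which all `dθ_i` act by zero. -/
noncomputable abbrev thetaAlgebraAlgebra : Algebra (Fibre n) (ThetaAlgebra n) :=
  ((algebraMap ℝ (ThetaAlgebra n)).comp MvPolynomial.constantCoeff).toAlgebra' fun c a =>
    Algebra.commutes (MvPolynomial.constantCoeff c) a

attribute [local instance] thetaAlgebraAlgebra in
/-- Setting all `dx^i` and `dθ_i` to zero in constant superforms. -/
noncomputable def toTheta : Grass n →ₐ[ℝ] ThetaAlgebra n :=
  haveI : IsScalarTower ℝ (Fibre n) (ThetaAlgebra n) := IsScalarTower.of_algebraMap_eq fun r => by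
    change _ = algebraMap ℝ (ThetaAlgebra n) (MvPolynomial.constantCoeff (MvPolynomial.C r))
    rw [MvPolynomial.constantCoeff_C]
  (ExteriorAlgebra.lift (Fibre n) ⟨
    { toFun := fun v => ExteriorAlgebra.ι ℝ fun i => MvPolynomial.constantCoeff (v (Sum.inl i))
      map_add' := fun v w => by
        rw [← map_add]
        congr 1
      map_smul' := fun c v => by
        refine Eq.trans ?_ (Algebra.smul_def (MvPolynomial.constantCoeff c : ℝ) _)
        rw [← map_smul]
        congr 1
        funext i
        simp },
    fun _ => ExteriorAlgebra.ι_sq_zero _⟩).restrictScalars ℝ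

/-- Setting all `dx^i` and `dθ_i` to zero. -/
noncomputable def thetaPart : SuperForm n R →ₐ[ℝ] R ⊗[ℝ] ThetaAlgebra n :=
  Algebra.TensorProduct.map (AlgHom.id ℝ R) toTheta

theorem toTheta_algebraMap (f : Fibre n) : toTheta (algebraMap (Fibre n) (Grass n) f) =
    algebraMap ℝ (ThetaAlgebra n) (MvPolynomial.constantCoeff f) :=
  letI := thetaAlgebraAlgebra (n := n)
  AlgHom.commutes (ExteriorAlgebra.lift (Fibre n) _) f

theorem toTheta_ι (v : Fin n ⊕ Fin n → Fibre n) : toTheta (ExteriorAlgebra.ι (Fibre n) v) =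
    ExteriorAlgebra.ι ℝ fun i => MvPolynomial.constantCoeff (v (Sum.inl i)) :=
  letI := thetaAlgebraAlgebra (n := n)
  ExteriorAlgebra.lift_ι_apply (Fibre n) _ _ v

theorem thetaPart_dtheta (i : Fin n) : thetaPart (dtheta R i) = 0 := by
  simp [thetaPart, dtheta, toTheta_algebraMap]

theorem map_ofTheta_thetaPart {f : SuperForm n R} (hf : f ∈ functions n R) :
    Algebra.TensorProduct.map (AlgHom.id ℝ R) ofTheta (thetaPart f) = f := by
  have h : functions n R ≤ AlgHom.equalizer
      ((Algebra.TensorProduct.map (AlgHom.id ℝ R) ofTheta).comp thetaPart)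
      (AlgHom.id ℝ (SuperForm n R)) := by
    refine Algebra.adjoin_le ?_
    rintro _ (⟨r, rfl⟩ | ⟨i, rfl⟩)
    · simp [thetaPart, func]
    · change (Algebra.TensorProduct.map (AlgHom.id ℝ R) ofTheta) (thetaPart (theta R i)) = theta R i
      simp only [thetaPart, theta, odd, Algebra.TensorProduct.map_tmul, toTheta_ι, ofTheta_ι]
      refine congrArg (fun v => (1 : R) ⊗ₜ[ℝ] (ExteriorAlgebra.ι (Fibre n) v)) (funext fun k => ?_)
      rcases k with k | k
      · by_cases h : k = i
        · subst h; simp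
        · simp [h]
      · simp
  exact h hf

/-- No nonzero superfunction is a combination of the `dθ_i`. -/
theorem functions_eq_zero {f : SuperForm n R} (hf : f ∈ functions n R)
    (h : f ∈ combos (SuperForm n R) (dthetaEven (n := n) R) Finset.univ) : f = 0 := by
  obtain ⟨y, hy⟩ := h
  have h0 : thetaPart f = 0 := by
    rw [hy, map_sum]
    refine Finset.sum_eq_zero fun i _ => ?_
    rw [EvenForm.smul_def, map_mul, coe_dthetaEven, thetaPart_dtheta, zero_mul]
  rw [← map_ofTheta_thetaPart hf, h0, map_zero]

theorem dDx_functions {f : SuperForm n R} (hf : f ∈ functions n R) (i : Fin n) : dDx i f = 0 := by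
  rw [dDx_eq]
  induction hf using Algebra.adjoin_induction with
  | mem x hx =>
    rcases hx with ⟨r, rfl⟩ | ⟨j, rfl⟩
    · rw [func_eq_pureForm, contract_pureForm]
    · rw [theta, contract_odd]; simp
  | algebraMap r =>
    have : algebraMap ℝ (SuperForm n R) r = func (algebraMap ℝ R r) := rfl
    rw [this, func_eq_pureForm, contract_pureForm]
  | add a b _ _ ha hb => rw [map_add, ha, hb, add_zero]
  | mul a b _ _ ha hb => rw [contract_mul, ha, hb, zero_mul, mul_zero, add_zero]

variable (n R) in
/-- The superforms that are superfunctions up to terms containing `dθ` or `dx`. -/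
noncomputable def functionsModGenerators : Submodule ℝ (SuperForm n R) where
  carrier := {s | ∃ f ∈ functions n R, ∃ y z : Fin n → SuperForm n R,
    s = f + (∑ i, dthetaEven R i • y i + ∑ i, dx R i * z i)}
  zero_mem' := ⟨0, zero_mem _, 0, 0, by simp⟩
  add_mem' := by
    rintro _ _ ⟨f, hf, y, z, rfl⟩ ⟨f', hf', y', z', rfl⟩
    refine ⟨f + f', add_mem hf hf', y + y', z + z', ?_⟩
    simp only [Pi.add_apply, smul_add, mul_add, Finset.sum_add_distrib]
    abel
  smul_mem' := by
    rintro c _ ⟨f, hf, y, z, rfl⟩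
    refine ⟨c • f, Subalgebra.smul_mem _ hf c, c • y, c • z, ?_⟩
    simp only [Pi.smul_apply, smul_add, Finset.smul_sum, EvenForm.smul_def, mul_smul_comm]

theorem func_mem_functions (r : R) : (func r : SuperForm n R) ∈ functions n R :=
  Algebra.subset_adjoin (Or.inl ⟨r, rfl⟩)

theorem theta_mem_functions (i : Fin n) : theta R i ∈ functions n R :=
  Algebra.subset_adjoin (Or.inr ⟨i, rfl⟩)

theorem dtheta_mul_mem (i : Fin n) (s : SuperForm n R) :
    dtheta R i * s ∈ functionsModGenerators n R := by
  classical
  refine ⟨0, zero_mem _, Pi.single i s, 0, ?_⟩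
  rw [zero_add, Finset.sum_eq_single_of_mem i (Finset.mem_univ i), Pi.single_eq_same]
  · simp [EvenForm.smul_def]
  · intro j _ h; rw [Pi.single_eq_of_ne h, smul_zero]

theorem dx_mul_mem (i : Fin n) (s : SuperForm n R) :
    dx R i * s ∈ functionsModGenerators n R := by
  classical
  refine ⟨0, zero_mem _, 0, Pi.single i s, ?_⟩
  rw [zero_add, Finset.sum_eq_single_of_mem (f := fun j => dx R j * _) i (Finset.mem_univ i),
    Pi.single_eq_same]
  · simp
  · intro j _ h; rw [Pi.single_eq_of_ne h, mul_zero]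

theorem functionsModGenerators_mul_mem {f s : SuperForm n R} (hf : f ∈ functions n R)
    (hdx : ∀ i, ∃ g, f * dx R i = dx R i * g) (hs : s ∈ functionsModGenerators n R) :
    f * s ∈ functionsModGenerators n R := by
  obtain ⟨f', hf', y, z, rfl⟩ := hs
  rw [mul_add, mul_add, Finset.mul_sum, Finset.mul_sum]
  refine add_mem ⟨f * f', mul_mem hf hf', 0, 0, by simp⟩
    (add_mem (sum_mem fun i _ => ?_) (sum_mem fun i _ => ?_))
  · rw [EvenForm.mul_smul, EvenForm.smul_def]
    exact dtheta_mul_mem i _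
  · obtain ⟨g, hg⟩ := hdx i
    rw [← mul_assoc, hg, mul_assoc]
    exact dx_mul_mem i _

/-- Superforms are generated by superfunctions, `dθ` and `dx`. -/
theorem mem_functionsModGenerators (s : SuperForm n R) : s ∈ functionsModGenerators n R := by
  have hfunc : ∀ (r : R) {s : SuperForm n R}, s ∈ functionsModGenerators n R →
      func r * s ∈ functionsModGenerators n R := fun r s hs =>
    functionsModGenerators_mul_mem (func_mem_functions r)
      (fun i => ⟨func r, even_mul_comm (parity_func r) _⟩) hs
  have hpure : ∀ (a : Fibre n) {s : SuperForm n R}, s ∈ functionsModGenerators n R →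
      pureForm n R (1 ⊗ₜ a) * s ∈ functionsModGenerators n R := by
    intro a s hs
    induction a using MvPolynomial.induction_on with
    | C r =>
      have : (1 : R) ⊗ₜ[ℝ] (MvPolynomial.C r : Fibre n) = r • 1 := by
        rw [Algebra.TensorProduct.one_def, ← TensorProduct.tmul_smul, MvPolynomial.smul_eq_C_mul,
          mul_one]
      rw [this, map_smul, map_one, smul_mul_assoc, one_mul]
      exact Submodule.smul_mem _ r hs
    | add a b ha hb =>
      rw [TensorProduct.tmul_add, map_add, add_mul]
      exact add_mem ha hb
    | mul_X a i _ =>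
      have : (1 : R) ⊗ₜ[ℝ] (a * MvPolynomial.X i : Fibre n) =
          (1 ⊗ₜ MvPolynomial.X i) * (1 ⊗ₜ a) := by
        rw [Algebra.TensorProduct.tmul_mul_tmul, mul_one, mul_comm]
      rw [this, map_mul, ← dtheta_eq_pureForm, mul_assoc]
      exact dtheta_mul_mem i _
  have hodd : ∀ (v : Fin n ⊕ Fin n → Fibre n) {s : SuperForm n R},
      s ∈ functionsModGenerators n R → odd v * s ∈ functionsModGenerators n R := by
    intro v s hs
    have e : (odd v : SuperForm n R) = ∑ k, pureForm n R (1 ⊗ₜ v k) * odd (Pi.single k 1) := by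
      have e1 : v = ∑ k, v k • Pi.single k (1 : Fibre n) := by
        funext k
        simp [Finset.sum_apply, Pi.single_apply]
      nth_rw 1 [e1]
      simp only [odd, map_sum, TensorProduct.tmul_sum, pureForm_tmul,
        Algebra.TensorProduct.tmul_mul_tmul, one_mul]
      refine Finset.sum_congr rfl fun k _ => ?_
      rw [map_smul, Algebra.smul_def]
    rw [e, Finset.sum_mul]
    refine sum_mem fun k _ => ?_
    rw [mul_assoc]
    refine hpure _ ?_
    rcases k with k | k
    · exact functionsModGenerators_mul_mem (theta_mem_functions k)
        (fun i => ⟨- theta R k, by rw [theta, odd_mul, dx, parity_odd]; simp⟩) hs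
    · exact dx_mul_mem k s
  induction s using TensorProduct.induction_on with
  | zero => exact zero_mem _
  | add s t hs ht => exact add_mem hs ht
  | tmul r g =>
    have e : (r ⊗ₜ[ℝ] g : SuperForm n R) = func r * (1 ⊗ₜ[ℝ] g) := by
      simp [func, Algebra.TensorProduct.tmul_mul_tmul]
    rw [e]
    refine hfunc r ?_
    clear e
    induction g using CliffordAlgebra.left_induction with
    | algebraMap a =>
      have := hpure a (s := 1) ⟨1, one_mem _, 0, 0, by simp⟩
      rwa [mul_one, pureForm_tmul] at this
    | add a b ha hb =>
      rw [TensorProduct.tmul_add]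
      exact add_mem ha hb
    | ι_mul a v h =>
      have := hodd v h
      rw [odd, Algebra.TensorProduct.tmul_mul_tmul, mul_one] at this
      exact this

/-- A superform without `dx` that is a combination of the `dθ_i` and `dx^i` is a combination of the
`dθ_i`. -/
theorem mem_combos_dtheta {x : SuperForm n R} (hx : ∀ i, dDx i x = 0) {y z : Fin n → SuperForm n R}
    (h : x = ∑ i, dthetaEven R i • y i + ∑ i, dx R i * z i) :
    x ∈ combos (SuperForm n R) (dthetaEven (n := n) R) Finset.univ := by
  classical
  have key : ∀ (T : Finset (Fin n)) (y z : Fin n → SuperForm n R),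
      x = ∑ i, dthetaEven R i • y i + ∑ i ∈ T, dx R i * z i →
      x ∈ combos (SuperForm n R) (dthetaEven (n := n) R) Finset.univ := by
    intro T
    induction T using Finset.induction_on with
    | empty => exact fun y z h => ⟨y, by rw [h, Finset.sum_empty, add_zero]⟩
    | insert k T hk ih =>
      intro y z h
      have h1 := dDx_dx_mul_self k x
      rw [hx, mul_zero, add_zero] at h1
      refine ih (fun i => dDx k (dx R k * y i)) (fun i => dDx k (dx R k * z i)) ?_
      rw [← h1, h, Finset.sum_insert hk, mul_add, mul_add, dx_mul_dx_mul_self, zero_add, map_add,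
        Finset.mul_sum, Finset.mul_sum, map_sum, map_sum]
      congr 1
      · refine Finset.sum_congr rfl fun i _ => ?_
        rw [EvenForm.mul_smul, EvenForm.smul_def, EvenForm.smul_def, coe_dthetaEven,
          dtheta_eq_pureForm, dDx_pureForm_mul]
      · refine Finset.sum_congr rfl fun i hi => ?_
        have hki : k ≠ i := fun h => hk (h ▸ hi)
        rw [dx_mul_dx_mul, map_neg, dDx_dx_mul hki, neg_neg]
  exact key Finset.univ y z h

/-- Every `ω`-cocycle is cohomologous to a superfunction times `dx^1 ⋯ dx^n`. -/
theorem exists_dxTop_add (hloc : ∀ r, ev r ≠ 0 → IsUnit r) {τ : SuperForm n R}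
    (hτ : omega n R * τ = 0) : ∃ f ∈ functions n R, ∃ σ, τ = dxTop f + omega n R * σ := by
  set t := Kos.top (EvenForm n R) (SuperForm n R) n
    (Kos.split (fun i => leftMul (dx R i)) dDx τ) with ht
  have hδ : ∀ i, dDx i t = 0 := fun i => Kos.δ_top_split
    (fun l m x => contract_contract _ _ x) (fun l x => contract_contract_self _ x) i τ
  obtain ⟨f, hf, y, z, h⟩ := mem_functionsModGenerators t
  obtain ⟨σ, hσ⟩ := Kos.exists_eq_eval_lift_add (f := f) (e := fun i => leftMul (dx R i)) (δ := dDx)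
    (w := dthetaEven R) (fun l m x => dx_mul_dx_mul l m x) (fun l x => dx_mul_dx_mul_self l x)
    (fun l x => dDx_dx_mul_self l x) (fun l m h x => dDx_dx_mul h x)
    dDx_dthetaEven_smul (regularFamily_dtheta hloc)
    (by rw [← omega_mul_eq_sum, hτ])
    (mem_combos_dtheta (fun i => by rw [map_sub, ← ht, hδ, dDx_functions hf, sub_zero])
      (sub_eq_iff_eq_add'.2 h))
  refine ⟨f, hf, σ, ?_⟩
  rw [dxTop, omega_mul_eq_sum, ← eval_leftMul_lift]
  exact hσ

/-- A nonzero superfunction times `dx^1 ⋯ dx^n` is not an `ω`-coboundary. -/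
theorem eq_zero_of_dxTop_eq {f σ : SuperForm n R} (hf : f ∈ functions n R)
    (h : dxTop f = omega n R * σ) : f = 0 := by
  refine functions_eq_zero hf (Kos.mem_combos_of_eval_lift_eq (e := fun i => leftMul (dx R i))
    (δ := dDx) (σ := σ) (fun l m x => dx_mul_dx_mul l m x) (fun l x => dx_mul_dx_mul_self l x)
    (fun l x => dDx_dx_mul_self l x) (fun l m h x => dDx_dx_mul h x)
    dDx_dthetaEven_smul (fun i => dDx_functions hf i) ?_)
  rw [← omega_mul_eq_sum, ← h, eval_leftMul_lift, dxTop]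

end Functions

end OmegaCohomology

end OddSymplectic

namespace OddSymplectic

/-! ### Comparison of the `ω`-cohomology of forms of picture `p` with that of superforms -/

section PForms

variable {n : ℕ} {R : Type*} [CommRing R] [Algebra ℝ R] {ev : R →+* ℝ} {p : ℕ}
  {D : Fin n → R →ₗ[ℝ] R}

theorem PForm.smul_mk (a b : SuperForm n R) (u : DeltaSystem n ev p) :
    a • (PForm.mk b u : PForm n ev p D) = PForm.mk (a * b) u := by
  rw [PForm.mk, PForm.mk, ← map_smul, Finsupp.smul_single, smul_eq_mul]

theorem PForm.mk_add (a b : SuperForm n R) (u : DeltaSystem n ev p) :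
    (PForm.mk (a + b) u : PForm n ev p D) = PForm.mk a u + PForm.mk b u := by
  rw [PForm.mk, Finsupp.single_add, map_add]; rfl

theorem PForm.mk_sub (a b : SuperForm n R) (u : DeltaSystem n ev p) :
    (PForm.mk (a - b) u : PForm n ev p D) = PForm.mk a u - PForm.mk b u := by
  rw [PForm.mk, Finsupp.single_sub, map_sub]; rfl

theorem PForm.mk_eq_zero_of_mem (hloc : ∀ r, ev r ≠ 0 → IsUnit r)
    (hD : ∀ i f g, D i (f * g) = D i f * g + f * D i g) {w : DeltaSystem n ev p} {s : SuperForm n R}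
    (hs : s ∈ combos (SuperForm n R) w.even Finset.univ) : (PForm.mk s w : PForm n ev p D) = 0 := by
  refine (Submodule.Quotient.mk_eq_zero _).2 ?_
  rw [relations_eq hloc hD]
  exact single_combos_mem hs

theorem PForm.mk_eq_mk (hloc : ∀ r, ev r ≠ 0 → IsUnit r)
    (hD : ∀ i f g, D i (f * g) = D i f * g + f * D i g) {u v : DeltaSystem n ev p}
    {H : Matrix (Fin p) (Fin p) (EvenForm n R)} (hH : v.even = H.mulVec u.even)
    (a : SuperForm n R) : (PForm.mk a u : PForm n ev p D) = PForm.mk (H.det • a) v := by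
  refine (Submodule.Quotient.eq _).2 ?_
  rw [relations_eq hloc hD]
  exact single_sub_single_mem hH a

/-- Every form of picture `p` is a single fraction. -/
theorem PForm.exists_eq_mk (hloc : ∀ r, ev r ≠ 0 → IsUnit r)
    (hD : ∀ i f g, D i (f * g) = D i f * g + f * D i g) (m : PForm n ev p D)
    (u : DeltaSystem n ev p) : ∃ w : DeltaSystem n ev p, w.IsPure ∧ w.Refines u ∧
      ∃ β, m = PForm.mk β w := by
  obtain ⟨f, rfl⟩ := Submodule.mkQ_surjective _ m
  obtain ⟨w, hw, hwu, h⟩ := exists_denominator f u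
  refine ⟨w, hw, hwu, numerator w f, (Submodule.Quotient.eq _).2 ?_⟩
  rw [relations_eq hloc hD]
  exact h w (.refl w)

/-- A fraction vanishes only if its numerator vanishes over a finer denominator. -/
theorem PForm.exists_of_mk_eq_zero (hloc : ∀ r, ev r ≠ 0 → IsUnit r)
    (hD : ∀ i f g, D i (f * g) = D i f * g + f * D i g) {β : SuperForm n R}
    {w : DeltaSystem n ev p} (h : (PForm.mk β w : PForm n ev p D) = 0) :
    ∃ w' : DeltaSystem n ev p, w'.IsPure ∧ ∃ K : Matrix (Fin p) (Fin p) (EvenForm n R),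
      w'.even = K.mulVec w.even ∧ K.det • β ∈ combos (SuperForm n R) w'.even Finset.univ := by
  have h1 := (Submodule.Quotient.mk_eq_zero _).1 h
  rw [relations_eq hloc hD] at h1
  obtain ⟨w', hw', ⟨K, hK⟩, h2⟩ := relationSpan_le hloc h1 w
  have h3 := h2 w' hw' (.refl w')
  rw [numerator_single, residue_coef_smul hloc hw' hK] at h3
  exact ⟨w', hw', K, hK, residue_eq_zero.1 h3⟩

/-- `Transgresses m τ` says that `m = β δ(u)` where `β` is the top coefficient and `τ` the constant
term of a cocycle of the Koszul complex of `ω` and the family `u`. This relation induces an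
isomorphism between the `ω`-cohomology of forms of picture `p` and that of superforms. -/
def Transgresses (m : PForm n ev p D) (τ : SuperForm n R) : Prop :=
  ∃ (u : DeltaSystem n ev p) (z : Kos (SuperForm n R) p),
    Kos.Q (leftMul (omega n R)) u.even z = 0 ∧
    m = PForm.mk (Kos.top (EvenForm n R) (SuperForm n R) p z) u ∧
    Kos.const (EvenForm n R) (SuperForm n R) p z = τ

theorem leftMul_omega_sq (s : SuperForm n R) :
    leftMul (omega n R) (leftMul (omega n R) s) = 0 := omega_mul_omega_mul s

/-- Passing to a finer denominator does not change the form that a cocycle represents. -/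
theorem Kos.transport_spec (hloc : ∀ r, ev r ≠ 0 → IsUnit r)
    (hD : ∀ i f g, D i (f * g) = D i f * g + f * D i g) {u w : DeltaSystem n ev p}
    {H : Matrix (Fin p) (Fin p) (EvenForm n R)} (hH : w.even = H.mulVec u.even)
    {z : Kos (SuperForm n R) p} (hz : Kos.Q (leftMul (omega n R)) u.even z = 0) :
    Kos.Q (leftMul (omega n R)) w.even (Kos.transport H z) = 0 ∧
    (PForm.mk (Kos.top (EvenForm n R) (SuperForm n R) p z) u : PForm n ev p D) =
      PForm.mk (Kos.top (EvenForm n R) (SuperForm n R) p (Kos.transport H z)) w := by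
  constructor
  · rw [hH, Kos.Q_transport, hz, map_zero]
  · rw [Kos.top_transport, PForm.mk_eq_mk hloc hD hH]

theorem Transgresses.add (hloc : ∀ r, ev r ≠ 0 → IsUnit r)
    (hD : ∀ i f g, D i (f * g) = D i f * g + f * D i g) {m m' : PForm n ev p D}
    {τ τ' : SuperForm n R} (h : Transgresses m τ) (h' : Transgresses m' τ') :
    Transgresses (m + m') (τ + τ') := by
  obtain ⟨u, z, hz, rfl, rfl⟩ := h
  obtain ⟨u', z', hz', rfl, rfl⟩ := h'
  obtain ⟨w, -, ⟨H, hH⟩, ⟨H', hH'⟩⟩ := u.exists_common_refinement u'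
  obtain ⟨h1, h2⟩ := Kos.transport_spec (D := D) hloc hD hH hz
  obtain ⟨h1', h2'⟩ := Kos.transport_spec (D := D) hloc hD hH' hz'
  refine ⟨w, Kos.transport H z + Kos.transport H' z', ?_, ?_, ?_⟩
  · rw [map_add, h1, h1', add_zero]
  · rw [h2, h2', map_add, PForm.mk_add]
  · rw [map_add, Kos.const_transport, Kos.const_transport]

/-- The action of superforms on the Koszul complex, normalized so that the top coefficient is
multiplied by `f`; moving `f` past the `p` odd variables twists the constant term by the `p`-th power
of the parity involution. -/
noncomputable def Kos.leftAction (f : SuperForm n R) : ∀ p, Kos (SuperForm n R) p → Kos (SuperForm n R) p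
  | 0, s => leftMul f s
  | p + 1, z => Kos.mk (Kos.leftAction (parity f) p z.1) (Kos.leftAction f p z.2)

theorem Kos.leftAction_mk (f : SuperForm n R) (a b : Kos (SuperForm n R) p) :
    Kos.leftAction f (p + 1) (Kos.mk a b) =
      Kos.mk (Kos.leftAction (parity f) p a) (Kos.leftAction f p b) := rfl

theorem Kos.leftAction_smul_sub (f : SuperForm n R) (c : EvenForm n R) (a b : Kos (SuperForm n R) p) :
    Kos.leftAction f p (c • a - b) = c • Kos.leftAction f p a - Kos.leftAction f p b := by
  induction p generalizing f with
  | zero =>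
    exact ((leftMul f).map_sub _ _).trans
      (congrArg₂ (· - ·) ((leftMul f).map_smul c a) rfl)
  | succ p ih =>
    obtain ⟨a, a', rfl⟩ := Kos.exists_eq_mk a
    obtain ⟨b, b', rfl⟩ := Kos.exists_eq_mk b
    rw [Kos.smul_mk, Kos.mk_sub, Kos.leftAction_mk, ih, ih, Kos.leftAction_mk, Kos.leftAction_mk,
      Kos.smul_mk, Kos.mk_sub]

theorem Kos.leftAction_zero (f : SuperForm n R) : Kos.leftAction f p 0 = 0 := by
  have := Kos.leftAction_smul_sub f (1 : EvenForm n R) (0 : Kos (SuperForm n R) p) 0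
  rwa [smul_zero, sub_zero, one_smul, sub_self] at this

theorem Kos.Q_leftAction (f : SuperForm n R) (w : Fin p → EvenForm n R) (z : Kos (SuperForm n R) p) :
    Kos.Q (leftMul (omega n R)) w (Kos.leftAction f p z) =
      Kos.leftAction (parity f) p (Kos.Q (leftMul (omega n R)) w z) := by
  induction p generalizing f with
  | zero =>
    have h : ∀ s : SuperForm n R, omega n R * (f * s) = parity f * (omega n R * s) := fun s => by
      rw [← mul_assoc, omega_mul, mul_assoc]
    exact h z
  | succ p ih =>
    obtain ⟨a, b, rfl⟩ := Kos.exists_eq_mk z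
    rw [Kos.leftAction_mk, Kos.Q_mk, Kos.Q_mk, Kos.leftAction_mk, ih, ih, parity_parity,
      Kos.leftAction_smul_sub]

theorem Kos.top_leftAction (f : SuperForm n R) (z : Kos (SuperForm n R) p) :
    Kos.top (EvenForm n R) (SuperForm n R) p (Kos.leftAction f p z) =
      f * Kos.top (EvenForm n R) (SuperForm n R) p z := by
  induction p generalizing f with
  | zero => rfl
  | succ p ih => exact ih f z.2

theorem Kos.const_leftAction (f : SuperForm n R) (z : Kos (SuperForm n R) p) :
    Kos.const (EvenForm n R) (SuperForm n R) p (Kos.leftAction f p z) =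
      (parity^[p] f) * Kos.const (EvenForm n R) (SuperForm n R) p z := by
  induction p generalizing f with
  | zero => rfl
  | succ p ih => exact ih (parity f) z.1

theorem Transgresses.smul {m : PForm n ev p D} {τ : SuperForm n R} (h : Transgresses m τ)
    (f : SuperForm n R) : Transgresses (f • m) ((parity^[p] f) * τ) := by
  obtain ⟨u, z, hz, rfl, rfl⟩ := h
  exact ⟨u, Kos.leftAction f p z, by rw [Kos.Q_leftAction, hz, Kos.leftAction_zero],
    by rw [PForm.smul_mk, Kos.top_leftAction], Kos.const_leftAction f z⟩

theorem Transgresses.sub (hloc : ∀ r, ev r ≠ 0 → IsUnit r)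
    (hD : ∀ i f g, D i (f * g) = D i f * g + f * D i g) {m m' : PForm n ev p D}
    {τ τ' : SuperForm n R} (h : Transgresses m τ) (h' : Transgresses m' τ') :
    Transgresses (m - m') (τ - τ') := by
  have h1 := h'.smul (-1)
  have h2 : (parity^[p] (-1 : SuperForm n R)) = -1 := by
    refine Function.iterate_fixed ?_ p
    rw [map_neg, map_one]
  rw [h2, neg_one_smul, neg_one_mul] at h1
  rw [sub_eq_add_neg, sub_eq_add_neg]
  exact h.add hloc hD h1

theorem Transgresses.sum (hloc : ∀ r, ev r ≠ 0 → IsUnit r)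
    (hD : ∀ i f g, D i (f * g) = D i f * g + f * D i g) {ι : Type*} (s : Finset ι) (hs : s.Nonempty)
    {m : ι → PForm n ev p D} {τ : ι → SuperForm n R} (h : ∀ i ∈ s, Transgresses (m i) (τ i)) :
    Transgresses (∑ i ∈ s, m i) (∑ i ∈ s, τ i) := by
  classical
  induction hs using Finset.Nonempty.cons_induction with
  | singleton a => simpa using h a
  | cons a s ha hs ih =>
    rw [Finset.sum_cons, Finset.sum_cons]
    exact (h a (Finset.mem_cons_self a s)).add hloc hD
      (ih fun i hi => h i (Finset.mem_cons_of_mem hi))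

theorem Transgresses.omega_mul_eq_zero {m : PForm n ev p D} {τ : SuperForm n R}
    (h : Transgresses m τ) : omega n R * τ = 0 := by
  obtain ⟨u, z, hz, -, rfl⟩ := h
  have := Kos.const_Q (leftMul (omega n R)) u.even z
  rwa [hz, map_zero, eq_comm] at this

theorem Transgresses.omega_smul_eq_zero (hloc : ∀ r, ev r ≠ 0 → IsUnit r)
    (hD : ∀ i f g, D i (f * g) = D i f * g + f * D i g)
    {m : PForm n ev p D} {τ : SuperForm n R} (h : Transgresses m τ) : omega n R • m = 0 := by
  obtain ⟨u, z, hz, rfl, -⟩ := h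
  rw [PForm.smul_mk]
  refine PForm.mk_eq_zero_of_mem hloc hD ?_
  have h1 := Kos.top_Q (leftMul (omega n R)) u.even z
  rw [hz, map_zero, zero_sub, neg_mem_iff] at h1
  have h2 := Submodule.smul_mem _ ((-1 : EvenForm n R) ^ p) h1
  rwa [smul_smul, ← mul_pow, neg_one_mul, neg_neg, one_pow, one_smul] at h2

/-- Every `ω`-cocycle transgresses. -/
theorem exists_transgresses (hloc : ∀ r, ev r ≠ 0 → IsUnit r)
    (hD : ∀ i f g, D i (f * g) = D i f * g + f * D i g) (u : DeltaSystem n ev p)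
    {m : PForm n ev p D} (h : omega n R • m = 0) : ∃ τ, Transgresses m τ := by
  obtain ⟨w, -, -, β, rfl⟩ := PForm.exists_eq_mk hloc hD m u
  rw [PForm.smul_mk] at h
  obtain ⟨w', hw', K, hK, hmem⟩ := PForm.exists_of_mk_eq_zero hloc hD h
  obtain ⟨z, hz, tz⟩ := Kos.exists_Q_eq_zero (leftMul_omega_sq (n := n) (R := R))
    (hw'.regularFamily hloc) (K.det • β) (by rwa [map_smul])
  exact ⟨_, w', z, hz, by rw [tz, PForm.mk_eq_mk hloc hD hK], rfl⟩

/-- Coboundaries transgress to coboundaries; with `m = 0`, the transgression is well defined in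
cohomology. -/
theorem Transgresses.exists_eq_omega_mul (hloc : ∀ r, ev r ≠ 0 → IsUnit r)
    (hD : ∀ i f g, D i (f * g) = D i f * g + f * D i g)
    {m : PForm n ev p D} {τ : SuperForm n R} (h : Transgresses (omega n R • m) τ) :
    ∃ η, τ = omega n R * η := by
  obtain ⟨u, z, hz, h1, rfl⟩ := h
  obtain ⟨w, -, ⟨H, hH⟩, β, rfl⟩ := PForm.exists_eq_mk hloc hD m u
  obtain ⟨hz', h2⟩ := Kos.transport_spec (D := D) hloc hD hH hz
  rw [PForm.smul_mk, h2, eq_comm, ← sub_eq_zero, ← PForm.mk_sub] at h1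
  obtain ⟨w', hw', K, hK, hmem⟩ := PForm.exists_of_mk_eq_zero hloc hD h1
  obtain ⟨hz'', -⟩ := Kos.transport_spec (D := D) hloc hD hK hz'
  obtain ⟨η, hη⟩ := Kos.const_mem_range (leftMul_omega_sq (n := n) (R := R))
    (hw'.regularFamily hloc) hz'' (γ := K.det • β) (by
      rwa [Kos.top_transport, map_smul, leftMul_apply, ← smul_sub])
  rw [Kos.const_transport, Kos.const_transport] at hη
  exact ⟨η, hη⟩

theorem dDx_omega_mul (i : Fin n) (s : SuperForm n R) :
    dDx i (omega n R * s) + omega n R * dDx i s = dtheta R i * s := by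
  simp only [omega_mul_eq_sum, map_sum, dDx_dthetaEven_smul, leftMul_apply,
    ← Finset.sum_add_distrib, ← smul_add]
  rw [Finset.sum_eq_single_of_mem i (Finset.mem_univ i), dDx_dx_mul_self, EvenForm.smul_def,
    coe_dthetaEven]
  intro j _ h
  rw [dDx_dx_mul h.symm, neg_add_cancel, smul_zero]

/-- Multiplication by a product of linear forms in the `dθ_i` is null-homotopic for `ω`: if `dθ_i` is
the commutator of `ω` and `∂/∂(dx^i)`, then `∑ b v_i dθ_i` is that of `ω` and `∑ b v_i ∂/∂(dx^i)`. -/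
theorem exists_homotopy (v : Fin n → R) (b : R ⊗[ℝ] Fibre n) : ∃ τ : SuperForm n R →+ SuperForm n R,
    (∀ x, τ (omega n R * x) + omega n R * τ x = pureForm n R (linForm v * b) * x) ∧
    ∀ (a : R ⊗[ℝ] Fibre n) x, τ (pureForm n R a * x) = pureForm n R a * τ x := by
  refine ⟨∑ i, (AddMonoidHom.mulLeft (pureForm n R (b * v i ⊗ₜ 1))).comp (dDx i), fun x => ?_,
    fun a x => ?_⟩
  · simp only [AddMonoidHom.finsetSum_apply, AddMonoidHom.comp_apply, AddMonoidHom.coe_mulLeft,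
      Finset.mul_sum, ← Finset.sum_add_distrib]
    have h : ∀ (a : R ⊗[ℝ] Fibre n) (s : SuperForm n R),
        omega n R * (pureForm n R a * s) = pureForm n R a * (omega n R * s) := fun a s => by
      rw [← mul_assoc, ← even_mul_comm (parity_pureForm a), mul_assoc]
    rw [linForm, Finset.sum_mul, map_sum, Finset.sum_mul]
    refine Finset.sum_congr rfl fun i _ => ?_
    rw [h, ← mul_add, dDx_omega_mul, dtheta_eq_pureForm, ← mul_assoc, ← map_mul, mul_assoc,
      Algebra.TensorProduct.tmul_mul_tmul, mul_one, one_mul, mul_comm b]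
  · simp only [AddMonoidHom.finsetSum_apply, AddMonoidHom.comp_apply, AddMonoidHom.coe_mulLeft,
      Finset.mul_sum, dDx_pureForm_mul]
    refine Finset.sum_congr rfl fun i _ => ?_
    rw [← mul_assoc, ← map_mul, mul_comm, map_mul, mul_assoc]

/-- Only coboundaries transgress to coboundaries. Over a pure denominator `w` the null-homotopies of
its members make the cocycle exact after `w` is replaced by the squares of its members, which
changes the numerator by the factor `∏ w_j` and hence not the form. -/
theorem Transgresses.exists_eq_omega_smul (hloc : ∀ r, ev r ≠ 0 → IsUnit r)
    (hD : ∀ i f g, D i (f * g) = D i f * g + f * D i g)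
    {m : PForm n ev p D} {η : SuperForm n R} (h : Transgresses m (omega n R * η)) :
    ∃ m', m = omega n R • m' := by
  obtain ⟨u, z, hz, rfl, hη⟩ := h
  obtain ⟨w, hw, ⟨H, hH⟩, -⟩ := u.exists_common_refinement u
  obtain ⟨hz', h2⟩ := Kos.transport_spec (D := D) hloc hD hH hz
  rw [← Kos.const_transport H] at hη
  rw [h2]
  generalize Kos.transport H z = z at hz' hη
  have hτ : ∀ j, ∃ τ : SuperForm n R →+ SuperForm n R,
      (∀ x, τ (omega n R * x) + omega n R * τ x = w.even j • x) ∧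
      ∀ (a : R ⊗[ℝ] Fibre n) x, τ (pureForm n R a * x) = pureForm n R a * τ x := by
    intro j
    obtain ⟨-, L, hL, -⟩ := w.2
    obtain ⟨v, hv⟩ := Multiset.exists_mem_of_ne_zero (hL j).1
    obtain ⟨L', hL'⟩ := Multiset.exists_cons_of_mem hv
    obtain ⟨τ, h1, h2⟩ := exists_homotopy v ((L'.map linForm).prod)
    refine ⟨τ, fun x => ?_, h2⟩
    rw [h1, EvenForm.smul_def, DeltaSystem.coe_even, hw j, (hL j).2, hL', Multiset.map_cons,
      Multiset.prod_cons]
  choose τ h1 h3 using hτ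
  obtain ⟨y, hy⟩ := Kos.exists_scale_eq_Q (q := leftMul (omega n R)) τ h1
    (fun j k x => by rw [EvenForm.smul_def, EvenForm.smul_def, DeltaSystem.coe_even, hw k, h3])
    hz' hη
  have hsq : w.sq.even = (Matrix.diagonal w.even).mulVec w.even := by
    funext j
    rw [Matrix.mulVec_diagonal, DeltaSystem.sq_even]
  refine ⟨PForm.mk ((-1 : EvenForm n R) ^ p • Kos.top (EvenForm n R) (SuperForm n R) p y) w.sq, ?_⟩
  rw [PForm.mk_eq_mk hloc hD hsq, Matrix.det_diagonal, ← Kos.top_scale, hy, PForm.smul_mk,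
    ← sub_eq_zero, ← PForm.mk_sub]
  refine PForm.mk_eq_zero_of_mem hloc hD ?_
  rw [EvenForm.mul_smul]
  exact Kos.top_Q (leftMul (omega n R)) w.sq.even y

end PForms

end OddSymplectic

namespace OddSymplectic

/-! ### Products of one-forms and the transgression of a generator -/

section Generator

variable {n : ℕ} {R : Type*} [CommRing R] [Algebra ℝ R] {ev : R →+* ℝ} {p : ℕ}
  {D : Fin n → R →ₗ[ℝ] R}

theorem list_prod_mul {l : List (SuperForm n R)} (hl : ∀ z ∈ l, parity z = - z)
    (a : SuperForm n R) : l.prod * a = parity^[l.length] a * l.prod := by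
  induction l generalizing a with
  | nil => simp
  | cons z l ih =>
    rw [List.prod_cons, mul_assoc, ih (fun z hz => hl z (List.mem_cons_of_mem _ hz)), ← mul_assoc,
      odd_form_mul (hl z List.mem_cons_self), mul_assoc, List.length_cons,
      Function.iterate_succ_apply']

theorem parity_list_prod {l : List (SuperForm n R)} (hl : ∀ z ∈ l, parity z = - z) :
    parity l.prod = (-1 : ℝ) ^ l.length • l.prod := by
  induction l with
  | nil => simp
  | cons z l ih =>
    rw [List.prod_cons, map_mul, ih (fun z hz => hl z (List.mem_cons_of_mem _ hz)),
      hl z List.mem_cons_self, List.length_cons, pow_succ, mul_smul_comm, neg_mul, mul_neg_one,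
      neg_smul, smul_neg]

theorem parity_iterate_smul (k : ℕ) {c : ℝ} {a : SuperForm n R} (h : parity a = c • a) :
    parity^[k] a = c ^ k • a := by
  induction k with
  | zero => simp
  | succ k ih => rw [Function.iterate_succ_apply', ih, map_smul, h, smul_smul, pow_succ]

theorem func_mul (a b : R) : (func (a * b) : SuperForm n R) = func a * func b := by
  simp [func, Algebra.TensorProduct.tmul_mul_tmul]

theorem func_one : (func 1 : SuperForm n R) = 1 := rfl

theorem smul_eq_func_mul (r : R) (s : SuperForm n R) : r • s = func r * s := by
  rw [Algebra.smul_def]; rfl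

theorem func_mul_comm (r : R) (s : SuperForm n R) : func r * s = s * func r :=
  even_mul_comm (parity_func r) s

/-- The one-form `∑ v_i dx^i`. -/
noncomputable def linDx : (Fin n → R) →ₗ[R] SuperForm n R where
  toFun v := ∑ i, v i • dx R i
  map_add' v w := by simp only [Pi.add_apply, add_smul, Finset.sum_add_distrib]
  map_smul' c v := by
    simp only [Pi.smul_apply, smul_eq_mul, mul_smul, Finset.smul_sum, RingHom.id_apply]

theorem linDx_apply (v : Fin n → R) : linDx v = ∑ i, func (v i) * dx R i := by
  simp only [← smul_eq_func_mul]; rfl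

theorem linDx_single (i : Fin n) : linDx (Pi.single i 1) = dx R i := by
  rw [linDx_apply, Finset.sum_eq_single_of_mem i (Finset.mem_univ i), Pi.single_eq_same, func_one,
    one_mul]
  intro j _ h
  rw [Pi.single_eq_of_ne h, func, TensorProduct.zero_tmul, zero_mul]

theorem parity_dx (i : Fin n) : parity (dx R i) = - dx R i := parity_odd _

theorem parity_linDx (v : Fin n → R) : parity (linDx v) = - linDx v := by
  simp only [linDx_apply, map_sum, map_mul, parity_func, parity_dx, mul_neg,
    Finset.sum_neg_distrib]

theorem linDx_mul_linDx (v w : Fin n → R) : linDx v * linDx w = - (linDx w * linDx v) := by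
  rw [odd_form_mul (parity_linDx v), parity_linDx, neg_mul]

theorem eq_zero_of_eq_neg {s : SuperForm n R} (h : s = - s) : s = 0 := by
  rw [eq_neg_iff_add_eq_zero, ← two_smul ℝ, smul_eq_zero_iff_right two_ne_zero] at h
  exact h

theorem linDx_mul_self (v : Fin n → R) : linDx v * linDx v = 0 :=
  eq_zero_of_eq_neg (linDx_mul_linDx v v)

/-- The product of `n` one-forms is their determinant times `dx^1 ⋯ dx^n`. -/
theorem prod_linDx (A : Matrix (Fin n) (Fin n) R) :
    (List.ofFn fun j => linDx (A j)).prod = func A.det * (List.ofFn (dx R)).prod := by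
  let L := ExteriorAlgebra.lift R ⟨linDx (n := n) (R := R), linDx_mul_self⟩
  have h : ∀ v : Fin n → Fin n → R,
      L.toLinearMap.compAlternatingMap (ExteriorAlgebra.ιMulti R n) v =
        (List.ofFn fun j => linDx (v j)).prod := fun v => by
    rw [LinearMap.compAlternatingMap_apply, ExteriorAlgebra.ιMulti_apply,
      AlgHom.toLinearMap_apply, map_list_prod, List.map_ofFn]
    congr 2
    funext j
    exact ExteriorAlgebra.lift_ι_apply R _ _ _
  have h1 := alternating_eq_det_smul
    (L.toLinearMap.compAlternatingMap (ExteriorAlgebra.ιMulti R n)) A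
  rw [h, h, smul_eq_func_mul] at h1
  simpa only [linDx_single] using h1

theorem prod_linDx_perm (A : Matrix (Fin n) (Fin n) R) (σ : Equiv.Perm (Fin n)) :
    (List.ofFn fun j => linDx (A (σ j))).prod =
      (Equiv.Perm.sign σ : ℤ) • (func A.det * (List.ofFn (dx R)).prod) := by
  have h := prod_linDx (A.submatrix σ id)
  rw [Matrix.det_permute] at h
  refine h.trans ?_
  rw [← smul_eq_func_mul, ← smul_eq_func_mul, mul_smul]
  exact Int.cast_smul_eq_zsmul R _ _

theorem prod_leftMul {k : ℕ} (y : Fin k → SuperForm n R) (g : SuperForm n R) :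
    (List.ofFn fun l => leftMul (y l)).prod g = (List.ofFn y).prod * g := by
  induction k with
  | zero => simp
  | succ k ih =>
    rw [List.ofFn_succ, List.ofFn_succ, List.prod_cons, List.prod_cons, Module.End.mul_apply, ih,
      leftMul_apply, mul_assoc]

theorem Transgresses.zsmul {m : PForm n ev p D} {τ : SuperForm n R} (h : Transgresses m τ)
    (k : ℤ) : Transgresses (k • m) (k • τ) := by
  have h1 := h.smul (k : SuperForm n R)
  have h2 : (parity^[p] (k : SuperForm n R)) = k := Function.iterate_fixed (map_intCast _ k) p
  rwa [h2, Int.cast_smul_eq_zsmul, ← zsmul_eq_mul] at h1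

/-- If `ω = ∑ y_j v_j`, then a product of some of the `y_j` and the deltas in the complementary `v_j`
transgress to the product of all the `y_j`. The cocycle that shows this is the product of the
`y_j + e_j`, as `ω + ∑ v_j e_j` is the sum of the `v_j (y_j + e_j)`. -/
theorem transgresses_prod (hp : p ≤ n) {y : Fin n → Fin n → R} {v : Fin n → EvenForm n R}
    (homega : omega n R = ∑ j, linDx (y j) * v j) (σ : Equiv.Perm (Fin n)) {u : DeltaSystem n ev p}
    (hu : ∀ k : Fin p, u.even k = v (σ (Fin.cast (Nat.sub_add_cancel hp) (Fin.natAdd (n - p) k)))) :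
    Transgresses (PForm.mk (List.ofFn fun k : Fin (n - p) =>
      linDx (y (σ (Fin.castLE (Nat.sub_le n p) k)))).prod u : PForm n ev p D)
      ((((-1 : ℝ) ^ (n - p)) ^ p) • (List.ofFn fun j => linDx (y (σ j))).prod) := by
  set g := (List.ofFn fun k : Fin (n - p) =>
    linDx (y (σ (Fin.castLE (Nat.sub_le n p) k)))).prod with hg
  -- the remaining one-forms, which are paired with the members of `u`
  set s : Fin p → Fin n → R := fun k =>
    y (σ (Fin.cast (Nat.sub_add_cancel hp) (Fin.natAdd (n - p) k))) with hs
  have hanti : ∀ (a b : Fin n → R) x, leftMul (linDx a) (leftMul (linDx b) x) =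
      - leftMul (linDx b) (leftMul (linDx a) x) := fun a b x => by
    simp only [leftMul_apply, ← mul_assoc]
    rw [linDx_mul_linDx, neg_mul]
  have hself : ∀ (a : Fin n → R) x, leftMul (linDx a) (leftMul (linDx a) x) = 0 := fun a x => by
    simp only [leftMul_apply, ← mul_assoc, linDx_mul_self, zero_mul]
  -- the part of `ω` that annihilates `g`
  set q : SuperForm n R →ₗ[EvenForm n R] SuperForm n R := leftMul (∑ k : Fin (n - p),
    linDx (y (σ (Fin.castLE (Nat.sub_le n p) k))) * v (σ (Fin.castLE (Nat.sub_le n p) k))) with hqdef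
  have hq : ∀ x, q x = ∑ k : Fin (n - p), v (σ (Fin.castLE (Nat.sub_le n p) k)) •
      leftMul (linDx (y (σ (Fin.castLE (Nat.sub_le n p) k)))) x := fun x => by
    rw [hqdef, leftMul_apply, Finset.sum_mul]
    refine Finset.sum_congr rfl fun k _ => ?_
    rw [leftMul_apply, EvenForm.smul_def, ← EvenForm.coe_mul_comm, mul_assoc]
  have hω : ∀ x, leftMul (omega n R) x = q x + ∑ k, u.even k • leftMul (linDx (s k)) x := by
    intro x
    have e1 : leftMul (omega n R) x = ∑ j, v (σ j) • leftMul (linDx (y (σ j))) x := by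
      rw [Equiv.sum_comp σ fun j => v j • leftMul (linDx (y j)) x, leftMul_apply, homega,
        Finset.sum_mul]
      refine Finset.sum_congr rfl fun j _ => ?_
      rw [leftMul_apply, EvenForm.smul_def, ← EvenForm.coe_mul_comm, mul_assoc]
    rw [e1, hq, ← Equiv.sum_comp (finCongr (Nat.sub_add_cancel hp)), Fin.sum_univ_add]
    simp only [hu]
    rfl
  refine ⟨u, Kos.shifted g fun k => leftMul (linDx (s k)), ?_, by rw [Kos.top_shifted], ?_⟩
  · refine Kos.Q_shifted (q := q) ?_ (fun l x => ?_) (fun l m x => hanti _ _ x)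
      (fun l x => hself _ x) _ hω
    · rw [hq]
      refine Finset.sum_eq_zero fun k _ => ?_
      rw [leftMul_apply, hg, mul_list_prod_eq_zero (linDx_mul_self _), smul_zero]
      · intro z hz
        obtain ⟨j, rfl⟩ := (List.mem_ofFn' _ _).1 hz
        exact linDx_mul_linDx _ _
      · exact (List.mem_ofFn' _ _).2 ⟨k, rfl⟩
    · rw [hq, hq, map_sum, ← Finset.sum_neg_distrib]
      refine Finset.sum_congr rfl fun k _ => ?_
      rw [hanti, map_smul, smul_neg]
  · rw [Kos.const_shifted, prod_leftMul, list_prod_mul, List.length_ofFn]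
    · have h1 : parity g = (-1 : ℝ) ^ (n - p) • g := by
        have := parity_list_prod (l := List.ofFn fun k : Fin (n - p) =>
          linDx (y (σ (Fin.castLE (Nat.sub_le n p) k)))) fun z hz => by
            obtain ⟨j, rfl⟩ := (List.mem_ofFn' _ _).1 hz
            exact parity_linDx _
        rwa [List.length_ofFn] at this
      rw [parity_iterate_smul p h1, smul_mul_assoc, hg, ← List.prod_append,
        List.ofFn_congr (Nat.sub_add_cancel hp).symm fun j => linDx (y (σ j)), List.ofFn_add]
      rfl
    · intro z hz
      obtain ⟨j, rfl⟩ := (List.mem_ofFn' _ _).1 hz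
      exact parity_linDx _

end Generator

end OddSymplectic

namespace OddSymplectic

/-! ### The first page and its differential -/

section FirstPage

variable {n : ℕ} {R : Type*} [CommRing R] [Algebra ℝ R] {ev : R →+* ℝ} {p : ℕ}
  {D : Fin n → R →ₗ[ℝ] R}

variable (n p) in
/-- The constant by which the antisymmetrized form of picture `p` differs from `dy^1 ⋯ dy^n` under
transgression: `n!` equal terms, and the sign of the permutation that exchanges the two blocks. -/
noncomputable def generatorConst : ℝ := n.factorial * ((-1 : ℝ) ^ (n - p)) ^ p

theorem generatorConst_ne_zero : generatorConst n p ≠ 0 :=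
  mul_ne_zero (by exact_mod_cast n.factorial_ne_zero) (pow_ne_zero _ (pow_ne_zero _ (by norm_num)))

/-- The antisymmetrized form built from `n` one-forms `y_j` and their partners `v_j` transgresses to a
multiple of `det y · dx^1 ⋯ dx^n`: all `n!` terms contribute equally. -/
theorem transgresses_sum (hloc : ∀ r, ev r ≠ 0 → IsUnit r)
    (hD : ∀ i f g, D i (f * g) = D i f * g + f * D i g) (hp : p ≤ n)
    {y : Matrix (Fin n) (Fin n) R} {v : Fin n → EvenForm n R}
    (homega : omega n R = ∑ j, linDx (y j) * v j) {u : Equiv.Perm (Fin n) → DeltaSystem n ev p}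
    (hu : ∀ (σ : Equiv.Perm (Fin n)) (k : Fin p),
      (u σ).even k = v (σ (Fin.cast (Nat.sub_add_cancel hp) (Fin.natAdd (n - p) k)))) :
    Transgresses (∑ σ : Equiv.Perm (Fin n), (Equiv.Perm.sign σ : ℤ) •
      (PForm.mk (List.ofFn fun k : Fin (n - p) =>
        linDx (y (σ (Fin.castLE (Nat.sub_le n p) k)))).prod (u σ) : PForm n ev p D))
      (dxTop (func (algebraMap ℝ R (generatorConst n p) * y.det))) := by
  have h := Transgresses.sum hloc hD Finset.univ (Finset.univ_nonempty (α := Equiv.Perm (Fin n)))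
    fun σ _ => (transgresses_prod (D := D) hp homega σ (hu σ)).zsmul (Equiv.Perm.sign σ : ℤ)
  convert h using 1
  have h1 : ∀ σ : Equiv.Perm (Fin n), (Equiv.Perm.sign σ : ℤ) • (((-1 : ℝ) ^ (n - p)) ^ p •
      (List.ofFn fun j => linDx (y (σ j))).prod) =
      ((-1 : ℝ) ^ (n - p)) ^ p • (func y.det * (List.ofFn (dx R)).prod) := by
    intro σ
    rw [prod_linDx_perm, smul_comm, smul_smul]
    have : (Equiv.Perm.sign σ : ℤ) * (Equiv.Perm.sign σ : ℤ) = 1 := by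
      rw [← Units.val_mul, Int.units_mul_self, Units.val_one]
    rw [this, one_smul]
  rw [Finset.sum_congr rfl fun σ _ => h1 σ, Finset.sum_const, Finset.card_univ, Fintype.card_perm,
    Fintype.card_fin, dxTop, ← func_mul_comm, func_mul, mul_assoc, generatorConst]
  have h2 : ∀ (c : ℝ) (s : SuperForm n R), func (algebraMap ℝ R c) * s = c • s := fun c s => by
    rw [← smul_eq_func_mul, algebraMap_smul]
  rw [h2, ← Nat.cast_smul_eq_nsmul ℝ, smul_smul]

theorem mul_dxTop (f g : SuperForm n R) : f * dxTop g = dxTop (parity^[n] f * g) := by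
  have h := list_prod_mul (l := List.ofFn (dx R)) (fun z hz => by
    obtain ⟨j, rfl⟩ := (List.mem_ofFn' _ _).1 hz
    exact parity_dx _) (parity^[n] f)
  rw [List.length_ofFn, ← Function.iterate_add_apply, ← two_mul, Function.iterate_mul] at h
  have h1 : (parity^[2])^[n] f = f := Function.iterate_fixed (parity_parity f) n
  rw [h1] at h
  rw [dxTop, dxTop, ← mul_assoc, ← mul_assoc, h]

theorem parity_functions {f : SuperForm n R} (hf : f ∈ functions n R) :
    parity f ∈ functions n R := by
  have h : functions n R ≤ (functions n R).comap parity := by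
    refine Algebra.adjoin_le ?_
    rintro _ (⟨r, rfl⟩ | ⟨i, rfl⟩)
    · change parity (func r : SuperForm n R) ∈ functions n R
      rw [parity_func]
      exact func_mem_functions r
    · change parity (theta R i) ∈ functions n R
      rw [theta, parity_odd]
      exact neg_mem (theta_mem_functions i)
  exact h hf

theorem parity_iterate_functions (k : ℕ) {f : SuperForm n R} (hf : f ∈ functions n R) :
    parity^[k] f ∈ functions n R := by
  induction k with
  | zero => exact hf
  | succ k ih =>
    rw [Function.iterate_succ_apply']
    exact parity_functions ih

theorem parity_iterate_iterate (k : ℕ) (f : SuperForm n R) : parity^[k] (parity^[k] f) = f := by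
  rw [← Function.iterate_add_apply, ← two_mul, Function.iterate_mul]
  exact Function.iterate_fixed (parity_parity f) k

theorem Transgresses.smul_dxTop {α : PForm n ev p D} {a : R}
    (hα : Transgresses α (dxTop (func a))) (f : SuperForm n R) :
    Transgresses (f • α) (dxTop (parity^[n + p] f * func a)) := by
  have := hα.smul f
  rwa [mul_dxTop, ← Function.iterate_add_apply] at this

theorem E1.mk_eq_zero {m : LinearMap.ker (omegaMul n ev p D)} :
    E1.mk n ev p D m = 0 ↔ ∃ m', m.1 = omega n R • m' := by
  refine (Submodule.Quotient.mk_eq_zero _).trans ⟨?_, ?_⟩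
  · rintro ⟨m', hm'⟩
    exact ⟨m', hm'.symm⟩
  · rintro ⟨m', hm'⟩
    exact ⟨m', hm'.symm⟩

theorem E1.mk_eq_mk {m m' : LinearMap.ker (omegaMul n ev p D)} :
    E1.mk n ev p D m = E1.mk n ev p D m' ↔ ∃ k, m.1 - m'.1 = omega n R • k := by
  rw [← sub_eq_zero, ← map_sub, E1.mk_eq_zero]
  rfl

/-- A form that transgresses to an invertible function times `dx^1 ⋯ dx^n` is a basis of the
`ω`-cohomology: cocycles are determined up to coboundaries by what they transgress to, and the
`ω`-cohomology of superforms consists of the superfunctions times `dx^1 ⋯ dx^n`. -/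
theorem E1.bijective_smul (hloc : ∀ r, ev r ≠ 0 → IsUnit r)
    (hD : ∀ i f g, D i (f * g) = D i f * g + f * D i g) (u : DeltaSystem n ev p)
    {α : LinearMap.ker (omegaMul n ev p D)} {a : R}
    (ha : IsUnit a) (hα : Transgresses α.1 (dxTop (func a))) :
    Function.Bijective (LinearMap.toSpanSingleton (functions n R) (E1 n ev p D)
      (E1.mk n ev p D α)) := by
  obtain ⟨b, hb⟩ := isUnit_iff_exists_inv.1 ha
  have hab : (func a * func b : SuperForm n R) = 1 := by rw [← func_mul, hb, func_one]
  constructor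
  · rw [injective_iff_map_eq_zero]
    intro f hf
    have h1 : E1.mk n ev p D ((f : SuperForm n R) • α) = 0 := by rw [map_smul]; exact hf
    obtain ⟨m', hm'⟩ := E1.mk_eq_zero.1 h1
    have h2 := hα.smul_dxTop (f : SuperForm n R)
    have h3 : (f : SuperForm n R) • α.1 = omega n R • m' := hm'
    rw [h3] at h2
    obtain ⟨η, hη⟩ := h2.exists_eq_omega_mul hloc hD
    have h4 := eq_zero_of_dxTop_eq (mul_mem (parity_iterate_functions (n + p) f.2)
      (func_mem_functions a)) hη
    have h5 := congrArg (· * func b) h4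
    simp only [mul_assoc, hab, mul_one, zero_mul] at h5
    have h6 := congrArg (parity^[n + p]) h5
    rw [parity_iterate_iterate] at h6
    refine Subtype.ext (h6.trans ?_)
    exact Function.iterate_fixed (map_zero _) _
  · intro c
    obtain ⟨m, rfl⟩ := Submodule.mkQ_surjective _ c
    obtain ⟨τ, hτ⟩ := exists_transgresses hloc hD u (m := m.1) m.2
    obtain ⟨f, hf, σ, rfl⟩ := exists_dxTop_add hloc hτ.omega_mul_eq_zero
    have hg : parity^[n + p] (f * func b) ∈ functions n R :=
      parity_iterate_functions _ (mul_mem hf (func_mem_functions b))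
    have h1 := hτ.sub hloc hD (hα.smul_dxTop (parity^[n + p] (f * func b)))
    have hba : (func b * func a : SuperForm n R) = 1 := by rw [← func_mul_comm, hab]
    rw [parity_iterate_iterate, mul_assoc, hba, mul_one, add_sub_cancel_left] at h1
    obtain ⟨m', hm'⟩ := h1.exists_eq_omega_smul hloc hD
    refine ⟨⟨_, hg⟩, ?_⟩
    change (parity^[n + p] (f * func b)) • E1.mk n ev p D α = E1.mk n ev p D m
    rw [← map_smul, eq_comm]
    exact E1.mk_eq_mk.2 ⟨m', hm'⟩

/-- Two generators differ by the ratio of the functions that they transgress to. -/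
theorem E1.mk_eq_func_smul (hloc : ∀ r, ev r ≠ 0 → IsUnit r)
    (hD : ∀ i f g, D i (f * g) = D i f * g + f * D i g) {α α' : LinearMap.ker (omegaMul n ev p D)} {a d : R}
    (hα : Transgresses α.1 (dxTop (func a))) (hα' : Transgresses α'.1 (dxTop (func (d * a)))) :
    E1.mk n ev p D α' = (func d : SuperForm n R) • E1.mk n ev p D α := by
  rw [← map_smul]
  have h1 := hα'.sub hloc hD (hα.smul_dxTop (func d))
  have h2 : parity^[n + p] (func d : SuperForm n R) = func d :=
    Function.iterate_fixed (parity_func d) _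
  rw [h2, ← func_mul, sub_self, ← mul_zero (omega n R)] at h1
  exact E1.mk_eq_mk.2 (h1.exists_eq_omega_smul hloc hD)

end FirstPage

section Differential

variable {n : ℕ} {R : Type*} [CommRing R] [Algebra ℝ R] {ev : R →+* ℝ} {p : ℕ}
  {D : Fin n → R →ₗ[ℝ] R}

theorem deRham_apply (s : SuperForm n R) : deRham D s =
    ∑ i, (dx R i * LinearMap.rTensor (Grass n) (D i) s + dtheta R i * dTheta i s) := by
  simp only [deRham, LinearMap.sum_apply, LinearMap.add_apply, LinearMap.comp_apply,
    LinearMap.mulLeft_apply]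

theorem deRham_func (g : R) : deRham D (func g : SuperForm n R) = ∑ i, dx R i * func (D i g) := by
  rw [deRham_apply]
  refine Finset.sum_congr rfl fun i _ => ?_
  rw [dTheta_eq_contract, func_eq_pureForm, contract_pureForm, mul_zero, add_zero,
    ← func_eq_pureForm, func, LinearMap.rTensor_tmul, func]

theorem deRham_one_tmul (hD : ∀ i f g, D i (f * g) = D i f * g + f * D i g) (g : Grass n) :
    deRham D (1 ⊗ₜ[ℝ] g : SuperForm n R) = ∑ i, dtheta R i * dTheta i (1 ⊗ₜ[ℝ] g) := by
  rw [deRham_apply]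
  refine Finset.sum_congr rfl fun i _ => ?_
  have h := hD i 1 1
  rw [mul_one, mul_one, one_mul, left_eq_add] at h
  rw [LinearMap.rTensor_tmul, h, TensorProduct.zero_tmul, mul_zero, zero_add]

theorem deRham_dx (hD : ∀ i f g, D i (f * g) = D i f * g + f * D i g) (i : Fin n) :
    deRham D (dx R i) = 0 := by
  rw [dx, odd, deRham_one_tmul hD]
  refine Finset.sum_eq_zero fun k _ => ?_
  have := contract_odd (R := R) (LinearMap.proj (Sum.inl k)) (Pi.single (Sum.inr i) 1 : Fin n ⊕ Fin n → Fibre n)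
  rw [odd] at this
  rw [dTheta_eq_contract, this]
  simp

theorem deRham_theta (hD : ∀ i f g, D i (f * g) = D i f * g + f * D i g) (i : Fin n) :
    deRham D (theta R i) = dtheta R i := by
  rw [theta, odd, deRham_one_tmul hD]
  have h : ∀ k : Fin n, dTheta k (1 ⊗ₜ[ℝ] ExteriorAlgebra.ι (Fibre n) (Pi.single (Sum.inl i) 1) :
      SuperForm n R) = if k = i then 1 else 0 := fun k => by
    have := contract_odd (R := R) (LinearMap.proj (Sum.inl k))
      (Pi.single (Sum.inl i) 1 : Fin n ⊕ Fin n → Fibre n)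
    rw [odd] at this
    rw [dTheta_eq_contract, this]
    split_ifs with h
    · subst h; simp [Algebra.TensorProduct.one_def]
    · simp [h]
  simp only [h, mul_ite, mul_one, mul_zero, Finset.sum_ite_eq', Finset.mem_univ, if_true]

theorem deRham_dtheta (hD : ∀ i f g, D i (f * g) = D i f * g + f * D i g) (i : Fin n) :
    deRham D (dtheta R i) = 0 := by
  rw [dtheta, deRham_one_tmul hD]
  refine Finset.sum_eq_zero fun k _ => ?_
  have := contract_pureForm (R := R) (LinearMap.proj (Sum.inl k)) (1 ⊗ₜ MvPolynomial.X i)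
  rw [pureForm_tmul] at this
  rw [dTheta_eq_contract, this, mul_zero]

theorem deRham_deRham_func (hD : ∀ i f g, D i (f * g) = D i f * g + f * D i g)
    (hDD : ∀ i j f, D i (D j f) = D j (D i f)) (g : R) :
    deRham D (deRham D (func g : SuperForm n R)) = 0 := by
  have h : deRham D (deRham D (func g : SuperForm n R)) =
      - ∑ i, ∑ j, dx R i * (dx R j * func (D j (D i g))) := by
    rw [deRham_func, map_sum, ← Finset.sum_neg_distrib]
    refine Finset.sum_congr rfl fun i _ => ?_
    rw [deRham_mul hD, deRham_dx hD, zero_mul, zero_add, parity_dx, deRham_func, neg_mul,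
      Finset.mul_sum]
  -- the sum is antisymmetric in `i` and `j`
  refine eq_zero_of_eq_neg ?_
  rw [h]
  congr 1
  refine Finset.sum_comm.trans ?_
  rw [← Finset.sum_neg_distrib]
  refine Finset.sum_congr rfl fun i _ => ?_
  rw [← Finset.sum_neg_distrib]
  refine Finset.sum_congr rfl fun j _ => ?_
  rw [dx_mul_dx_mul, hDD]

/-- The form `ω` is the differential of `∑ dx^i θ_i` up to sign, so it can be computed from any
expression of the latter as `∑ y_j Θ_j` with closed `y_j`. -/
theorem omega_eq_sum (hD : ∀ i f g, D i (f * g) = D i f * g + f * D i g)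
    {y Θ : Fin n → SuperForm n R} (hy : ∀ j, parity (y j) = - y j) (hdy : ∀ j, deRham D (y j) = 0)
    (h : ∑ j, y j * Θ j = ∑ i, dx R i * theta R i) :
    omega n R = ∑ j, y j * deRham D (Θ j) := by
  have h1 := congrArg (deRham D) h
  rw [map_sum, map_sum] at h1
  simp only [deRham_mul hD, hdy, deRham_dx hD, zero_mul, zero_add, hy, parity_dx,
    deRham_theta hD, neg_mul, Finset.sum_neg_distrib, neg_inj] at h1
  exact h1.symm

theorem deRham_list_prod (hD : ∀ i f g, D i (f * g) = D i f * g + f * D i g)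
    {l : List (SuperForm n R)} (hl : ∀ z ∈ l, deRham D z = 0) : deRham D l.prod = 0 := by
  induction l with
  | nil =>
    have h := deRham_mul hD (1 : SuperForm n R) 1
    rwa [mul_one, mul_one, map_one parity, one_mul, left_eq_add] at h
  | cons z l ih =>
    rw [List.prod_cons, deRham_mul hD, hl z List.mem_cons_self, zero_mul, zero_add,
      ih fun z hz => hl z (List.mem_cons_of_mem _ hz), mul_zero]

theorem pDeRham_smul (hD : ∀ i f g, D i (f * g) = D i f * g + f * D i g) (a : SuperForm n R)
    (m : PForm n ev p D) :
    pDeRham n ev p D (a • m) = deRham D a • m + parity a • pDeRham n ev p D m := by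
  induction m using Submodule.Quotient.induction_on with
  | H f => exact congrArg (relations n ev p D).mkQ (preDeRham_smul hD a f)

theorem pDeRham_mk_eq_zero {a : SuperForm n R} {u : DeltaSystem n ev p} (ha : deRham D a = 0)
    (hu : ∀ k, deRham D (u.1 k) = 0) : pDeRham n ev p D (PForm.mk a u) = 0 := by
  have h : preDeRham D (Finsupp.single u a) = 0 := by
    rw [preDeRham_single, ha, Finsupp.single_zero, zero_sub, neg_eq_zero]
    exact Finset.sum_eq_zero fun k _ => by rw [hu, zero_mul, Finsupp.single_zero]
  exact (congrArg (relations n ev p D).mkQ h).trans (map_zero _)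

/-- The differential of the first page vanishes if the generator is closed: `dx^i` and `dθ_i` act by
zero on the `ω`-cohomology of superforms, hence on that of forms of picture `p`. -/
theorem E1.d_eq_zero (hloc : ∀ r, ev r ≠ 0 → IsUnit r)
    (hD : ∀ i f g, D i (f * g) = D i f * g + f * D i g)
    {α : LinearMap.ker (omegaMul n ev p D)} {a : R}
    (hα : Transgresses α.1 (dxTop (func a))) (hdα : pDeRham n ev p D α.1 = 0)
    (hgen : ∀ m : LinearMap.ker (omegaMul n ev p D), ∃ f : SuperForm n R,
      E1.mk n ev p D m = f • E1.mk n ev p D α) : E1.d n ev p D = 0 := by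
  have hleft : ∀ (s t : SuperForm n R), (∃ m', t • α.1 = omega n R • m') →
      ∃ m', (s * t) • α.1 = omega n R • m' := by
    rintro s t ⟨m', hm'⟩
    refine ⟨parity s • m', ?_⟩
    rw [mul_smul, hm', smul_smul, smul_smul, omega_mul, parity_parity]
  have hdx : ∀ i, ∃ m', dx R i • α.1 = omega n R • m' := fun i => by
    have h := hα.smul (dx R i)
    have h1 : parity^[p] (dx R i) = (-1 : ℝ) ^ p • dx R i :=
      parity_iterate_smul p (by rw [parity_dx, neg_one_smul])
    rw [h1, smul_mul_assoc, dx_mul_dxTop, smul_zero, ← mul_zero (omega n R)] at h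
    exact h.exists_eq_omega_smul hloc hD
  have hdθ : ∀ i, ∃ m', dtheta R i • α.1 = omega n R • m' := fun i => by
    have h := hα.smul (dtheta R i)
    have h1 : parity^[p] (dtheta R i) = dtheta R i := Function.iterate_fixed (parity_dtheta i) _
    rw [h1, ← dDx_omega_mul, omega_mul_dxTop, map_zero, zero_add] at h
    exact h.exists_eq_omega_smul hloc hD
  refine AddMonoidHom.ext fun c => ?_
  obtain ⟨m, rfl⟩ := Submodule.mkQ_surjective _ c
  change E1.mk n ev p D (kerDeRham n ev p D m) = 0
  rw [E1.mk_eq_zero]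
  obtain ⟨f, hf⟩ := hgen m
  rw [← map_smul, E1.mk_eq_mk] at hf
  obtain ⟨k, hk⟩ := hf
  have hk' : m.1 = f • α.1 + omega n R • k := sub_eq_iff_eq_add'.1 hk
  have e : (kerDeRham n ev p D m).1 = deRham D f • α.1 - omega n R • pDeRham n ev p D k := by
    change pDeRham n ev p D m.1 = _
    rw [hk', map_add, pDeRham_smul hD, hdα, smul_zero, add_zero, pDeRham_omega, sub_eq_add_neg]
  have hsum : ∃ m', deRham D f • α.1 = omega n R • m' := by
    have h1 : ∀ i, ∃ m', (dx R i * LinearMap.rTensor (Grass n) (D i) f + dtheta R i * dTheta i f) •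
        α.1 = omega n R • m' := fun i => by
      obtain ⟨k₁, h₁⟩ := hleft (parity (LinearMap.rTensor (Grass n) (D i) f)) (dx R i) (hdx i)
      obtain ⟨k₂, h₂⟩ := hleft (dTheta i f) (dtheta R i) (hdθ i)
      refine ⟨k₁ + k₂, ?_⟩
      rw [add_smul, smul_add, ← h₁, ← h₂, dtheta_comm, dx, odd_mul]
    choose k hk using h1
    exact ⟨∑ i, k i, by rw [deRham_apply, Finset.sum_smul, Finset.smul_sum]; simp only [hk]⟩
  obtain ⟨k', hk'⟩ := hsum
  exact ⟨k' - pDeRham n ev p D k, by rw [e, hk', smul_sub]⟩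

end Differential

end OddSymplectic

namespace OddSymplectic

/-! ### Calculus of germs in several charts -/

section GermCalculus

variable {n : ℕ} {M : Type*} [TopologicalSpace M] [ChartedSpace (EuclideanSpace ℝ (Fin n)) M] {x : M}

theorem SmoothGerm.isUnit_of_eval_ne_zero (g : SmoothGerm n x) (hg : SmoothGerm.eval n x g ≠ 0) :
    IsUnit g := by
  obtain ⟨_, f, rfl, hf⟩ := g
  have hfx : f x ≠ 0 := hg
  have hne : ∀ᶠ y in 𝓝 x, f y ≠ 0 := (hf.self_of_nhds.continuousAt).eventually_ne hfx
  refine IsUnit.of_mul_eq_one ⟨((fun y => (f y)⁻¹ : M → ℝ) : Filter.Germ (𝓝 x) ℝ), _, rfl, ?_⟩ ?_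
  · filter_upwards [hf, hne] with y h1 h2
    exact ContMDiffAt.comp (I' := 𝓘(ℝ, ℝ)) y (contDiffAt_inv ℝ h2).contMDiffAt h1
  · refine Subtype.ext (Filter.Germ.coe_eq.2 ?_)
    filter_upwards [hne] with y h
    exact mul_inv_cancel₀ h

theorem partialDeriv_mul (e : ChartNear n x) (i : Fin n) (f g : SmoothGerm n x) :
    partialDeriv e i (f * g) = partialDeriv e i f * g + f * partialDeriv e i g := by
  obtain ⟨_, f, rfl, hf⟩ := f
  obtain ⟨_, g, rfl, hg⟩ := g
  refine Subtype.ext (Filter.Germ.coe_eq.2 ?_)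
  filter_upwards [hf, hg, e.1.open_source.mem_nhds e.2.2] with y h1 h2 h3
  have d1 := (contDiffAt_comp_symm e h3 h1).differentiableAt (by simp)
  have d2 := (contDiffAt_comp_symm e h3 h2).differentiableAt (by simp)
  have h := congrArg (fun T => T (EuclideanSpace.single i 1)) (fderiv_mul d1 d2)
  have hy : e.1.symm (e.1 y) = y := e.1.left_inv h3
  simp only [add_apply, smul_apply, Function.comp_apply, hy,
    smul_eq_mul] at h
  refine h.trans ?_
  rw [add_comm, mul_comm (g y)]
  rfl

theorem partialDeriv_comm (e : ChartNear n x) (i j : Fin n) (f : SmoothGerm n x) :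
    partialDeriv e i (partialDeriv e j f) = partialDeriv e j (partialDeriv e i f) := by
  obtain ⟨_, f, rfl, hf⟩ := f
  refine Subtype.ext (Filter.Germ.coe_eq.2 ?_)
  filter_upwards [hf, e.1.open_source.mem_nhds e.2.2] with y h1 h3
  have hc := contDiffAt_comp_symm e h3 h1
  have key : ∀ i j : Fin n, partialFun e.1 i (partialFun e.1 j f) y =
      fderiv ℝ (fderiv ℝ (f ∘ e.1.symm)) (e.1 y) (EuclideanSpace.single i 1)
        (EuclideanSpace.single j 1) := by
    intro i j
    have h4 : partialFun e.1 j f ∘ e.1.symm =ᶠ[𝓝 (e.1 y)]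
        fun z => fderiv ℝ (f ∘ e.1.symm) z (EuclideanSpace.single j 1) := by
      filter_upwards [e.1.open_target.mem_nhds (e.1.map_source h3)] with z hz
      simp only [Function.comp_apply, partialFun, e.1.right_inv hz]
    rw [partialFun, h4.fderiv_eq]
    have hd : DifferentiableAt ℝ (fderiv ℝ (f ∘ e.1.symm)) (e.1 y) :=
      (hc.fderiv_right (m := ∞) (by simp)).differentiableAt (by simp)
    rw [fderiv_clm_apply hd (differentiableAt_const _)]
    simp
  change partialFun e.1 i (partialFun e.1 j f) y = partialFun e.1 j (partialFun e.1 i f) y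
  rw [key, key]
  exact (hc.isSymmSndFDerivAt (by
    rw [minSmoothness_of_isRCLikeNormedField]; exact WithTop.coe_le_coe.2 le_top)) _ _

/-- The chain rule for a change of charts. -/
theorem partialDeriv_chain (e e' : ChartNear n x) (i : Fin n) (f : SmoothGerm n x) :
    partialDeriv e i f = ∑ j, jac e e' j i * partialDeriv e' j f := by
  obtain ⟨_, f, rfl, hf⟩ := f
  -- a sum of products of germs is represented by the sum of products of representatives
  have hs : ∀ (a b : Fin n → M → ℝ) (ha : ∀ j, ∀ᶠ y in 𝓝 x, ContMDiffAt (𝓡 n) 𝓘(ℝ, ℝ) ∞ (a j) y)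
      (hb : ∀ j, ∀ᶠ y in 𝓝 x, ContMDiffAt (𝓡 n) 𝓘(ℝ, ℝ) ∞ (b j) y),
      ((∑ j, SmoothGerm.of (a j) (ha j) * SmoothGerm.of (b j) (hb j) : SmoothGerm n x)).1 =
        ((fun y => ∑ j, a j y * b j y : M → ℝ) : Filter.Germ (𝓝 x) ℝ) := by
    intro a b ha hb
    have h1 : ((∑ j, SmoothGerm.of (a j) (ha j) * SmoothGerm.of (b j) (hb j) : SmoothGerm n x)).1 =
        ∑ j, ((fun y => a j y * b j y : M → ℝ) : Filter.Germ (𝓝 x) ℝ) :=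
      map_sum (smoothGermSubring n x).subtype _ _
    rw [h1]
    have h2 := map_sum (Filter.Germ.coeRingHom (𝓝 x)) (fun j => (fun y => a j y * b j y : M → ℝ))
      Finset.univ
    refine h2.symm.trans ?_
    refine congrArg (fun g : M → ℝ => (g : Filter.Germ (𝓝 x) ℝ)) (funext fun y => ?_)
    exact Finset.sum_apply y _ _
  have h := hs (fun j => partialFun e.1 i fun y => e'.1 y j) (fun j => partialFun e'.1 j f)
    (fun j => partialFun_smooth e i (by
      filter_upwards [e'.1.open_source.mem_nhds e'.2.2] with y hy
      have h := contMDiffAt_of_mem_maximalAtlas e'.2.1 hy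
      have h2 : ContDiff ℝ ∞ (fun z : EuclideanSpace ℝ (Fin n) => z j) := by fun_prop
      exact ContMDiffAt.comp (I' := 𝓡 n) y h2.contDiffAt.contMDiffAt h))
    (fun j => partialFun_smooth e' j hf)
  refine Subtype.ext (Eq.trans (Filter.Germ.coe_eq.2 ?_) h.symm)
  filter_upwards [hf, e.1.open_source.mem_nhds e.2.2, e'.1.open_source.mem_nhds e'.2.2]
    with y h1 h2 h3
  let ey : ChartNear n y := ⟨e.1, e.2.1, h2⟩
  let ey' : ChartNear n y := ⟨e'.1, e'.2.1, h3⟩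
  have hT := differentiableAt_transition ey ey'
  have hc := (contDiffAt_comp_symm ey' h3 h1).differentiableAt (by simp)
  have hcomp : f ∘ e.1.symm =ᶠ[𝓝 (e.1 y)] (f ∘ e'.1.symm) ∘ (e'.1 ∘ e.1.symm) := by
    have hcont := e.1.continuousAt_symm (e.1.map_source h2)
    rw [ContinuousAt, e.1.left_inv h2] at hcont
    filter_upwards [hcont.eventually (e'.1.open_source.mem_nhds h3)] with z hz
    simp only [Function.comp_apply]
    rw [e'.1.left_inv hz]
  have hpt : (e'.1 ∘ e.1.symm) (e.1 y) = e'.1 y := by simp [e.1.left_inv h2]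
  have hc' : DifferentiableAt ℝ (f ∘ e'.1.symm) ((e'.1 ∘ e.1.symm) (e.1 y)) := by
    rw [hpt]; exact hc
  have e1 : partialFun e.1 i f y = fderiv ℝ (f ∘ e'.1.symm) (e'.1 y)
      (fderiv ℝ (e'.1 ∘ e.1.symm) (e.1 y) (EuclideanSpace.single i 1)) := by
    rw [partialFun, hcomp.fderiv_eq, fderiv_comp _ hc' hT, hpt]
    rfl
  have e2 : ∀ j, partialFun e.1 i (fun y => e'.1 y j) y =
      (fderiv ℝ (e'.1 ∘ e.1.symm) (e.1 y) (EuclideanSpace.single i 1)) j := fun j =>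
    eval_jac ey ey' j i
  have e3 : ∀ v : EuclideanSpace ℝ (Fin n), v = ∑ j, v j • EuclideanSpace.single j (1 : ℝ) := by
    intro v
    have := (EuclideanSpace.basisFun (Fin n) ℝ).sum_repr v
    simpa using this.symm
  rw [e1, e3 (fderiv ℝ (e'.1 ∘ e.1.symm) (e.1 y) (EuclideanSpace.single i 1)), map_sum]
  refine Finset.sum_congr rfl fun j _ => ?_
  rw [map_smul, smul_eq_mul, e2]
  rfl

/-- The cocycle rule for Jacobians: the chain rule for the coordinate functions. -/
theorem jac_mul_jac (e e' e'' : ChartNear n x) : jac e' e'' * jac e e' = jac e e'' := by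
  ext1 k i
  rw [Matrix.mul_apply]
  refine Eq.trans (Finset.sum_congr rfl fun j _ => ?_) (partialDeriv_chain e e' i (coord e'' k)).symm
  exact mul_comm _ _

theorem jac_self (e : ChartNear n x) : jac e e = 1 := by
  ext1 k i
  have h : partialFun e.1 i (fun y => e.1 y k) =ᶠ[𝓝 x]
      fun _ => (1 : Matrix (Fin n) (Fin n) ℝ) k i := by
    filter_upwards [e.1.open_source.mem_nhds e.2.2] with y hy
    have h1 : (fun y => e.1 y k) ∘ e.1.symm =ᶠ[𝓝 (e.1 y)]
        (EuclideanSpace.proj k : EuclideanSpace ℝ (Fin n) →L[ℝ] ℝ) := by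
      filter_upwards [e.1.open_target.mem_nhds (e.1.map_source hy)] with z hz
      simp [e.1.right_inv hz]
    rw [partialFun, h1.fderiv_eq, ContinuousLinearMap.fderiv]
    simp [Matrix.one_apply]
  refine Subtype.ext ((Filter.Germ.coe_eq.2 h).trans ?_)
  rw [Matrix.one_apply, Matrix.one_apply]
  split_ifs <;> rfl

theorem det_jac_mul_det_jac (e e' e'' : ChartNear n x) :
    (jac e' e'').det * (jac e e').det = (jac e e'').det := by
  rw [← Matrix.det_mul, jac_mul_jac]

theorem det_jac_mul_det_jac_symm (e e' : ChartNear n x) : (jac e' e).det * (jac e e').det = 1 := by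
  rw [det_jac_mul_det_jac, jac_self, Matrix.det_one]

theorem isUnit_det_jac (e e' : ChartNear n x) : IsUnit (jac e e').det :=
  IsUnit.of_mul_eq_one _ (det_jac_mul_det_jac_symm e' e)

theorem berezinian_eq (e e' : ChartNear n x) : berezinian e e' = (jac e e').det ^ 2 := by
  have h : (jac e' e).transpose⁻¹ = (jac e e').transpose := by
    refine Matrix.inv_eq_right_inv ?_
    rw [← Matrix.transpose_mul, jac_mul_jac, jac_self, Matrix.transpose_one]
  rw [berezinian, h, Matrix.det_transpose, pow_two]

end GermCalculus

end OddSymplectic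

namespace OddSymplectic

/-! ### The generators attached to charts -/

section Charts

variable {n : ℕ} {M : Type*} [TopologicalSpace M] [ChartedSpace (EuclideanSpace ℝ (Fin n)) M]
  [IsManifold (𝓡 n) ∞ M] {x : M} {p : ℕ}

theorem basePartial_mul (i : Fin n) (f g : SmoothGerm n x) :
    basePartial n x i (f * g) = basePartial n x i f * g + f * basePartial n x i g :=
  partialDeriv_mul _ i f g

theorem basePartial_comm (i j : Fin n) (f : SmoothGerm n x) :
    basePartial n x i (basePartial n x j f) = basePartial n x j (basePartial n x i f) :=
  partialDeriv_comm _ i j f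

theorem chartDx_eq_linDx (e : ChartNear n x) (j : Fin n) :
    chartDx e j = linDx (jac (preferredChart n x) e j) := by
  rw [chartDx, deRham_func, linDx_apply]
  exact Finset.sum_congr rfl fun i _ => (func_mul_comm _ _).symm

theorem deRham_chartDx (e : ChartNear n x) (j : Fin n) :
    deRham (basePartial n x) (chartDx e j) = 0 :=
  deRham_deRham_func basePartial_mul basePartial_comm _

/-- The one-form `∑ dy^j θ_j` is the same in every chart. -/
theorem sum_chartDx_mul_chartTheta (e : ChartNear n x) :
    ∑ j, chartDx e j * chartTheta e j =
      ∑ i, dx (SmoothGerm n x) i * theta (SmoothGerm n x) i := by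
  simp only [chartDx_eq_linDx, chartTheta, Finset.mul_sum]
  rw [Finset.sum_comm]
  refine Finset.sum_congr rfl fun i _ => ?_
  have h : ∑ j, jac e (preferredChart n x) i j • jac (preferredChart n x) e j =
      (Pi.single i 1 : Fin n → SmoothGerm n x) := by
    funext k
    have h1 := congrFun (congrFun ((jac_mul_jac (preferredChart n x) e (preferredChart n x)).trans
      (jac_self _)) i) k
    rw [Matrix.mul_apply, Matrix.one_eq_pi_single] at h1
    rw [Finset.sum_apply]
    exact h1
  rw [← linDx_single i, ← h, map_sum, Finset.sum_mul]
  refine Finset.sum_congr rfl fun j _ => ?_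
  rw [map_smul, smul_eq_func_mul, ← mul_assoc, func_mul_comm _ (linDx _)]

/-- The form `ω` is the same in every chart. -/
theorem omega_eq_sum_chart (e : ChartNear n x) :
    omega n (SmoothGerm n x) = ∑ j, chartDx e j * chartDtheta e j :=
  omega_eq_sum basePartial_mul (fun j => by rw [chartDx_eq_linDx, parity_linDx]) (deRham_chartDx e)
    (sum_chartDx_mul_chartTheta e)

/-- The form of the chart `y` transgresses to a nonzero constant times
`det(∂y/∂x) dx^1 ⋯ dx^n`. -/
theorem transgresses_generator (e : ChartNear n x) (hp : p ≤ n) :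
    Transgresses (generator e p hp) (dxTop (func
      (algebraMap ℝ (SmoothGerm n x) (generatorConst n p) * (jac (preferredChart n x) e).det))) := by
  simp only [generator, chartDx_eq_linDx]
  refine transgresses_sum SmoothGerm.isUnit_of_eval_ne_zero basePartial_mul hp
    (v := fun j => ⟨chartDtheta e j, parity_chartDtheta e j⟩) ?_ fun σ k => rfl
  simp only [← chartDx_eq_linDx]
  exact omega_eq_sum_chart e

theorem generator_mem_ker (e : ChartNear n x) (hp : p ≤ n) :
    generator e p hp ∈ LinearMap.ker
      (omegaMul n (SmoothGerm.eval n x) p (basePartial n x)) :=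
  (transgresses_generator e hp).omega_smul_eq_zero SmoothGerm.isUnit_of_eval_ne_zero basePartial_mul

/-- The class `[α^e_p]` of the form of the chart `e`. -/
noncomputable def generatorClass (e : ChartNear n x) (p : ℕ) (hp : p ≤ n) : Coh n x p :=
  E1.mk _ _ _ _ ⟨generator e p hp, generator_mem_ker e hp⟩

theorem bijective_smul_generatorClass (e : ChartNear n x) (hp : p ≤ n) :
    Function.Bijective
      (LinearMap.toSpanSingleton (StructureStalk n x) (Coh n x p) (generatorClass e p hp)) :=
  E1.bijective_smul SmoothGerm.isUnit_of_eval_ne_zero basePartial_mul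
    ⟨fun k => chartDtheta e (Fin.castLE hp k),
      isDeltaSystem_chartDtheta e _ (Fin.castLE_injective hp)⟩
    (((isUnit_iff_ne_zero.2 generatorConst_ne_zero).map _).mul (isUnit_det_jac _ _))
    (transgresses_generator e hp)

/-- The isomorphism `f ↦ f [α^e_p]` from the superfunctions onto `H_ω(Ω^{•|p})`. -/
noncomputable def generatorEquiv (e : ChartNear n x) (hp : p ≤ n) :
    StructureStalk n x ≃ₗ[StructureStalk n x] Coh n x p :=
  LinearEquiv.ofBijective _ (bijective_smul_generatorClass e hp)

theorem generatorEquiv_apply (e : ChartNear n x) (hp : p ≤ n) (f : StructureStalk n x) :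
    generatorEquiv e hp f = f • generatorClass e p hp := rfl

/-- The class of the generator changes by the Jacobian determinant, as
`det(∂y'/∂x) = det(∂y'/∂y) det(∂y/∂x)`. -/
theorem generatorClass_eq_smul (e e' : ChartNear n x) (hp : p ≤ n) :
    generatorClass e' p hp =
      (func (jac e e').det : FormStalk n x) • generatorClass e p hp := by
  refine E1.mk_eq_func_smul SmoothGerm.isUnit_of_eval_ne_zero basePartial_mul
    (transgresses_generator e hp) ?_
  have h := transgresses_generator e' hp
  rwa [← det_jac_mul_det_jac (preferredChart n x) e e', mul_left_comm] at h

/-- A semidensity is determined by its component in the reference chart, which can be any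
superfunction. -/
noncomputable def semidensityEquiv : Semidensity n x ≃ₗ[StructureStalk n x] StructureStalk n x where
  toFun s := s.1 (preferredChart n x)
  map_add' _ _ := rfl
  map_smul' _ _ := rfl
  invFun f := ⟨fun e => f * ⟨func (jac e (preferredChart n x)).det, func_mem_functions _⟩,
    fun e e' => by
      change f.1 * func _ = f.1 * func _ * func _
      rw [mul_assoc, ← func_mul, det_jac_mul_det_jac]⟩
  left_inv s := Subtype.ext (funext fun e => Subtype.ext (s.2 e _).symm)
  right_inv f := Subtype.ext (by
    change f.1 * func _ = f.1
    rw [jac_self, Matrix.det_one, func_one, mul_one])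

theorem semidensityEquiv_smul_generatorClass (e : ChartNear n x) (hp : p ≤ n)
    (s : Semidensity n x) :
    semidensityEquiv s • generatorClass (preferredChart n x) p hp =
      s.1 e • generatorClass e p hp := by
  change (s.1 (preferredChart n x)).1 • generatorClass (preferredChart n x) p hp =
    (s.1 e).1 • generatorClass e p hp
  rw [generatorClass_eq_smul e (preferredChart n x), smul_smul, ← s.2 e (preferredChart n x)]

theorem chartDtheta_preferredChart (j : Fin n) :
    chartDtheta (preferredChart n x) j = dtheta (SmoothGerm n x) j := by
  have h : chartTheta (preferredChart n x) j = theta (SmoothGerm n x) j := by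
    rw [chartTheta, jac_self, Finset.sum_eq_single_of_mem j (Finset.mem_univ j), Matrix.one_apply_eq,
      func_one, one_mul]
    intro i _ hi
    rw [Matrix.one_apply_ne hi, func, TensorProduct.zero_tmul, zero_mul]
  rw [chartDtheta, h, deRham_theta basePartial_mul]

/-- In the reference chart the generator has constant coefficients, hence is closed. -/
theorem pDeRham_generator_preferredChart (hp : p ≤ n) :
    pDeRham n (SmoothGerm.eval n x) p (basePartial n x) (generator (preferredChart n x) p hp) = 0 := by
  rw [generator, map_sum]
  refine Finset.sum_eq_zero fun σ _ => ?_
  refine (map_zsmul _ _ _).trans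
    ((congrArg _ (pDeRham_mk_eq_zero ?_ fun k => ?_)).trans (smul_zero _))
  · refine deRham_list_prod basePartial_mul fun z hz => ?_
    obtain ⟨k, rfl⟩ := (List.mem_ofFn' _ _).1 hz
    exact deRham_chartDx _ _
  · exact (congrArg (deRham _) (chartDtheta_preferredChart _)).trans (deRham_dtheta basePartial_mul _)

theorem E1.d_eq_zero_of_le (hp : p ≤ n) :
    E1.d n (SmoothGerm.eval n x) p (basePartial n x) = 0 := by
  refine E1.d_eq_zero SmoothGerm.isUnit_of_eval_ne_zero basePartial_mul
    (α := ⟨_, generator_mem_ker (preferredChart n x) hp⟩) (transgresses_generator _ hp)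
    (pDeRham_generator_preferredChart hp) fun m => ?_
  obtain ⟨f, hf⟩ := (bijective_smul_generatorClass (preferredChart n x) hp).2 (E1.mk _ _ _ _ m)
  exact ⟨f.1, hf.symm⟩

end Charts

/-- The cohomology of the zero differential is the group itself. -/
theorem exists_homology_equiv_of_eq_zero {A : Type*} [AddCommGroup A] {d : A →+ A} (hd : d = 0) :
    ∃ Ψ : (d.ker ⧸ d.range.addSubgroupOf d.ker) ≃+ A,
      ∀ c : d.ker, Ψ (QuotientAddGroup.mk c) = c.1 := by
  subst hd
  have h : ((0 : A →+ A).range.addSubgroupOf (0 : A →+ A).ker) ≤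
      ((0 : A →+ A).ker.subtype).ker := by
    rintro c ⟨a, ha⟩
    exact ha.symm
  refine ⟨AddEquiv.ofBijective (QuotientAddGroup.lift _ (0 : A →+ A).ker.subtype h) ⟨?_, ?_⟩,
    fun c => rfl⟩
  · rw [injective_iff_map_eq_zero]
    intro q hq
    obtain ⟨c, rfl⟩ := QuotientAddGroup.mk_surjective q
    exact (QuotientAddGroup.eq_zero_iff c).2 ⟨0, Eq.symm hq⟩
  · exact fun a => ⟨QuotientAddGroup.mk ⟨a, rfl⟩, rfl⟩

end OddSymplectic

theorem mainTheorem1 (n : ℕ) (M : Type*) [TopologicalSpace M]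
    [ChartedSpace (EuclideanSpace ℝ (Fin n)) M] [IsManifold (𝓡 n) ∞ M] (x : M) :
    (∀ e : ChartNear n x,
      omega n (SmoothGerm n x) = ∑ j, chartDx e j * chartDtheta e j) ∧
    ∃ cocycle : ∀ (e : ChartNear n x) (p : ℕ) (hp : p ≤ n),
        generator e p hp ∈ LinearMap.ker
          (omegaMul n (SmoothGerm.eval n x) p (basePartial n x)),
      (∀ (e : ChartNear n x) (p : ℕ) (hp : p ≤ n),
        ∃ b : Module.Basis Unit (StructureStalk n x) (Coh n x p),
          b () = E1.mk _ _ _ _ ⟨generator e p hp, cocycle e p hp⟩) ∧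
      (∀ e : ChartNear n x,
        ∃ b : Module.Basis (Fin (n + 1)) (StructureStalk n x) (∀ p : Fin (n + 1), Coh n x p),
          ∀ p : Fin (n + 1), b p = Pi.single p (E1.mk _ _ _ _
            ⟨generator e p (Nat.lt_succ_iff.1 p.2), cocycle e p (Nat.lt_succ_iff.1 p.2)⟩)) ∧
      (∀ (e e' : ChartNear n x) (p : ℕ) (hp : p ≤ n),
        E1.mk _ _ _ _ ⟨generator e' p hp, cocycle e' p hp⟩ =
          (func (jac e e').det : FormStalk n x) •
            E1.mk _ _ _ _ ⟨generator e p hp, cocycle e p hp⟩) ∧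
      (∀ e e' : ChartNear n x, berezinian e e' = (jac e e').det ^ 2) ∧
      (∀ (p : ℕ) (hp : p ≤ n),
        ∃ Φ : Semidensity n x ≃ₗ[StructureStalk n x] Coh n x p,
          ∀ (e : ChartNear n x) (s : Semidensity n x),
            Φ s = s.1 e • E1.mk _ _ _ _ ⟨generator e p hp, cocycle e p hp⟩) ∧
      (∀ p : ℕ, p ≤ n →
        E1.d n (SmoothGerm.eval n x) p (basePartial n x) = 0 ∧
        ∃ Ψ : E2 n (SmoothGerm.eval n x) p (basePartial n x) ≃+ Coh n x p,
          ∀ c : (E1.d n (SmoothGerm.eval n x) p (basePartial n x)).ker,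
            Ψ (QuotientAddGroup.mk c) = c.1) := by
  refine ⟨omega_eq_sum_chart, fun e _ hp => generator_mem_ker e hp,
    fun e _ hp => ⟨(Module.Basis.singleton Unit (StructureStalk n x)).map (generatorEquiv e hp), ?_⟩,
    fun e => ⟨(Pi.basis fun p : Fin (n + 1) => (Module.Basis.singleton Unit
      (StructureStalk n x)).map (generatorEquiv e (Nat.lt_succ_iff.1 p.2))).reindex
        (Equiv.sigmaPUnit _), fun p => ?_⟩,
    fun e e' _ hp => generatorClass_eq_smul e e' hp, berezinian_eq,
    fun _ hp => ⟨semidensityEquiv.trans (generatorEquiv (preferredChart n x) hp),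
      fun e s => semidensityEquiv_smul_generatorClass e hp s⟩,
    fun _ hp => ⟨E1.d_eq_zero_of_le hp, exists_homology_equiv_of_eq_zero (E1.d_eq_zero_of_le hp)⟩⟩
  · rw [Module.Basis.map_apply, Module.Basis.singleton_apply]
    exact (generatorEquiv_apply e hp 1).trans (one_smul _ _)
  · rw [Module.Basis.reindex_apply]
    refine (Pi.basis_apply _ _).trans ?_
    rw [Module.Basis.map_apply, Module.Basis.singleton_apply]
    exact congrArg (Pi.single p) ((generatorEquiv_apply e _ 1).trans (one_smul _ _))
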